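/- **Setting.** For a function $g:\mathbb{R}^2\to\mathbb{R}$ with second partial derivatives write $d^2 g=(g^{(2,0)},g^{(1,1)},g^{(0,2)})^T$, where $g^{(i,j)}=\partial^{i+j}g/\partial x_1^i\partial x_2^j$, and let $$G(u,v,w)=\begin{pmatrix}2u-2w+2v-2\sqrt{(w-u)^2+4v^2}\\ w-u+4v-\sqrt{(w-u)^2+4v^2}\end{pmatrix},$$ so that $G(d^2g(x))$ lies in the eigenspace of the smaller eigenvalue of the Hessian $\nabla^2 g(x)$. For a vector field $W$ on $\mathbb{R}^2$, the integral curve of $W$ starting in $x_0$ is the solution $c:\mathbb{R}\to\mathbb{R}^2$ of $c'(t)=W(c(t))$, $c(0)=x_0$. Let $\xi_1,\xi_2,\dots$ be i.i.d. random points of $\mathbb{R}^2$ with density $f$, let $K:\mathbb{R}^2\to[0,\infty)$, $h_n>0$, and let $$\hat f_n(x)=\frac{1}{nh_n^2}\sum_{i=1}^nK\Big(\frac{x-\xi_i}{h_n}\Big),\qquad V(x)=G(d^2f(x)),\qquad \hat V_n(x)=G(d^2\hat f_n(x)).$$ Let $\mathfrak{X}_{x_0}$ and $\hat{\mathfrak{X}}_{x_0}$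 denote the integral curves of $V$ and of $\hat V_n$ starting in $x_0$. **Assumptions.** - (F1) $f$ is a four times continuously differentiable probability density on $\mathbb{R}^2$ whose partial derivatives of orders one to four are bounded. - (F2) $\mathcal{H}\subset\mathbb{R}^2$ is compact, $f>0$ on the union of the open balls of radius $\varepsilon_0$ with centres in $\mathcal{H}$, for some $\varepsilon_0>0$, and $\nabla^2f(x)$ has two distinct eigenvalues for every $x\in\mathcal{H}$. - (K1) $K$ is a symmetric ($K(-x)=K(x)$), four times differentiable probability density, with support equal to the closed unit ball, whose partial derivatives of orders one to four are bounded, and $\int K(x)xx^T\,dx=\mu_2 I_{2\times2}$ for some $\mu_2<\infty$. - (K2) The matrix $\int d^2K(z)\,d^2K(z)^T\,dz$ is finite. - (H1) As $n\to\infty$: $h_n\to0$, $nh_n^8/(\log n)^3\to\infty$, and $nh_n^9\to\beta$ for some $\beta\ge0$. **Theorem.** Assume (F1), (F2), (K1), (K2) and (H1). Let $\mathcal{L}\subset\mathbb{R}^2$ be any set (for instance a filament, i.e. a set of points where $\langle\nabla f,V\rangle=0$ and the smaller eigenvalue of $\nabla^2f$ is negative), let $a^*\ge0$, and let $$\mathcal{G}=\{\mathfrak{X}_{x_0}(t):\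 x_0\in\mathcal{L},\ -a^*\le t\le a^*\}.$$ Suppose that for every $x_0\in\mathcal{G}$ there are $T^{\min}_{x_0},T^{\max}_{x_0}\ge0$ with $T^{\min}_{x_0}+T^{\max}_{x_0}>0$, depending continuously on $x_0\in\mathcal{G}$, such that $\mathfrak{X}_{x_0}(t)\in\mathcal{H}$ for all $x_0\in\mathcal{G}$ and $t\in[-T^{\min}_{x_0},T^{\max}_{x_0}]$, and that for some $\gamma>0$ $$\inf_{x_0\in\mathcal{G}}\ \inf_{-T^{\min}_{x_0}\le s<u\le T^{\max}_{x_0}}\Big\|\frac1{u-s}\int_s^uV(\mathfrak{X}_{x_0}(\lambda))\,d\lambda\Big\|\ge\gamma.$$ Then $$\sup_{x_0\in\mathcal{G}}\ \sup_{t\in[-T^{\min}_{x_0},T^{\max}_{x_0}]}\big\|\hat{\mathfrak{X}}_{x_0}(t)-\mathfrak{X}_{x_0}(t)\big\|=O_p\Big(\sqrt{\frac{\log n}{nh_n^5}}\Big),$$ i.e. for every $\varepsilon>0$ there is an $M$ such that, for all sufficiently large $n$, the left side exceeds $M\sqrt{\log n/(nh_n^5)}$ with probability at most $\varepsilon$.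 Moreover the curves in question are well defined: for every starting point in $\mathbb{R}^2$ the integral curve of $V$, and for every $n$ and every sample the integral curve of $\hat V_n$, exists on all of $\mathbb{R}$ and is unique. -/

import Mathlib

open MeasureTheory ProbabilityTheory Filter Topology
open scoped ENNReal

noncomputable section

namespace IntegralCurveEstimation

/-- The plane `ℝ²` with its Euclidean norm. -/
abbrev Plane : Type := EuclideanSpace ℝ (Fin 2)

/-- The first order partial derivative `∂g/∂x_i`. -/
def partialDeriv (i : Fin 2) (g : Plane → ℝ) (x : Plane) : ℝ :=
  fderiv ℝ g x (EuclideanSpace.single i 1)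

/-- `d²g(x) = (g^{(2,0)}(x), g^{(1,1)}(x), g^{(0,2)}(x))`. -/
def d2 (g : Plane → ℝ) (x : Plane) : Fin 3 → ℝ :=
  ![partialDeriv 0 (partialDeriv 0 g) x,
    partialDeriv 0 (partialDeriv 1 g) x,
    partialDeriv 1 (partialDeriv 1 g) x]

/-- The Hessian matrix of `g` at `x`. -/
def hessian (g : Plane → ℝ) (x : Plane) : Matrix (Fin 2) (Fin 2) ℝ :=
  !![d2 g x 0, d2 g x 1;
     d2 g x 1, d2 g x 2]

/-- The map `G : ℝ³ → ℝ²` that turns `(u, v, w)` into a vector in the eigenspace of the smaller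
eigenvalue of the symmetric matrix with rows `(u, v)` and `(v, w)`. -/
def eigG (p : Fin 3 → ℝ) : Plane :=
  !₂[2 * p 0 - 2 * p 2 + 2 * p 1 - 2 * √((p 2 - p 0) ^ 2 + 4 * p 1 ^ 2),
     p 2 - p 0 + 4 * p 1 - √((p 2 - p 0) ^ 2 + 4 * p 1 ^ 2)]

/-- The second eigenvector field `V(x) = G(d²g(x))` of the Hessian of `g`. -/
def eigField (g : Plane → ℝ) (x : Plane) : Plane := eigG (d2 g x)

/-- The kernel density estimator with kernel `K` and bandwidth `h` from the first `n` of the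
sample points `y 0, y 1, …`. -/
def kde (K : Plane → ℝ) (h : ℝ) (n : ℕ) (y : ℕ → Plane) (x : Plane) : ℝ :=
  1 / (n * h ^ 2) * ∑ i ∈ Finset.range n, K (h⁻¹ • (x - y i))

/-- `γ` solves `γ' = W(γ)` on the whole line, with `γ(0) = x₀`. -/
def IsIntegralCurveFrom (W : Plane → Plane) (x₀ : Plane) (γ : ℝ → Plane) : Prop :=
  γ 0 = x₀ ∧ ∀ t, HasDerivAt γ (W (γ t)) t

/-- The integral curve driven by `W` that starts in `x₀` (a meaningful object when there is one;
the main statement also claims existence and uniqueness for all the fields it deals with). -/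
def integralCurve (W : Plane → Plane) (x₀ : Plane) : ℝ → Plane :=
  Classical.epsilon (IsIntegralCurveFrom W x₀)

/-- The set `{𝔛_{x₀}(t) : x₀ ∈ L, -a ≤ t ≤ a}` of the points that the integral curves driven by
`W` through `L` reach within time `a`. -/
def startSet (W : Plane → Plane) (L : Set Plane) (a : ℝ) : Set Plane :=
  {x | ∃ x₀ ∈ L, ∃ t ∈ Set.Icc (-a) a, x = integralCurve W x₀ t}

/-- `g` is a probability density function with respect to Lebesgue measure on the plane. -/
structure IsDensity (g : Plane → ℝ) : Prop where
  nonneg : ∀ x, 0 ≤ g x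
  integrable : Integrable g
  integral_eq_one : ∫ x, g x = 1

/-- All partial derivatives of `g` of the orders one to four are bounded (equivalently, the
derivatives of these orders are bounded as multilinear maps). -/
def BoundedDerivs (g : Plane → ℝ) : Prop :=
  ∃ C : ℝ, ∀ m : ℕ, 1 ≤ m → m ≤ 4 → ∀ x, ‖iteratedFDeriv ℝ m g x‖ ≤ C

/-- `f` is a four times continuously differentiable probability density whose partial derivatives
of the orders one to four are bounded. -/
structure SmoothDensity (f : Plane → ℝ) : Prop where
  density : IsDensity f
  contDiff : ContDiff ℝ 4 f
  bounded : BoundedDerivs f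

/-- `H` is compact, `f` is positive on an enlargement of `H`, and the Hessian of `f` has two
distinct eigenvalues at every point of `H`. -/
structure RegularRegion (f : Plane → ℝ) (H : Set Plane) : Prop where
  isCompact : IsCompact H
  pos : ∃ ε₀ > 0, ∀ x ∈ Metric.thickening ε₀ H, 0 < f x
  distinct : ∀ x ∈ H, ∃ a b : ℝ, a ≠ b ∧
    Module.End.HasEigenvalue (Matrix.toLin' (hessian f x)) a ∧
    Module.End.HasEigenvalue (Matrix.toLin' (hessian f x)) b

/-- `K` is a symmetric, four times differentiable probability density that is supported on the unit
ball, has bounded partial derivatives of the orders one to four, and has a scalar second moment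
matrix. -/
structure KernelRegular (K : Plane → ℝ) : Prop where
  density : IsDensity K
  symm : ∀ x, K (-x) = K x
  support : tsupport K = Metric.closedBall 0 1
  differentiable : ∀ m : ℕ, m < 4 → Differentiable ℝ (iteratedFDeriv ℝ m K)
  bounded : BoundedDerivs K
  moment : ∃ μ₂ : ℝ, ∀ i j : Fin 2, ∫ x, K x * (x i * x j) = if i = j then μ₂ else 0

/-- The matrix `∫ d²K(z) d²K(z)ᵀ dz` is finite. -/
def KernelRoughnessFinite (K : Plane → ℝ) : Prop :=
  ∀ i j : Fin 3, Integrable fun z => d2 K z i * d2 K z j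

/-- The conditions on the sequence of bandwidths. -/
structure BandwidthCondition (h : ℕ → ℝ) : Prop where
  pos : ∀ n, 0 < h n
  tendsto_zero : Tendsto h atTop (𝓝 0)
  lower : Tendsto (fun n : ℕ => n * h n ^ 8 / Real.log n ^ 3) atTop atTop
  upper : ∃ β : ℝ, 0 ≤ β ∧ Tendsto (fun n : ℕ => n * h n ^ 9) atTop (𝓝 β)

/-- `ξ 0, ξ 1, …` are independent random points of the plane with common density `f`. -/
structure IsIIDSample {Ω : Type*} [MeasurableSpace Ω] (P : Measure Ω) (f : Plane → ℝ)
    (ξ : ℕ → Ω → Plane) : Prop where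
  measurable : ∀ i, Measurable (ξ i)
  indep : iIndepFun ξ P
  law : ∀ i, P.map (ξ i) = volume.withDensity fun x => ENNReal.ofReal (f x)

/-- `Z_n = O_p(r_n)`: for every `ε > 0` there is a constant `M` with `P(Z_n > M r_n) ≤ ε` for all
large `n`. -/
def IsBigOInProb {Ω : Type*} [MeasurableSpace Ω] (P : Measure Ω) (Z : ℕ → Ω → ℝ≥0∞)
    (r : ℕ → ℝ) : Prop :=
  ∀ ε : ℝ, 0 < ε → ∃ M : ℝ, ∀ᶠ n in atTop,
    P {ω | ENNReal.ofReal (M * r n) < Z n ω} ≤ ENNReal.ofReal ε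

end IntegralCurveEstimation

end

/-!
Both fields are globally Lipschitz, because `eigG` is a linear map minus a multiple of the norm of
`gapVec`, and the second derivatives of `f` and of the estimator are Lipschitz. This gives existence
and uniqueness of the integral curves on the whole line (`existsUnique_integralCurve`).

For the rate, write `V` for the true field, `W` for the estimated one, and `X`, `Y` for their curves
from a common point. By Grönwall's inequality (`norm_sub_le_of_perturbation`), `Y - X` is bounded by
a constant times the supremum of the primitive of `W - V` along `X`, provided that `W` has a
Lipschitz constant of order one near the region. The latter holds because the third derivatives of
the estimator are bounded with high probability. Since the gap between the eigenvalues is bounded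
below on the region, `W - V` is a linear form in the errors of the second derivatives up to a
quadratic remainder (`norm_integral_eigG_sub_le`), and the remainder is negligible: it is the square
of an error of order `√(log n / (n h ^ 6)) + h ^ 2`.

The linear part is integrated along `X` before it is estimated, and this gains a factor `√h` over
its size at single points. By the lower bound on the mean velocities, a curve moves away from each
of its points at least at speed `γ`, so it stays in a ball of radius `h` for a time of order `h`
only. The integral of the rescaled kernel along the curve is therefore a random variable of size
`h` and of first absolute moment `h ^ 2`, hence of second moment `h ^ 3`
(`IsBump.integral_sq_curveAverage_le`). A Bernstein inequality on a net of polynomially many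
starting points and end times (`measure_exists_lt_abs_deviation_le`) turns this into the rate
`√(log n / (n h ^ 5))`, uniformly over the curves. The same inequality, applied at points, controls
the second and third derivatives. The lower bound on the mean velocities also bounds the times
that the curves can spend in the region, which keeps the parameters of the net in a bounded set.

The bias of the second derivatives is of order `h ^ 2` (`abs_smoothing_sub_le`), which is of the
order of the rate because `n h ^ 9` is bounded.
-/

namespace IntegralCurveEstimation

/-! ### Integral curves of Lipschitz fields -/

/-- Clamping of every coordinate of `x` to the interval `[x₀ i - R, x₀ i + R]`. It truncates a
Lipschitz field to a bounded one with the same Lipschitz constant. -/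
noncomputable def clampAt (x₀ : Plane) (R : ℝ) (x : Plane) : Plane :=
  WithLp.toLp 2 fun i => max (x₀ i - R) (min (x₀ i + R) (x i))

lemma lipschitzWith_clampAt (x₀ : Plane) (R : ℝ) : LipschitzWith 1 (clampAt x₀ R) := by
  refine LipschitzWith.of_dist_le_mul fun x y => ?_
  rw [NNReal.coe_one, one_mul, EuclideanSpace.dist_eq, EuclideanSpace.dist_eq]
  refine Real.sqrt_le_sqrt (Finset.sum_le_sum fun i _ => ?_)
  have h : dist (clampAt x₀ R x i) (clampAt x₀ R y i) ≤ dist (x i) (y i) := by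
    simp only [clampAt, Real.dist_eq, max_comm (x₀ i - R)]
    refine (abs_max_sub_max_le_abs _ _ _).trans ?_
    exact (abs_min_sub_min_le_max _ _ _ _).trans (by simp)
  gcongr

lemma clampAt_eq_self {x₀ x : Plane} {R : ℝ} (h : ‖x - x₀‖ ≤ R) : clampAt x₀ R x = x := by
  ext i
  have := abs_le.1 ((PiLp.norm_apply_le (x - x₀) i).trans h)
  simp only [PiLp.sub_apply] at this
  simp only [clampAt]
  rw [min_eq_right (by linarith), max_eq_right (by linarith)]

lemma norm_clampAt_sub_le (x₀ x : Plane) {R : ℝ} (hR : 0 ≤ R) :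
    ‖clampAt x₀ R x - x₀‖ ≤ 2 * R := by
  have h : ∀ i, |clampAt x₀ R x i - x₀ i| ≤ R := fun i => by
    simp only [clampAt]
    rw [abs_le]
    constructor
    · linarith [le_max_left (x₀ i - R) (min (x₀ i + R) (x i))]
    · linarith [max_le (show x₀ i - R ≤ x₀ i + R by linarith) (min_le_left (x₀ i + R) (x i))]
  rw [EuclideanSpace.norm_eq]
  refine Real.sqrt_le_iff.2 ⟨by positivity, ?_⟩
  rw [Fin.sum_univ_two]
  simp only [Real.norm_eq_abs, PiLp.sub_apply]
  nlinarith [h 0, h 1, abs_nonneg (clampAt x₀ R x 0 - x₀ 0), abs_nonneg (clampAt x₀ R x 1 - x₀ 1)]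

variable {W : Plane → Plane} {k : NNReal}

/-- Forward growth estimate: a curve whose velocity is at most `κ ‖c - x₀‖ + B` stays in a
ball whose radius depends on these constants and the time horizon only. -/
lemma norm_sub_le_gronwallBound {c c' : ℝ → Plane} {x₀ : Plane} {B κ T : ℝ} (h0 : c 0 = x₀)
    (hc : ∀ t ∈ Set.Icc 0 T, HasDerivWithinAt c (c' t) (Set.Icc 0 T) t)
    (hb : ∀ t ∈ Set.Icc 0 T, ‖c' t‖ ≤ κ * ‖c t - x₀‖ + B) :
    ∀ t ∈ Set.Icc 0 T, ‖c t - x₀‖ ≤ gronwallBound 0 κ B t := by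
  have := norm_le_gronwallBound_of_norm_deriv_right_le (f := fun t => c t - x₀) (f' := c')
    (δ := 0) (K := κ) (ε := B) (a := 0) (b := T)
    (fun t ht => ((hc t ht).sub_const x₀).continuousWithinAt)
    (fun t ht => ((hc t (Set.Ico_subset_Icc_self ht)).sub_const x₀).mono_of_mem_nhdsWithin
      (Icc_mem_nhdsGE_of_mem ht))
    (by simp [h0]) (fun t ht => hb t (Set.Ico_subset_Icc_self ht))
  simpa using this

/-- A bounded Lipschitz field satisfies the hypotheses of the Picard-Lindelöf theorem on every time
interval. The solution for the truncated field stays where the truncation has no effect. -/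
lemma exists_integralCurve_Ioo (hW : LipschitzWith k W) (x₀ : Plane) {T : ℝ} (hT : 0 < T) :
    ∃ c : ℝ → Plane, c 0 = x₀ ∧ ∀ t ∈ Set.Ioo (-T) T, HasDerivAt c (W (c t)) t := by
  -- The radius `R` bounds, by Grönwall, every solution up to time `T`, truncated or not.
  set R : ℝ := gronwallBound 0 k ‖W x₀‖ T with hR
  have hR0 : 0 ≤ R := by
    rw [hR]
    have := gronwallBound_mono le_rfl (norm_nonneg (W x₀)) k.2 hT.le
    rwa [gronwallBound_x0] at this
  set U : Plane → Plane := W ∘ clampAt x₀ R with hU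
  have hUL : LipschitzWith k U := by simpa using hW.comp (lipschitzWith_clampAt x₀ R)
  have hUx : U x₀ = W x₀ := by simp [hU, clampAt_eq_self (x₀ := x₀) (x := x₀) (by simpa using hR0)]
  have hgrow : ∀ x, ‖U x‖ ≤ k * ‖x - x₀‖ + ‖W x₀‖ := fun x => by
    have h1 := hUL.dist_le_mul x x₀
    rw [dist_eq_norm, dist_eq_norm, hUx] at h1
    linarith [norm_le_norm_sub_add (U x) (W x₀)]
  have hbd : ∀ x, ‖U x‖ ≤ k * (2 * R) + ‖W x₀‖ := fun x => by
    have h1 := hW.dist_le_mul (clampAt x₀ R x) x₀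
    rw [dist_eq_norm, dist_eq_norm] at h1
    have h2 := mul_le_mul_of_nonneg_left (norm_clampAt_sub_le x₀ x hR0) k.2
    have h3 := norm_le_norm_sub_add (U x) (W x₀)
    simp only [hU, Function.comp_apply] at h3 ⊢
    simp only [NNReal.val_eq_coe] at h2
    linarith
  set M : NNReal := ⟨k * (2 * R) + ‖W x₀‖, by positivity⟩ with hM
  have h0 : (0 : ℝ) ∈ Set.Icc (-T) T := ⟨by linarith, hT.le⟩
  have hPL : IsPicardLindelof (fun _ => U) (⟨0, h0⟩ : Set.Icc (-T) T) x₀ (M * ⟨T, hT.le⟩) 0 M k :=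
    { lipschitzOnWith := fun _ _ => hUL.lipschitzOnWith
      continuousOn := fun _ _ => continuousOn_const
      norm_le := fun _ _ x _ => hbd x
      mul_max_le := by simp [-NNReal.val_eq_coe]; exact le_of_eq rfl }
  obtain ⟨c, hc0, hc⟩ := hPL.exists_eq_forall_mem_Icc_hasDerivWithinAt₀
  simp only at hc0
  have hfwd : ∀ t ∈ Set.Icc 0 T, ‖c t - x₀‖ ≤ R := fun t ht => by
    refine (norm_sub_le_gronwallBound hc0 (c' := fun t => U (c t))
      (fun s hs => (hc s ⟨by linarith [hs.1], hs.2⟩).mono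
        (Set.Icc_subset_Icc_left (by linarith)))
      (fun s _ => hgrow (c s)) t ht).trans ?_
    exact gronwallBound_mono le_rfl (norm_nonneg _) k.2 ht.2
  have hbwd : ∀ t ∈ Set.Icc 0 T, ‖c (-t) - x₀‖ ≤ R := fun t ht => by
    refine (norm_sub_le_gronwallBound (c := fun t => c (-t)) (c' := fun t => -U (c (-t)))
      (by simpa using hc0) (fun s hs => ?_) (fun s _ => ?_) t ht).trans
      (gronwallBound_mono le_rfl (norm_nonneg (W x₀)) k.2 ht.2)
    · have h1 := hc (-s) ⟨by linarith [hs.2], by linarith [hs.1]⟩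
      have h2 := h1.scomp s ((hasDerivAt_id s).neg.hasDerivWithinAt (s := Set.Icc 0 T))
        (fun r hr => ⟨neg_le_neg hr.2, (neg_nonpos.2 hr.1).trans hT.le⟩)
      simpa [Function.comp_def] using h2
    · rw [norm_neg]
      exact hgrow _
  have hall : ∀ t ∈ Set.Icc (-T) T, U (c t) = W (c t) := fun t ht => by
    have : ‖c t - x₀‖ ≤ R := by
      rcases le_total 0 t with h | h
      · exact hfwd t ⟨h, ht.2⟩
      · simpa using hbwd (-t) ⟨by linarith, by linarith [ht.1]⟩
    simp [hU, clampAt_eq_self this]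
  refine ⟨c, hc0, fun t ht => ?_⟩
  rw [← hall t (Set.Ioo_subset_Icc_self ht)]
  exact (hc t (Set.Ioo_subset_Icc_self ht)).hasDerivAt (Icc_mem_nhds ht.1 ht.2)

/-- A globally Lipschitz field has exactly one integral curve, defined for all times, through every
point. -/
theorem existsUnique_integralCurve (hW : LipschitzWith k W) (x₀ : Plane) :
    ∃! c, IsIntegralCurveFrom W x₀ c := by
  choose! c hc0 hc using fun T (hT : (0 : ℝ) < T) => exists_integralCurve_Ioo hW x₀ hT
  have hagree : ∀ T T' : ℝ, 0 < T → T ≤ T' → Set.EqOn (c T) (c T') (Set.Ioo (-T) T) :=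
    fun T T' hT hTT' => by
    refine ODE_solution_unique_of_mem_Ioo (v := fun _ => W) (s := fun _ => Set.univ) (K := k)
      (t₀ := 0) (fun _ _ => hW.lipschitzOnWith) ⟨by linarith, hT⟩
      (fun t ht => ⟨hc T hT t ht, trivial⟩)
      (fun t ht => ⟨hc T' (by linarith) t ⟨by linarith [ht.1], by linarith [ht.2]⟩, trivial⟩) ?_
    rw [hc0 T hT, hc0 T' (by linarith)]
  refine ⟨fun t => c (|t| + 1) t, ⟨?_, fun t => ?_⟩, fun c' hc' => ?_⟩
  · exact hc0 _ (by positivity)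
  · have hd := hc (|t| + 2) (by positivity) t
      ⟨by linarith [neg_abs_le t], by linarith [le_abs_self t]⟩
    have he : (fun s => c (|s| + 1) s) =ᶠ[𝓝 t] c (|t| + 2) := by
      filter_upwards [Ioo_mem_nhds (show t - 1 < t by linarith) (show t < t + 1 by linarith)]
        with s hs
      have hs' : |s| ≤ |t| + 1 := by
        have : |s - t| ≤ 1 := abs_le.2 ⟨by linarith [hs.1], by linarith [hs.2]⟩
        linarith [abs_sub_abs_le_abs_sub s t]
      exact hagree _ _ (by positivity) (by linarith)
        ⟨by linarith [neg_abs_le s], by linarith [le_abs_self s]⟩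
    have := hd.congr_of_eventuallyEq he
    rwa [← he.self_of_nhds] at this
  · funext t
    refine ODE_solution_unique_of_mem_Ioo (v := fun _ => W) (s := fun _ => Set.univ) (K := k)
      (t₀ := 0) (a := -(|t| + 1)) (b := |t| + 1) (fun _ _ => hW.lipschitzOnWith)
      ⟨by linarith [abs_nonneg t], by linarith [abs_nonneg t]⟩
      (fun s _ => ⟨hc'.2 s, trivial⟩)
      (fun s hs => ⟨hc (|t| + 1) (by positivity) s hs, trivial⟩) ?_
      ⟨by linarith [neg_abs_le t], by linarith [le_abs_self t]⟩
    rw [hc'.1, hc0 _ (by positivity)]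

lemma isIntegralCurveFrom_integralCurve (hW : LipschitzWith k W) (x₀ : Plane) :
    IsIntegralCurveFrom W x₀ (integralCurve W x₀) :=
  Classical.epsilon_spec (existsUnique_integralCurve hW x₀).exists

lemma IsIntegralCurveFrom.reverse {x₀ : Plane} {c : ℝ → Plane} (hc : IsIntegralCurveFrom W x₀ c) :
    IsIntegralCurveFrom (fun x => -W x) x₀ (fun t => c (-t)) := by
  refine ⟨by simpa using hc.1, fun t => ?_⟩
  have := (hc.2 (-t)).scomp t (hasDerivAt_id t).neg
  simpa [Function.comp_def] using this

lemma IsIntegralCurveFrom.continuous {x₀ : Plane} {c : ℝ → Plane}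
    (hc : IsIntegralCurveFrom W x₀ c) : Continuous c :=
  continuous_iff_continuousAt.2 fun t => (hc.2 t).continuousAt

/-- The integral curves of a Lipschitz field depend on their starting points in a Lipschitz way,
uniformly over bounded times. -/
lemma IsIntegralCurveFrom.norm_sub_le (hW : LipschitzWith k W) {x y : Plane} {c d : ℝ → Plane}
    (hc : IsIntegralCurveFrom W x c) (hd : IsIntegralCurveFrom W y d) {t T : ℝ} (ht : |t| ≤ T) :
    ‖c t - d t‖ ≤ ‖x - y‖ * Real.exp (k * T) := by
  have key : ∀ (U : Plane → Plane) (c d : ℝ → Plane), LipschitzWith k U →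
      IsIntegralCurveFrom U x c → IsIntegralCurveFrom U y d → ∀ s, 0 ≤ s → s ≤ T →
      ‖c s - d s‖ ≤ ‖x - y‖ * Real.exp (k * T) := fun U c d hU hc hd s hs hsT => by
    have := dist_le_of_trajectories_ODE (v := fun _ => U) (K := k) (f := c) (g := d) (a := 0)
      (b := s) (δ := ‖x - y‖) (fun _ => hU) hc.continuous.continuousOn
      (fun t _ => (hc.2 t).hasDerivWithinAt) hd.continuous.continuousOn
      (fun t _ => (hd.2 t).hasDerivWithinAt) (by rw [hc.1, hd.1, dist_eq_norm]) s ⟨hs, le_rfl⟩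
    rw [dist_eq_norm, sub_zero] at this
    refine this.trans ?_
    gcongr
  rcases le_total 0 t with h | h
  · exact key W c d hW hc hd t h ((le_abs_self t).trans ht)
  · have := key _ _ _ (hW.neg) hc.reverse hd.reverse (-t) (by linarith)
      ((neg_le_abs t).trans ht)
    simpa using this

lemma integral_field_along_curve {W : Plane → Plane} (hW : Continuous W) {x₀ : Plane}
    {c : ℝ → Plane} (hc : IsIntegralCurveFrom W x₀ c) (s u : ℝ) :
    ∫ l in s..u, W (c l) = c u - c s :=
  intervalIntegral.integral_eq_sub_of_hasDerivAt (fun t _ => hc.2 t)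
    ((hW.comp hc.continuous).intervalIntegrable _ _)

/-- Perturbation of an integral curve in forward time. The field `W` need only be Lipschitz on a
ball that contains a unit neighbourhood of the unperturbed curve `X`, and the size of the
perturbation is measured by the primitive of `W - V` along `X`, not by `W - V` itself. -/
lemma norm_sub_le_of_perturbation_forward {V W : Plane → Plane} (hV : Continuous V)
    (hW : Continuous W) {x : Plane} {X Y : ℝ → Plane} (hX : IsIntegralCurveFrom V x X)
    (hY : IsIntegralCurveFrom W x Y) {R Λ δ T : ℝ} (hΛ : 0 < Λ) (hδ : 0 ≤ δ)
    (hball : ∀ t ∈ Set.Icc 0 T, ‖X t‖ ≤ R - 1)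
    (hLip : ∀ p q, ‖p‖ ≤ R → ‖q‖ ≤ R → ‖W p - W q‖ ≤ Λ * ‖p - q‖)
    (hA : ∀ t ∈ Set.Icc 0 T, ‖∫ l in (0 : ℝ)..t, (W (X l) - V (X l))‖ ≤ δ)
    (hsmall : δ * Real.exp (Λ * T) < 1) :
    ∀ t ∈ Set.Icc 0 T, ‖Y t - X t‖ ≤ δ * Real.exp (Λ * T) := by
  set A : ℝ → Plane := fun t => ∫ l in (0 : ℝ)..t, (W (X l) - V (X l)) with hAdef
  have hcont : Continuous fun l => W (X l) - V (X l) :=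
    (hW.comp hX.continuous).sub (hV.comp hX.continuous)
  have hAd : ∀ t, HasDerivAt A (W (X t) - V (X t)) t := fun t =>
    intervalIntegral.integral_hasDerivAt_right (hcont.intervalIntegrable _ _)
      (hcont.stronglyMeasurableAtFilter _ _) hcont.continuousAt
  have hec : Continuous fun t => ‖Y t - X t‖ := (hY.continuous.sub hX.continuous).norm
  have key : ∀ s ∈ Set.Icc 0 T, (∀ r ∈ Set.Ico 0 s, ‖Y r - X r‖ ≤ 1) →
      ‖Y s - X s‖ ≤ δ * Real.exp (Λ * T) := fun s hs hr => by
    have hd : ∀ t, HasDerivAt (fun t => Y t - X t - A t) (W (Y t) - W (X t)) t := fun t => by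
      have := ((hY.2 t).sub (hX.2 t)).sub (hAd t)
      convert! this using 1
      abel
    have h1 := norm_le_gronwallBound_of_norm_deriv_right_le (f := fun t => Y t - X t - A t)
      (f' := fun t => W (Y t) - W (X t)) (δ := 0) (K := Λ) (ε := Λ * δ) (a := 0) (b := s)
      (fun t _ => (hd t).continuousAt.continuousWithinAt)
      (fun t _ => (hd t).hasDerivWithinAt) (by simp [hX.1, hY.1, hAdef])
      (fun t ht => by
        have htT : t ∈ Set.Icc 0 T := ⟨ht.1, ht.2.le.trans hs.2⟩
        have hXt := hball t htT
        have hYt : ‖Y t‖ ≤ R := by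
          have := norm_le_norm_sub_add (Y t) (X t)
          linarith [hr t ht]
        have h2 := hLip (Y t) (X t) hYt (by linarith)
        have h3 : ‖Y t - X t‖ ≤ ‖Y t - X t - A t‖ + ‖A t‖ := norm_le_norm_sub_add _ _
        have h4 := hA t htT
        calc ‖W (Y t) - W (X t)‖ ≤ Λ * ‖Y t - X t‖ := h2
          _ ≤ Λ * (‖Y t - X t - A t‖ + δ) := by gcongr; linarith
          _ = _ := by ring) s ⟨hs.1, le_rfl⟩
    rw [gronwallBound_of_K_ne_0 hΛ.ne'] at h1
    have h5 : Λ * δ / Λ = δ := by field_simp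
    simp only [zero_mul, zero_add, sub_zero, h5] at h1
    have h3 : ‖Y s - X s‖ ≤ ‖Y s - X s - A s‖ + ‖A s‖ := norm_le_norm_sub_add _ _
    have h4 := hA s hs
    have h6 : δ * Real.exp (Λ * s) ≤ δ * Real.exp (Λ * T) := by
      gcongr
      exact hs.2
    linarith
  -- At the first time at which the distance reaches `1` it would be smaller than `1`.
  have hone : ∀ t ∈ Set.Icc 0 T, ‖Y t - X t‖ < 1 := by
    by_contra! hcon
    obtain ⟨t₀, ht₀, h₀⟩ := hcon
    have hcpt : IsCompact (Set.Icc 0 T ∩ {t | 1 ≤ ‖Y t - X t‖}) :=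
      isCompact_Icc.inter_right (isClosed_le continuous_const hec)
    obtain ⟨s, ⟨hs, hs1⟩, hmin⟩ := hcpt.exists_isLeast ⟨t₀, ht₀, h₀⟩
    have := key s hs fun r hr => by
      by_contra! h
      exact absurd (hmin ⟨⟨hr.1, hr.2.le.trans hs.2⟩, h.le⟩) (not_le.2 hr.2)
    exact absurd (hs1.trans this) (not_le.2 hsmall)
  exact fun t ht => key t ht fun r hr => (hone r ⟨hr.1, hr.2.le.trans ht.2⟩).le

/-- Perturbation of an integral curve over a time interval that contains `0`. -/
lemma norm_sub_le_of_perturbation {V W : Plane → Plane} (hV : Continuous V)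
    (hW : Continuous W) {x : Plane} {X Y : ℝ → Plane} (hX : IsIntegralCurveFrom V x X)
    (hY : IsIntegralCurveFrom W x Y) {R Λ δ T a b : ℝ} (hΛ : 0 < Λ) (hδ : 0 ≤ δ)
    (ha : 0 ≤ a) (hb : 0 ≤ b) (haT : a ≤ T) (hbT : b ≤ T)
    (hball : ∀ t ∈ Set.Icc (-a) b, ‖X t‖ ≤ R - 1)
    (hLip : ∀ p q, ‖p‖ ≤ R → ‖q‖ ≤ R → ‖W p - W q‖ ≤ Λ * ‖p - q‖)
    (hA : ∀ t ∈ Set.Icc (-a) b, ‖∫ l in (0 : ℝ)..t, (W (X l) - V (X l))‖ ≤ δ)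
    (hsmall : δ * Real.exp (Λ * T) < 1) :
    ∀ t ∈ Set.Icc (-a) b, ‖Y t - X t‖ ≤ δ * Real.exp (Λ * T) := by
  have hexp : ∀ s, s ≤ T → δ * Real.exp (Λ * s) ≤ δ * Real.exp (Λ * T) := fun s hs => by gcongr
  intro t ht
  rcases le_total 0 t with h | h
  · exact (norm_sub_le_of_perturbation_forward hV hW hX hY hΛ hδ (T := b)
      (fun s hs => hball s ⟨by linarith [hs.1], hs.2⟩) hLip
      (fun s hs => hA s ⟨by linarith [hs.1], hs.2⟩) ((hexp b hbT).trans_lt hsmall) t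
      ⟨h, ht.2⟩).trans (hexp b hbT)
  · have := (norm_sub_le_of_perturbation_forward hV.neg hW.neg hX.reverse hY.reverse hΛ hδ
      (T := a) (R := R)
      (fun s hs => hball (-s) ⟨by linarith [hs.2], by linarith [hs.1]⟩)
      (fun p q hp hq => by
        rw [Pi.neg_apply, Pi.neg_apply, ← neg_sub', norm_neg]
        exact hLip p q hp hq)
      (fun s hs => by
        have h1 := hA (-s) ⟨by linarith [hs.2], by linarith [hs.1]⟩
        have h2 := intervalIntegral.integral_comp_neg (a := 0) (b := s)
          (fun l => W (X l) - V (X l))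
        rw [neg_zero, intervalIntegral.integral_symm (0 : ℝ) (-s)] at h2
        have h3 : (∫ l in (0 : ℝ)..s, (-W (X (-l)) - -V (X (-l))))
            = -∫ l in (0 : ℝ)..s, (W (X (-l)) - V (X (-l))) := by
          rw [← intervalIntegral.integral_neg]
          congr 1; funext l; abel
        simp only [Pi.neg_apply]
        rw [h3, norm_neg, h2, norm_neg]
        exact h1)
      ((hexp a haT).trans_lt hsmall) (-t) ⟨by linarith, by linarith [ht.1]⟩).trans (hexp a haT)
    simpa using this

/-! ### Uniform concentration of empirical means -/

section Concentration

variable {E Ω : Type*} [MeasurableSpace E] [MeasurableSpace Ω] {P : Measure Ω}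
  {μ : Measure E} {ξ : ℕ → Ω → E} {g : E → ℝ} {b v : ℝ}

/-- The deviation of the empirical mean of `g` over `n` sample points from the mean of `g`. -/
noncomputable def deviation (μ : Measure E) (g : E → ℝ) (n : ℕ) (y : ℕ → E) : ℝ :=
  (n : ℝ)⁻¹ * ∑ i ∈ Finset.range n, g (y i) - ∫ x, g x ∂μ

lemma integrable_of_abs_le [IsFiniteMeasure μ] (hg : Measurable g) (hb : ∀ x, |g x| ≤ b) :
    Integrable g μ :=
  Integrable.of_bound hg.aestronglyMeasurable b (ae_of_all _ hb)

/-- Exponential moments of a bounded centred variable, in terms of its second moment; the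
variance in the exponent is what makes the deviation inequalities below of Bernstein type. -/
lemma integral_exp_centered_le [IsProbabilityMeasure μ] (hg : Measurable g)
    (hb : ∀ x, |g x| ≤ b) (hv : ∫ x, g x ^ 2 ∂μ ≤ v) {l : ℝ} (hl : 0 ≤ l) (hlb : 2 * b * l ≤ 1) :
    ∫ x, Real.exp (l * (g x - ∫ z, g z ∂μ)) ∂μ ≤ Real.exp (l ^ 2 * v) := by
  set m := ∫ z, g z ∂μ with hm
  have hgi : Integrable g μ := integrable_of_abs_le hg hb
  have hg2 : Integrable (fun x => g x ^ 2) μ :=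
    integrable_of_abs_le (b := b ^ 2) (hg.pow_const 2) fun x => by
      rw [abs_pow]
      exact pow_le_pow_left₀ (abs_nonneg _) (hb x) 2
  have hmb : |m| ≤ b := by
    have := norm_integral_le_of_norm_le_const (μ := μ) (f := g) (C := b) (ae_of_all _ hb)
    simpa using this
  have hbd : ∀ x, |l * (g x - m)| ≤ 1 := fun x => by
    rw [abs_mul, abs_of_nonneg hl]
    have : |g x - m| ≤ 2 * b := (abs_sub _ _).trans (by linarith [hb x])
    nlinarith
  have hpt : ∀ x, Real.exp (l * (g x - m)) ≤
      1 + l * (g x - m) + (l ^ 2 * g x ^ 2 - 2 * l ^ 2 * m * g x + l ^ 2 * m ^ 2) := fun x => by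
    have := (abs_le.1 (Real.abs_exp_sub_one_sub_id_le (hbd x))).2
    nlinarith
  have hei : Integrable (fun x => Real.exp (l * (g x - m))) μ :=
    integrable_of_abs_le (b := Real.exp 1) (by fun_prop) fun x => by
      rw [abs_of_pos (Real.exp_pos _)]
      exact Real.exp_le_exp.2 ((le_abs_self _).trans (hbd x))
  calc ∫ x, Real.exp (l * (g x - m)) ∂μ
      ≤ ∫ x, (1 + l * (g x - m) + (l ^ 2 * g x ^ 2 - 2 * l ^ 2 * m * g x + l ^ 2 * m ^ 2)) ∂μ :=
        integral_mono hei (by fun_prop) hpt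
    _ = 1 + l ^ 2 * (∫ x, g x ^ 2 ∂μ) - l ^ 2 * m ^ 2 := by
        have h1 : Integrable (fun x => l * (g x - m)) μ := by fun_prop
        rw [integral_add (by fun_prop) (by fun_prop), integral_add (by fun_prop) h1,
          integral_add (by fun_prop) (by fun_prop), integral_sub (by fun_prop) (by fun_prop),
          integral_const_mul, integral_sub hgi (by fun_prop), integral_const_mul,
          integral_const_mul, ← hm]
        simp
        ring
    _ ≤ l ^ 2 * v + 1 := by nlinarith [sq_nonneg l, sq_nonneg (l * m)]
    _ ≤ Real.exp (l ^ 2 * v) := Real.add_one_le_exp _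

lemma measure_le_deviation_le [IsProbabilityMeasure P] [IsProbabilityMeasure μ]
    (hξ : ∀ i, Measurable (ξ i)) (hind : iIndepFun ξ P) (hlaw : ∀ i, P.map (ξ i) = μ)
    (hg : Measurable g) (hb : ∀ x, |g x| ≤ b) (hv : ∫ x, g x ^ 2 ∂μ ≤ v) {l : ℝ}
    (hl : 0 ≤ l) (hlb : 2 * b * l ≤ 1) {n : ℕ} (hn : 0 < n) (τ : ℝ) :
    P.real {ω | τ ≤ deviation μ g n fun i => ξ i ω} ≤
      Real.exp (n * (l ^ 2 * v) - l * (n * τ)) := by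
  set m := ∫ z, g z ∂μ with hm
  set X : ℕ → Ω → ℝ := fun i ω => g (ξ i ω) - m with hX
  have hXm : ∀ i, Measurable (X i) := fun i => (hg.comp (hξ i)).sub_const m
  have hXi : iIndepFun X P := hind.comp (fun _ x => g x - m) fun _ => hg.sub_const m
  have hmgf : ∀ i, mgf (X i) P l ≤ Real.exp (l ^ 2 * v) := fun i => by
    have h1 := integral_exp_centered_le hg hb hv hl hlb
    rw [← hlaw i, integral_map (hξ i).aemeasurable
      (by fun_prop), hlaw i] at h1
    exact h1
  have hmb : |m| ≤ b := by
    have := norm_integral_le_of_norm_le_const (μ := μ) (f := g) (C := b) (ae_of_all _ hb)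
    simpa using this
  have hXb : ∀ i ω, |X i ω| ≤ 2 * b := fun i ω =>
    (abs_sub _ _).trans (by linarith [hb (ξ i ω)])
  have hset : {ω | τ ≤ deviation μ g n fun i => ξ i ω}
      = {ω | n * τ ≤ (∑ i ∈ Finset.range n, X i) ω} := by
    ext ω
    have hn' : (0 : ℝ) < n := by exact_mod_cast hn
    simp only [Set.mem_ofPred_eq, deviation, Finset.sum_apply, hX, Finset.sum_sub_distrib,
      Finset.sum_const, Finset.card_range, nsmul_eq_mul]
    rw [← mul_le_mul_iff_right₀ hn', mul_sub, mul_inv_cancel_left₀ hn'.ne']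
  have hint : Integrable (fun ω => Real.exp (l * (∑ i ∈ Finset.range n, X i) ω)) P :=
    integrable_of_abs_le (b := Real.exp (l * (n * (2 * b)))) (by
      have : Measurable (∑ i ∈ Finset.range n, X i) := by
        convert! Finset.measurable_sum (Finset.range n) fun i _ => hXm i using 1
        funext ω
        simp
      fun_prop) fun ω => by
      rw [abs_of_pos (Real.exp_pos _), Real.exp_le_exp]
      gcongr
      rw [Finset.sum_apply]
      refine (Finset.sum_le_card_nsmul _ _ (2 * b) fun i _ =>
        (le_abs_self _).trans (hXb i ω)).trans (by simp)
  rw [hset]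
  refine (measure_ge_le_exp_mul_mgf _ hl hint).trans ?_
  rw [hXi.mgf_sum hXm]
  have hprod : ∏ i ∈ Finset.range n, mgf (X i) P l ≤ Real.exp (n * (l ^ 2 * v)) := by
    rw [Real.exp_nat_mul]
    refine (Finset.prod_le_prod (fun i _ => mgf_nonneg) fun i _ => hmgf i).trans (by simp)
  calc Real.exp (-l * (n * τ)) * ∏ i ∈ Finset.range n, mgf (X i) P l
      ≤ Real.exp (-l * (n * τ)) * Real.exp (n * (l ^ 2 * v)) := by gcongr
    _ = _ := by rw [← Real.exp_add]; ring_nf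

lemma deviation_neg (n : ℕ) (y : ℕ → E) :
    deviation μ (fun x => -g x) n y = -deviation μ g n y := by
  simp only [deviation, Finset.sum_neg_distrib, integral_neg]
  ring

/-- Bernstein's inequality at a logarithmic deviation level. The factor `8` makes the probability
of order `n ^ (-7)`, which leaves room for a union bound over `n ^ 6` events. -/
lemma measure_log_le_abs_deviation_le [IsProbabilityMeasure P] [IsProbabilityMeasure μ]
    (hξ : ∀ i, Measurable (ξ i)) (hind : iIndepFun ξ P) (hlaw : ∀ i, P.map (ξ i) = μ)
    (hg : Measurable g) (hb : ∀ x, |g x| ≤ b) (hb0 : 0 ≤ b) (hv : ∫ x, g x ^ 2 ∂μ ≤ v)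
    (hv0 : 0 < v) {n : ℕ} (hn : 2 ≤ n) (hbv : 4 * b ^ 2 * Real.log n ≤ n * v) :
    P {ω | 8 * √(v * Real.log n / n) ≤ |deviation μ g n fun i => ξ i ω|} ≤
      ENNReal.ofReal (2 / n ^ 7) := by
  have hn0 : (0 : ℝ) < n := by positivity
  have hlog : 0 < Real.log n := Real.log_pos (by exact_mod_cast hn)
  -- With this exponent the two terms of the Chernoff exponent are `log n` and `-8 log n`.
  set l := √(Real.log n / (n * v)) with hl
  have hl2 : l ^ 2 = Real.log n / (n * v) := Real.sq_sqrt (by positivity)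
  have hl0 : 0 ≤ l := Real.sqrt_nonneg _
  have hlb : 2 * b * l ≤ 1 := by
    refine (sq_le_one_iff₀ (by positivity)).1 ?_
    rw [mul_pow, hl2, ← mul_div_assoc, div_le_one (by positivity)]
    nlinarith
  have hlt : l * (n * (8 * √(v * Real.log n / n))) = 8 * Real.log n := by
    have h1 : l * √(v * Real.log n / n) = Real.log n / n := by
      rw [hl, ← Real.sqrt_mul (by positivity)]
      rw [show Real.log n / (n * v) * (v * Real.log n / n) = (Real.log n / n) ^ 2 by
        field_simp]
      exact Real.sqrt_sq (by positivity)
    calc _ = 8 * n * (l * √(v * Real.log n / n)) := by ring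
      _ = _ := by rw [h1]; field_simp
  have hexp : Real.exp (n * (l ^ 2 * v) - l * (n * (8 * √(v * Real.log n / n)))) = 1 / n ^ 7 := by
    rw [hlt, hl2, show (n : ℝ) * (Real.log n / (n * v) * v) - 8 * Real.log n
      = -(7 * Real.log n) by field_simp; ring, Real.exp_neg,
      show (7 : ℝ) * Real.log n = (7 : ℕ) * Real.log n by norm_num, Real.exp_nat_mul,
      Real.exp_log hn0, one_div]
  have h1 := measure_le_deviation_le hξ hind hlaw hg hb hv hl0 hlb (by lia : 0 < n)
    (8 * √(v * Real.log n / n))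
  have h2 := measure_le_deviation_le hξ hind hlaw hg.neg (b := b) (v := v)
    (fun x => by simpa using hb x) (by simpa using hv) hl0 hlb (by lia : 0 < n)
    (8 * √(v * Real.log n / n))
  rw [hexp] at h1 h2
  simp only [Pi.neg_def, deviation_neg] at h2
  rw [measureReal_def, ← ENNReal.le_ofReal_iff_toReal_le (measure_ne_top _ _) (by positivity)]
    at h1 h2
  calc P {ω | 8 * √(v * Real.log n / n) ≤ |deviation μ g n fun i => ξ i ω|}
      ≤ P ({ω | 8 * √(v * Real.log n / n) ≤ deviation μ g n fun i => ξ i ω} ∪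
          {ω | 8 * √(v * Real.log n / n) ≤ -deviation μ g n fun i => ξ i ω}) :=
        measure_mono fun ω hω => by
          rw [Set.mem_ofPred_eq] at hω
          simpa only [Set.mem_union, Set.mem_ofPred_eq] using le_abs.1 hω
    _ ≤ _ := measure_union_le _ _
    _ ≤ ENNReal.ofReal (1 / n ^ 7) + ENNReal.ofReal (1 / n ^ 7) := add_le_add h1 h2
    _ = ENNReal.ofReal (2 / n ^ 7) := by
        rw [← ENNReal.ofReal_add (by positivity) (by positivity)]
        ring_nf

/-- A family with a bounded system of `d` real coordinates has a finite net of polynomial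
cardinality. The net consists of members of the family: one from every cell of a grid that
contains one. -/
lemma exists_finset_net {S : Type*} {d : ℕ} (ι : S → Fin d → ℝ) {R ρ : ℝ}
    (hR : ∀ s i, |ι s i| ≤ R) (hR0 : 0 ≤ R) (hρ : 0 < ρ) :
    ∃ N : Finset S, (N.card : ℝ) ≤ (2 * (R / ρ) + 3) ^ d ∧
      ∀ s, ∃ s' ∈ N, ∀ i, |ι s i - ι s' i| ≤ ρ := by
  classical
  set cell : S → Fin d → ℤ := fun s i => ⌊ι s i / ρ⌋ with hcell
  set m : ℕ := ⌈R / ρ⌉₊ with hm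
  have hmem : ∀ s, cell s ∈ Fintype.piFinset fun _ : Fin d => Finset.Icc (-(m : ℤ)) m := fun s => by
    rw [Fintype.mem_piFinset]
    intro i
    rw [Finset.mem_Icc]
    have h1 : R / ρ ≤ m := Nat.le_ceil _
    have h2 := abs_le.1 (hR s i)
    have h3 : ι s i / ρ ≤ m := (div_le_div_of_nonneg_right h2.2 hρ.le).trans h1
    have h4 : -(m : ℝ) ≤ ι s i / ρ := by
      have := div_le_div_of_nonneg_right h2.1 hρ.le
      rw [neg_div] at this
      linarith
    refine ⟨Int.le_floor.2 (by push_cast; exact h4), ?_⟩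
    exact_mod_cast (Int.floor_le (ι s i / ρ)).trans h3
  set C := (Fintype.piFinset fun _ : Fin d => Finset.Icc (-(m : ℤ)) m).filter
    (· ∈ Set.range cell) with hC
  have hrep : ∀ c ∈ C, ∃ s, cell s = c := fun c hc => (Finset.mem_filter.1 hc).2
  choose rep hrep using hrep
  refine ⟨C.attach.image fun c => rep c.1 c.2, ?_, fun s => ?_⟩
  · have h1 : C.card ≤ (2 * m + 1) ^ d := by
      refine (Finset.card_filter_le _ _).trans ?_
      rw [Fintype.card_piFinset]
      simp only [Int.card_Icc, Finset.prod_const, Finset.card_univ, Fintype.card_fin]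
      gcongr
      lia
    have h2 : (m : ℝ) ≤ R / ρ + 1 := (Nat.ceil_lt_add_one (by positivity)).le
    calc ((C.attach.image _).card : ℝ) ≤ C.card := by
          exact_mod_cast Finset.card_image_le.trans (by simp)
      _ ≤ (2 * m + 1 : ℝ) ^ d := by exact_mod_cast h1
      _ ≤ _ := by
        refine pow_le_pow_left₀ (by positivity) ?_ d
        linarith
  · have hs : cell s ∈ C := Finset.mem_filter.2 ⟨hmem s, s, rfl⟩
    refine ⟨rep (cell s) hs, Finset.mem_image.2 ⟨⟨cell s, hs⟩, Finset.mem_attach _ _, rfl⟩,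
      fun i => ?_⟩
    have h1 : ⌊ι (rep (cell s) hs) i / ρ⌋ = ⌊ι s i / ρ⌋ := congrFun (hrep _ hs) i
    have h2 := (Int.abs_sub_lt_one_of_floor_eq_floor h1.symm).le
    rw [← sub_div, abs_div, abs_of_pos hρ, div_le_one hρ] at h2
    exact h2

/-- Bernstein's inequality, uniformly over a family that depends on three real parameters in a
Lipschitz way: a union bound over a net of mesh `1 / n ^ 2`. -/
lemma measure_exists_lt_abs_deviation_le [IsProbabilityMeasure P] [IsProbabilityMeasure μ]
    (hξ : ∀ i, Measurable (ξ i)) (hind : iIndepFun ξ P) (hlaw : ∀ i, P.map (ξ i) = μ)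
    {S : Type*} (ι : S → Fin 3 → ℝ) {R : ℝ} (hR : ∀ s i, |ι s i| ≤ R) (hR0 : 0 ≤ R)
    (Z : S → E → ℝ) (hZ : ∀ s, Measurable (Z s)) (hb : ∀ s x, |Z s x| ≤ b) (hb0 : 0 ≤ b)
    (hv : ∀ s, ∫ x, Z s x ^ 2 ∂μ ≤ v) (hv0 : 0 < v) {D : ℝ}
    (hD : ∀ s s' ρ, (∀ i, |ι s i - ι s' i| ≤ ρ) → ∀ x, |Z s x - Z s' x| ≤ D * ρ)
    {n : ℕ} (hn : 2 ≤ n) (hbv : 4 * b ^ 2 * Real.log n ≤ n * v) :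
    P {ω | ∃ s, 8 * √(v * Real.log n / n) + 2 * D / n ^ 2
        < |deviation μ (Z s) n fun i => ξ i ω|} ≤ ENNReal.ofReal (2 * (2 * R + 3) ^ 3 / n) := by
  have hn0 : (0 : ℝ) < n := by positivity
  have hn1 : (1 : ℝ) ≤ n := by exact_mod_cast (by lia : 1 ≤ n)
  obtain ⟨N, hN, hnet⟩ := exists_finset_net ι hR hR0 (ρ := 1 / (n : ℝ) ^ 2) (by positivity)
  have hcard : (N.card : ℝ) ≤ (2 * R + 3) ^ 3 * n ^ 6 := by
    refine hN.trans ?_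
    rw [show (2 * R + 3) ^ 3 * (n : ℝ) ^ 6 = ((2 * R + 3) * n ^ 2) ^ 3 by ring]
    gcongr
    rw [div_div_eq_mul_div, div_one]
    nlinarith [one_le_pow₀ hn1 (n := 2)]
  have hsub : {ω | ∃ s, 8 * √(v * Real.log n / n) + 2 * D / n ^ 2
        < |deviation μ (Z s) n fun i => ξ i ω|} ⊆
      ⋃ s ∈ N, {ω | 8 * √(v * Real.log n / n) ≤ |deviation μ (Z s) n fun i => ξ i ω|} := by
    rintro ω ⟨s, hs⟩
    obtain ⟨s', hs', hss⟩ := hnet s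
    have hclose := hD s s' _ hss
    rw [Set.mem_iUnion₂]
    refine ⟨s', hs', ?_⟩
    have h1 : |(n : ℝ)⁻¹ * ∑ i ∈ Finset.range n, Z s (ξ i ω)
        - (n : ℝ)⁻¹ * ∑ i ∈ Finset.range n, Z s' (ξ i ω)| ≤ D * (1 / n ^ 2) := by
      rw [← mul_sub, ← Finset.sum_sub_distrib, abs_mul, abs_of_pos (inv_pos.2 hn0),
        inv_mul_le_iff₀ hn0]
      refine (Finset.abs_sum_le_sum_abs _ _).trans ?_
      refine (Finset.sum_le_card_nsmul _ _ _ fun i _ => hclose (ξ i ω)).trans ?_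
      simp
    have h2 : |∫ x, Z s x ∂μ - ∫ x, Z s' x ∂μ| ≤ D * (1 / n ^ 2) := by
      rw [← integral_sub (integrable_of_abs_le (hZ s) (hb s)) (integrable_of_abs_le (hZ s') (hb s'))]
      have := norm_integral_le_of_norm_le_const (μ := μ) (f := fun x => Z s x - Z s' x)
        (ae_of_all _ hclose)
      simpa using this
    have h3 : |deviation μ (Z s) n (fun i => ξ i ω) - deviation μ (Z s') n fun i => ξ i ω|
        ≤ 2 * D / n ^ 2 := by
      simp only [deviation]
      rw [sub_sub_sub_comm]
      refine (abs_sub _ _).trans ((add_le_add h1 h2).trans (le_of_eq (by ring)))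
    have h4 := abs_sub_abs_le_abs_sub (deviation μ (Z s) n fun i => ξ i ω)
      (deviation μ (Z s') n fun i => ξ i ω)
    rw [Set.mem_ofPred_eq]
    linarith
  calc P _ ≤ P (⋃ s ∈ N, _) := measure_mono hsub
    _ ≤ ∑ s ∈ N, P {ω | 8 * √(v * Real.log n / n) ≤ |deviation μ (Z s) n fun i => ξ i ω|} :=
        measure_biUnion_finset_le _ _
    _ ≤ ∑ s ∈ N, ENNReal.ofReal (2 / n ^ 7) := Finset.sum_le_sum fun s _ =>
        measure_log_le_abs_deviation_le hξ hind hlaw (hZ s) (hb s) hb0 (hv s) hv0 hn hbv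
    _ = ENNReal.ofReal (N.card * (2 / n ^ 7)) := by
        rw [Finset.sum_const, nsmul_eq_mul, ENNReal.ofReal_mul (by positivity)]
        simp
    _ ≤ ENNReal.ofReal (2 * (2 * R + 3) ^ 3 / n) := by
        refine ENNReal.ofReal_le_ofReal ?_
        calc (N.card : ℝ) * (2 / n ^ 7) ≤ (2 * R + 3) ^ 3 * n ^ 6 * (2 / n ^ 7) := by gcongr
          _ = _ := by field_simp

end Concentration

/-! ### Partial derivatives of functions with bounded derivatives -/

/-- The differentiability properties shared by the density and the kernel: the derivatives of the
orders zero to three are differentiable, those of the orders one to four are bounded by `C`. -/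
structure FourDerivs (g : Plane → ℝ) (C : ℝ) : Prop where
  differentiable : ∀ m : ℕ, m < 4 → Differentiable ℝ (iteratedFDeriv ℝ m g)
  bound : ∀ m : ℕ, 1 ≤ m → m ≤ 4 → ∀ x, ‖iteratedFDeriv ℝ m g x‖ ≤ C

lemma SmoothDensity.exists_fourDerivs {f : Plane → ℝ} (hf : SmoothDensity f) :
    ∃ C, FourDerivs f C := by
  obtain ⟨C, hC⟩ := hf.bounded
  exact ⟨C, fun m hm => hf.contDiff.differentiable_iteratedFDeriv (by exact_mod_cast hm), hC⟩

lemma KernelRegular.exists_fourDerivs {K : Plane → ℝ} (hK : KernelRegular K) :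
    ∃ C, FourDerivs K C := by
  obtain ⟨C, hC⟩ := hK.bounded
  exact ⟨C, hK.differentiable, hC⟩

/-- The unit vector in the direction of the `i`-th coordinate. -/
noncomputable abbrev unitVec (i : Fin 2) : Plane := EuclideanSpace.single i 1

lemma norm_unitVec (i : Fin 2) : ‖unitVec i‖ = 1 := by simp

namespace FourDerivs

variable {g : Plane → ℝ} {C : ℝ}

lemma nonneg (hg : FourDerivs g C) : 0 ≤ C :=
  (norm_nonneg _).trans (hg.bound 1 le_rfl (by norm_num) 0)

lemma differentiable_zero (hg : FourDerivs g C) : Differentiable ℝ g := by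
  have h := hg.differentiable 0 (by norm_num)
  have : g = fun x => iteratedFDeriv ℝ 0 g x ![] := by
    funext x
    simp
  rw [this]
  exact fun x => (h x).continuousMultilinear_apply_const _

lemma partialDeriv_eq_iteratedFDeriv (g : Plane → ℝ) (a : Fin 2) :
    partialDeriv a g = fun x => iteratedFDeriv ℝ 1 g x ![unitVec a] := by
  funext x
  rw [iteratedFDeriv_one_apply]
  rfl

lemma partialDeriv_iteratedFDeriv (hg : FourDerivs g C) {m : ℕ} (hm : m < 4) (a : Fin 2)
    (v : Fin m → Plane) : partialDeriv a (fun x => iteratedFDeriv ℝ m g x v)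
      = fun x => iteratedFDeriv ℝ (m + 1) g x (Matrix.vecCons (unitVec a) v) := by
  funext x
  rw [(hg.differentiable m hm x).iteratedFDeriv_succ_apply_left']
  rfl

lemma partialDeriv_two_eq (hg : FourDerivs g C) (a b : Fin 2) :
    partialDeriv a (partialDeriv b g) =
      fun x => iteratedFDeriv ℝ 2 g x ![unitVec a, unitVec b] := by
  rw [partialDeriv_eq_iteratedFDeriv g b, hg.partialDeriv_iteratedFDeriv (by norm_num)]

lemma partialDeriv_three_eq (hg : FourDerivs g C) (c a b : Fin 2) :
    partialDeriv c (partialDeriv a (partialDeriv b g)) =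
      fun x => iteratedFDeriv ℝ 3 g x ![unitVec c, unitVec a, unitVec b] := by
  rw [hg.partialDeriv_two_eq, hg.partialDeriv_iteratedFDeriv (by norm_num)]

lemma differentiable_apply (hg : FourDerivs g C) {m : ℕ} (hm : m < 4) (v : Fin m → Plane) :
    Differentiable ℝ fun x => iteratedFDeriv ℝ m g x v :=
  fun x => (hg.differentiable m hm x).continuousMultilinear_apply_const _

lemma differentiable_one (hg : FourDerivs g C) (a : Fin 2) :
    Differentiable ℝ (partialDeriv a g) := by
  rw [partialDeriv_eq_iteratedFDeriv]
  exact hg.differentiable_apply (by norm_num) _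

lemma differentiable_two (hg : FourDerivs g C) (a b : Fin 2) :
    Differentiable ℝ (partialDeriv a (partialDeriv b g)) := by
  rw [hg.partialDeriv_two_eq]
  exact hg.differentiable_apply (by norm_num) _

lemma differentiable_three (hg : FourDerivs g C) (c a b : Fin 2) :
    Differentiable ℝ (partialDeriv c (partialDeriv a (partialDeriv b g))) := by
  rw [hg.partialDeriv_three_eq]
  exact hg.differentiable_apply (by norm_num) _

lemma abs_apply_le (hg : FourDerivs g C) {m : ℕ} (hm : 1 ≤ m) (hm' : m ≤ 4) (v : Fin m → Plane)
    (hv : ∀ i, ‖v i‖ = 1) (x : Plane) : |iteratedFDeriv ℝ m g x v| ≤ C := by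
  have := (iteratedFDeriv ℝ m g x).le_opNorm v
  simp only [hv, Finset.prod_const_one, mul_one, Real.norm_eq_abs] at this
  exact this.trans (hg.bound m hm hm' x)

lemma norm_iteratedFDeriv_sub_le (hg : FourDerivs g C) {m : ℕ} (hm : m < 4) (x y : Plane) :
    ‖iteratedFDeriv ℝ m g x - iteratedFDeriv ℝ m g y‖ ≤ C * ‖x - y‖ :=
  convex_univ.norm_image_sub_le_of_norm_fderiv_le (𝕜 := ℝ)
    (fun z _ => hg.differentiable m hm z)
    (fun z _ => by
      rw [norm_fderiv_iteratedFDeriv]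
      exact hg.bound (m + 1) (by lia) (by lia) z) trivial trivial

lemma abs_apply_sub_le (hg : FourDerivs g C) {m : ℕ} (hm : m < 4) (v : Fin m → Plane)
    (hv : ∀ i, ‖v i‖ = 1) (x y : Plane) :
    |iteratedFDeriv ℝ m g x v - iteratedFDeriv ℝ m g y v| ≤ C * ‖x - y‖ := by
  have := (iteratedFDeriv ℝ m g x - iteratedFDeriv ℝ m g y).le_opNorm v
  simp only [hv, Finset.prod_const_one, mul_one, Real.norm_eq_abs] at this
  exact this.trans (hg.norm_iteratedFDeriv_sub_le hm x y)

lemma abs_two_le (hg : FourDerivs g C) (a b : Fin 2) (x : Plane) :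
    |partialDeriv a (partialDeriv b g) x| ≤ C := by
  rw [hg.partialDeriv_two_eq]
  exact hg.abs_apply_le (by norm_num) (by norm_num) _
    (by simp [Fin.forall_fin_succ]) x

lemma abs_three_le (hg : FourDerivs g C) (c a b : Fin 2) (x : Plane) :
    |partialDeriv c (partialDeriv a (partialDeriv b g)) x| ≤ C := by
  rw [hg.partialDeriv_three_eq]
  exact hg.abs_apply_le (by norm_num) (by norm_num) _
    (by simp [Fin.forall_fin_succ]) x

lemma abs_two_sub_le (hg : FourDerivs g C) (a b : Fin 2) (x y : Plane) :
    |partialDeriv a (partialDeriv b g) x - partialDeriv a (partialDeriv b g) y|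
      ≤ C * ‖x - y‖ := by
  rw [hg.partialDeriv_two_eq]
  exact hg.abs_apply_sub_le (by norm_num) _ (by simp [Fin.forall_fin_succ]) x y

lemma abs_three_sub_le (hg : FourDerivs g C) (c a b : Fin 2) (x y : Plane) :
    |partialDeriv c (partialDeriv a (partialDeriv b g)) x
      - partialDeriv c (partialDeriv a (partialDeriv b g)) y| ≤ C * ‖x - y‖ := by
  rw [hg.partialDeriv_three_eq]
  exact hg.abs_apply_sub_le (by norm_num) _ (by simp [Fin.forall_fin_succ]) x y

lemma norm_fderiv_two_sub_le (hg : FourDerivs g C) (a b : Fin 2) (x y : Plane) :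
    ‖fderiv ℝ (partialDeriv a (partialDeriv b g)) x
      - fderiv ℝ (partialDeriv a (partialDeriv b g)) y‖ ≤ C * ‖x - y‖ := by
  have key : ∀ z v, fderiv ℝ (partialDeriv a (partialDeriv b g)) z v
      = iteratedFDeriv ℝ 3 g z ![v, unitVec a, unitVec b] := fun z v => by
    rw [hg.partialDeriv_two_eq,
      (hg.differentiable 2 (by norm_num) z).iteratedFDeriv_succ_apply_left']
    rfl
  refine ContinuousLinearMap.opNorm_le_bound _ (mul_nonneg hg.nonneg (norm_nonneg _)) fun v => ?_
  rw [sub_apply, key, key]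
  have := (iteratedFDeriv ℝ 3 g x - iteratedFDeriv ℝ 3 g y).le_opNorm ![v, unitVec a, unitVec b]
  rw [Fin.prod_univ_three] at this
  simp only [Matrix.cons_val_zero, Matrix.cons_val_one, Matrix.cons_val, norm_unitVec,
    mul_one] at this
  refine this.trans ?_
  gcongr
  exact hg.norm_iteratedFDeriv_sub_le (by norm_num) x y

lemma partialDeriv_comm (hg : FourDerivs g C) (a b : Fin 2) :
    partialDeriv a (partialDeriv b g) = partialDeriv b (partialDeriv a g) := by
  funext x
  have hd : Differentiable ℝ (fderiv ℝ g) := by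
    have h1 := hg.differentiable 1 (by norm_num)
    have : fderiv ℝ g = fun x => (continuousMultilinearCurryFin1 ℝ Plane ℝ)
        (iteratedFDeriv ℝ 1 g x) := by
      funext x
      ext v
      simp
    rw [this]
    exact (continuousMultilinearCurryFin1 ℝ Plane ℝ).differentiable.comp h1
  have hs := second_derivative_symmetric (fun y => (hg.differentiable_zero y).hasFDerivAt)
    (hd x).hasFDerivAt (unitVec a) (unitVec b)
  have key : ∀ p q : Fin 2, partialDeriv p (partialDeriv q g) x
      = fderiv ℝ (fderiv ℝ g) x (unitVec p) (unitVec q) := fun p q => by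
    have := ((hd x).hasFDerivAt.clm_apply (hasFDerivAt_const (unitVec q) x)).fderiv
    show fderiv ℝ (fun y => fderiv ℝ g y (unitVec q)) x (unitVec p) = _
    rw [this]
    simp
  rw [key, key, hs]

end FourDerivs

/-- The entries of `d2` as iterated partial derivatives. -/
lemma d2_apply (g : Plane → ℝ) (x : Plane) (k : Fin 3) :
    d2 g x k = partialDeriv (![0, 0, 1] k) (partialDeriv (![0, 1, 1] k) g) x := by
  fin_cases k <;> rfl

lemma partialDeriv_eq_zero {u : Plane → ℝ} (hu : ∀ z, 1 < ‖z‖ → u z = 0) (a : Fin 2) (z : Plane)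
    (hz : 1 < ‖z‖) : partialDeriv a u z = 0 := by
  have : u =ᶠ[𝓝 z] fun _ => 0 := by
    filter_upwards [(isOpen_lt continuous_const continuous_norm).mem_nhds hz] with y hy
    exact hu y hy
  rw [partialDeriv, this.fderiv_eq]
  simp

lemma KernelRegular.eq_zero {K : Plane → ℝ} (hK : KernelRegular K) (z : Plane) (hz : 1 < ‖z‖) :
    K z = 0 := by
  refine image_eq_zero_of_notMem_tsupport ?_
  rw [hK.support]
  simpa using hz

/-! ### Smoothing by the kernel -/

lemma integrable_of_eq_zero_of_lt {F : Plane → ℝ} (hF : Continuous F) (x : Plane) (h : ℝ)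
    (h0 : ∀ y, h < ‖x - y‖ → F y = 0) : Integrable F := by
  refine hF.integrable_of_hasCompactSupport
    (HasCompactSupport.intro (isCompact_closedBall x h) fun y hy => h0 y ?_)
  rw [Metric.mem_closedBall, dist_comm, dist_eq_norm] at hy
  linarith

lemma eq_zero_scaled {u : Plane → ℝ} (hu : ∀ z, 1 < ‖z‖ → u z = 0) {h : ℝ} (hh : 0 < h)
    {x y : Plane} (hxy : h < ‖x - y‖) : u (h⁻¹ • (x - y)) = 0 := by
  refine hu _ ?_
  rw [norm_smul, norm_inv, Real.norm_of_nonneg hh.le, ← div_eq_inv_mul, one_lt_div hh]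
  exact hxy

lemma hasFDerivAt_scaled {u : Plane → ℝ} (hu : Differentiable ℝ u) (h : ℝ) (x y : Plane) :
    HasFDerivAt (fun y => u (h⁻¹ • (x - y)))
      (-(h⁻¹ • fderiv ℝ u (h⁻¹ • (x - y)))) y := by
  have h1 : HasFDerivAt (fun y : Plane => h⁻¹ • (x - y))
      (h⁻¹ • (-(ContinuousLinearMap.id ℝ Plane))) y :=
    ((hasFDerivAt_id y).const_sub x).const_smul h⁻¹
  have := (hu _).hasFDerivAt.comp y h1
  convert! this using 1
  ext v
  simp

/-- Integration by parts against a rescaled compactly supported function. -/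
lemma integral_mul_partialDeriv_scaled {f u : Plane → ℝ} {a : Fin 2} (hf : Differentiable ℝ f)
    (hfa : Continuous (partialDeriv a f)) (hu : Differentiable ℝ u)
    (hua : Continuous (partialDeriv a u)) (hu0 : ∀ z, 1 < ‖z‖ → u z = 0) {h : ℝ} (hh : 0 < h)
    (x : Plane) :
    ∫ y, f y * partialDeriv a u (h⁻¹ • (x - y)) =
      h * ∫ y, partialDeriv a f y * u (h⁻¹ • (x - y)) := by
  have hd : ∀ y, fderiv ℝ (fun y => u (h⁻¹ • (x - y))) y (unitVec a)
      = -(h⁻¹ * partialDeriv a u (h⁻¹ • (x - y))) := fun y => by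
    rw [(hasFDerivAt_scaled hu h x y).fderiv]
    rfl
  have hfc := hf.continuous
  have huc := hu.continuous
  have hi1 : Integrable fun y => partialDeriv a f y * u (h⁻¹ • (x - y)) :=
    integrable_of_eq_zero_of_lt (by fun_prop) x h fun y hy => by
      rw [eq_zero_scaled hu0 hh hy, mul_zero]
  have hi2 : Integrable fun y => f y * -(h⁻¹ * partialDeriv a u (h⁻¹ • (x - y))) :=
    integrable_of_eq_zero_of_lt (by fun_prop) x h fun y hy => by
      rw [eq_zero_scaled (partialDeriv_eq_zero hu0 a) hh hy]
      simp
  have hi3 : Integrable fun y => f y * u (h⁻¹ • (x - y)) :=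
    integrable_of_eq_zero_of_lt (by fun_prop) x h fun y hy => by
      rw [eq_zero_scaled hu0 hh hy, mul_zero]
  have := integral_mul_fderiv_eq_neg_fderiv_mul_of_integrable (μ := volume) (f := f)
    (g := fun y => u (h⁻¹ • (x - y))) (v := unitVec a) hi1 (by simpa only [hd] using hi2) hi3
    (fun y _ => hf y) (fun y _ => (hasFDerivAt_scaled hu h x y).differentiableAt)
  simp only [hd] at this
  have h2 : ∫ y, f y * -(h⁻¹ * partialDeriv a u (h⁻¹ • (x - y)))
      = -h⁻¹ * ∫ y, f y * partialDeriv a u (h⁻¹ • (x - y)) := by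
    rw [← integral_const_mul]
    congr 1
    funext y
    ring
  rw [h2] at this
  have h3 : ∫ y, fderiv ℝ f y (unitVec a) * u (h⁻¹ • (x - y))
      = ∫ y, partialDeriv a f y * u (h⁻¹ • (x - y)) := rfl
  rw [h3] at this
  have h4 : ∫ y, f y * partialDeriv a u (h⁻¹ • (x - y))
      = h * (h⁻¹ * ∫ y, f y * partialDeriv a u (h⁻¹ • (x - y))) := by
    rw [mul_inv_cancel_left₀ hh.ne']
  rw [h4]
  congr 1
  linarith

lemma integral_mul_scaled (φ u : Plane → ℝ) {h : ℝ} (hh : 0 < h) (x : Plane) :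
    ∫ y, φ y * u (h⁻¹ • (x - y)) = h ^ 2 * ∫ z, u z * φ (x - h • z) := by
  have h1 := integral_sub_left_eq_self (fun w => φ (x - w) * u (h⁻¹ • w)) volume x
  simp only [sub_sub_cancel] at h1
  rw [h1]
  have h2 := Measure.integral_comp_inv_smul (volume : Measure Plane)
    (fun z => u z * φ (x - h • z)) h
  simp only [finrank_euclideanSpace_fin, smul_eq_mul, smul_inv_smul₀ hh.ne'] at h2
  rw [abs_of_pos (by positivity)] at h2
  rw [← h2]
  congr 1
  funext w
  ring

section Smoothing

variable {f K : Plane → ℝ} {C C' : ℝ}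

/-- The mean of a rescaled second derivative of the kernel is the smoothed second derivative of
the density. -/
lemma integral_mul_partialDeriv_two (hf : FourDerivs f C) (hK : FourDerivs K C')
    (hK0 : ∀ z, 1 < ‖z‖ → K z = 0) (a b : Fin 2) {h : ℝ} (hh : 0 < h) (x : Plane) :
    ∫ y, f y * partialDeriv a (partialDeriv b K) (h⁻¹ • (x - y)) =
      h ^ 4 * ∫ z, K z * partialDeriv a (partialDeriv b f) (x - h • z) := by
  rw [integral_mul_partialDeriv_scaled hf.differentiable_zero (hf.differentiable_one a).continuous
      (hK.differentiable_one b) (hK.differentiable_two a b).continuous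
      (partialDeriv_eq_zero hK0 b) hh,
    integral_mul_partialDeriv_scaled (hf.differentiable_one a)
      (hf.differentiable_two b a).continuous hK.differentiable_zero
      (hK.differentiable_one b).continuous hK0 hh, integral_mul_scaled _ _ hh,
    hf.partialDeriv_comm b a]
  ring

lemma integral_mul_partialDeriv_three (hf : FourDerivs f C) (hK : FourDerivs K C')
    (hK0 : ∀ z, 1 < ‖z‖ → K z = 0) (c a b : Fin 2) {h : ℝ} (hh : 0 < h) (x : Plane) :
    ∫ y, f y * partialDeriv c (partialDeriv a (partialDeriv b K)) (h⁻¹ • (x - y)) =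
      h ^ 5 * ∫ z, K z * partialDeriv b (partialDeriv a (partialDeriv c f)) (x - h • z) := by
  rw [integral_mul_partialDeriv_scaled hf.differentiable_zero (hf.differentiable_one c).continuous
      (hK.differentiable_two a b) (hK.differentiable_three c a b).continuous
      (partialDeriv_eq_zero (partialDeriv_eq_zero hK0 b) a) hh,
    integral_mul_partialDeriv_scaled (hf.differentiable_one c)
      (hf.differentiable_two a c).continuous (hK.differentiable_one b)
      (hK.differentiable_two a b).continuous (partialDeriv_eq_zero hK0 b) hh,
    integral_mul_partialDeriv_scaled (hf.differentiable_two a c)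
      (hf.differentiable_three b a c).continuous hK.differentiable_zero
      (hK.differentiable_one b).continuous hK0 hh, integral_mul_scaled _ _ hh]
  ring

lemma abs_integral_kernel_mul_le (hK : IsDensity K) {φ : Plane → ℝ} {D : ℝ}
    (hφ : ∀ z, K z ≠ 0 → |φ z| ≤ D) : |∫ z, K z * φ z| ≤ D := by
  have h1 := norm_integral_le_of_norm_le (μ := volume) (f := fun z => K z * φ z)
    (g := fun z => K z * D) (hK.integrable.mul_const D) (ae_of_all _ fun z => by
      rw [norm_mul, Real.norm_of_nonneg (hK.nonneg z)]
      by_cases hz : K z = 0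
      · simp [hz]
      · exact mul_le_mul_of_nonneg_left (hφ z hz) (hK.nonneg z))
  rwa [integral_mul_const, hK.integral_eq_one, one_mul, Real.norm_eq_abs] at h1

/-- Smoothing with a symmetric kernel of bandwidth `h` changes a function whose derivative is
`C`-Lipschitz by at most `C h ^ 2`: the linear term of the Taylor expansion integrates to zero. -/
lemma abs_smoothing_sub_le (hK : KernelRegular K) {φ : Plane → ℝ} (hφ : Differentiable ℝ φ)
    (hφ' : ∀ x y, ‖fderiv ℝ φ x - fderiv ℝ φ y‖ ≤ C * ‖x - y‖) (hC : 0 ≤ C) {h : ℝ} (hh : 0 < h)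
    (x : Plane) : |(∫ z, K z * φ (x - h • z)) - φ x| ≤ C * h ^ 2 := by
  obtain ⟨C', hK4⟩ := hK.exists_fourDerivs
  have hKc := hK4.differentiable_zero.continuous
  have hφc := hφ.continuous
  have hint : ∀ ψ : Plane → ℝ, Continuous ψ → Integrable fun z => K z * ψ z := fun ψ hψ =>
    integrable_of_eq_zero_of_lt (by fun_prop) 0 1 fun y hy => by
      rw [zero_sub, norm_neg] at hy
      rw [hK.eq_zero y hy, zero_mul]
  set D := fderiv ℝ φ x with hD
  have hodd : ∫ z, K z * D z = 0 := by
    have := integral_neg_eq_self (fun z => K z * D z) volume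
    simp only [hK.symm, map_neg, mul_neg, integral_neg] at this
    linarith
  have hsplit : (∫ z, K z * φ (x - h • z)) - φ x
      = ∫ z, K z * (φ (x - h • z) - φ x - D (-(h • z))) := by
    have h1 : ∫ z, K z * φ x = φ x := by
      rw [integral_mul_const, hK.density.integral_eq_one, one_mul]
    have h2 : ∫ z, K z * D (-(h • z)) = 0 := by
      have : ∀ z, K z * D (-(h • z)) = -h * (K z * D z) := fun z => by
        rw [map_neg, map_smul, smul_eq_mul]
        ring
      simp only [this, integral_const_mul, hodd, mul_zero]
    simp only [mul_sub]
    have i1 := hint (fun z => φ (x - h • z)) (by fun_prop)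
    have i2 := hint (fun _ => φ x) continuous_const
    have e1 := integral_sub (i1.sub i2) (hint (fun z => D (-(h • z))) (by fun_prop))
    have e2 := integral_sub i1 i2
    simp only [Pi.sub_apply] at e1
    rw [e1, e2, h1, h2, sub_zero]
  rw [hsplit]
  refine abs_integral_kernel_mul_le hK.density fun z hz => ?_
  have hz1 : ‖z‖ ≤ 1 := by
    by_contra! hlt
    exact hz (hK.eq_zero z hlt)
  have hhz : ‖h • z‖ ≤ h := by
    rw [norm_smul, Real.norm_of_nonneg hh.le]
    nlinarith
  have := (convex_closedBall x h).norm_image_sub_le_of_norm_fderiv_le' (𝕜 := ℝ) (f := φ) (φ := D)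
    (C := C * h) (x := x) (y := x - h • z) (fun y _ => hφ y) (fun y hy => by
      refine (hφ' y x).trans ?_
      gcongr
      simpa [dist_eq_norm] using hy) (Metric.mem_closedBall_self hh.le)
    (by simpa [dist_eq_norm] using hhz)
  have hsub : x - h • z - x = -(h • z) := by abel
  rw [hsub, norm_neg, Real.norm_eq_abs] at this
  refine this.trans ?_
  rw [pow_two, ← mul_assoc]
  gcongr

end Smoothing

/-! ### First order expansion of the eigenvector map -/

/-- The vector `(w - u, 2 v)` attached to `(u, v, w)`. Its norm is the difference of the two
eigenvalues of the symmetric matrix with rows `(u, v)` and `(v, w)`. -/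
noncomputable def gapVec (p : Fin 3 → ℝ) : Plane := !₂[p 2 - p 0, 2 * p 1]

lemma gapVec_add (p q : Fin 3 → ℝ) : gapVec (p + q) = gapVec p + gapVec q := by
  ext i
  fin_cases i <;> simp [gapVec] <;> ring

lemma gapVec_sub (p q : Fin 3 → ℝ) : gapVec (p - q) = gapVec p - gapVec q := by
  ext i
  fin_cases i <;> simp [gapVec] <;> ring

lemma norm_gapVec (p : Fin 3 → ℝ) : ‖gapVec p‖ = √((p 2 - p 0) ^ 2 + 4 * p 1 ^ 2) := by
  rw [EuclideanSpace.norm_eq, Fin.sum_univ_two]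
  congr 1
  simp only [gapVec, Real.norm_eq_abs, sq_abs]
  simp
  ring

lemma norm_le_abs_add_abs (x : Plane) : ‖x‖ ≤ |x 0| + |x 1| := by
  rw [EuclideanSpace.norm_eq, Fin.sum_univ_two]
  refine Real.sqrt_le_iff.2 ⟨by positivity, ?_⟩
  simp only [Real.norm_eq_abs]
  nlinarith [mul_nonneg (abs_nonneg (x 0)) (abs_nonneg (x 1))]

lemma abs_apply_le_norm (x : Plane) (i : Fin 2) : |x i| ≤ ‖x‖ := PiLp.norm_apply_le x i

lemma continuous_gapVec : Continuous gapVec := by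
  refine (PiLp.continuous_toLp 2 _).comp (continuous_pi fun i => ?_)
  fin_cases i <;> simp <;> fun_prop

lemma norm_gapVec_le {p : Fin 3 → ℝ} {B : ℝ} (hp : ∀ k, |p k| ≤ B) : ‖gapVec p‖ ≤ 4 * B := by
  refine (norm_le_abs_add_abs _).trans ?_
  have h0 := hp 0
  have h1 := hp 1
  have h2 := hp 2
  have h3 : |gapVec p 0| ≤ |p 2| + |p 0| := abs_sub _ _
  have h4 : |gapVec p 1| = 2 * |p 1| := by simp [gapVec, abs_mul]
  linarith

lemma eigG_zero (p : Fin 3 → ℝ) :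
    eigG p 0 = 2 * p 0 - 2 * p 2 + 2 * p 1 - 2 * ‖gapVec p‖ := by
  rw [norm_gapVec]
  rfl

lemma eigG_one (p : Fin 3 → ℝ) : eigG p 1 = p 2 - p 0 + 4 * p 1 - ‖gapVec p‖ := by
  rw [norm_gapVec]
  rfl

/-- The map `eigG` is globally Lipschitz, since the square root in it is a norm. -/
lemma norm_eigG_sub_le {p q : Fin 3 → ℝ} {B : ℝ} (h : ∀ k, |p k - q k| ≤ B) :
    ‖eigG p - eigG q‖ ≤ 24 * B := by
  have hgap : |‖gapVec p‖ - ‖gapVec q‖| ≤ 4 * B := by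
    refine (abs_norm_sub_norm_le _ _).trans ?_
    rw [← gapVec_sub]
    exact norm_gapVec_le h
  obtain ⟨h0, h0'⟩ := abs_le.1 (h 0)
  obtain ⟨h1, h1'⟩ := abs_le.1 (h 1)
  obtain ⟨h2, h2'⟩ := abs_le.1 (h 2)
  obtain ⟨h3, h3'⟩ := abs_le.1 hgap
  refine (norm_le_abs_add_abs _).trans ?_
  rw [PiLp.sub_apply, PiLp.sub_apply, eigG_zero, eigG_zero, eigG_one, eigG_one]
  have e0 : |2 * p 0 - 2 * p 2 + 2 * p 1 - 2 * ‖gapVec p‖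
      - (2 * q 0 - 2 * q 2 + 2 * q 1 - 2 * ‖gapVec q‖)| ≤ 14 * B :=
    abs_le.2 ⟨by linarith, by linarith⟩
  have e1 : |p 2 - p 0 + 4 * p 1 - ‖gapVec p‖ - (q 2 - q 0 + 4 * q 1 - ‖gapVec q‖)| ≤ 10 * B :=
    abs_le.2 ⟨by linarith, by linarith⟩
  linarith

lemma continuous_eigG : Continuous eigG := by
  refine (PiLp.continuous_toLp 2 _).comp (continuous_pi fun i => ?_)
  fin_cases i <;> simp <;> fun_prop

/-- First order expansion of the norm, with a quadratic remainder that involves the size of `p`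
only through the factor `1 / ‖p‖`. -/
lemma abs_norm_add_sub_le {p q : Plane} (hp : 0 < ‖p‖) :
    |‖p + q‖ - ‖p‖ - inner ℝ p q / ‖p‖| ≤ ‖q‖ ^ 2 / (2 * ‖p‖) := by
  have h1 := norm_add_sq_real p q
  have h2 : inner ℝ p (p + q) ≤ ‖p‖ * ‖p + q‖ := real_inner_le_norm _ _
  rw [inner_add_right, real_inner_self_eq_norm_sq] at h2
  rw [abs_le]
  have h3 : ‖p‖ * (inner ℝ p q / ‖p‖) = inner ℝ p q := mul_div_cancel₀ _ hp.ne'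
  have h4 : 2 * ‖p‖ * (‖q‖ ^ 2 / (2 * ‖p‖)) = ‖q‖ ^ 2 := mul_div_cancel₀ _ (by positivity)
  constructor
  · have h5 : 0 ≤ ‖p + q‖ - ‖p‖ - inner ℝ p q / ‖p‖ := by
      by_contra! hneg
      nlinarith
    have : 0 ≤ ‖q‖ ^ 2 / (2 * ‖p‖) := by positivity
    linarith
  · by_contra! hlt
    have h6 := mul_lt_mul_of_pos_left hlt (show 0 < 2 * ‖p‖ by positivity)
    nlinarith [sq_nonneg (‖p + q‖ - ‖p‖)]

/-- The vector `p` divided by the maximum of its norm and `c`: the derivative of the norm at `p`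
when `c ≤ ‖p‖`, and a globally Lipschitz extension of it when not. -/
noncomputable def cutDir (c : ℝ) (p : Plane) : Plane := (max ‖p‖ c)⁻¹ • p

lemma norm_cutDir_le {c : ℝ} (hc : 0 < c) (p : Plane) : ‖cutDir c p‖ ≤ 1 := by
  have hm : 0 < max ‖p‖ c := lt_max_of_lt_right hc
  rw [cutDir, norm_smul, norm_inv, Real.norm_of_nonneg hm.le, inv_mul_le_iff₀ hm, mul_one]
  exact le_max_left _ _

lemma norm_cutDir_sub_le {c : ℝ} (hc : 0 < c) (p q : Plane) :
    ‖cutDir c p - cutDir c q‖ ≤ 2 / c * ‖p - q‖ := by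
  have hp : c ≤ max ‖p‖ c := le_max_right _ _
  have hq : c ≤ max ‖q‖ c := le_max_right _ _
  set mp := max ‖p‖ c
  set mq := max ‖q‖ c with hmq
  have hp0 : 0 < mp := hc.trans_le hp
  have hq0 : 0 < mq := hc.trans_le hq
  have hsplit : cutDir c p - cutDir c q = mp⁻¹ • (p - q) + (mp⁻¹ * (mq - mp)) • cutDir c q := by
    rw [cutDir, cutDir, smul_sub, smul_smul, ← hmq,
      show mp⁻¹ * (mq - mp) * mq⁻¹ = mp⁻¹ - mq⁻¹ by field_simp, sub_smul]
    abel
  have hm : |mq - mp| ≤ ‖p - q‖ := by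
    rw [abs_sub_comm]
    exact (abs_max_sub_max_le_abs _ _ _).trans (abs_norm_sub_norm_le _ _)
  have hinv : mp⁻¹ ≤ c⁻¹ := inv_anti₀ hc hp
  rw [hsplit]
  refine (norm_add_le _ _).trans ?_
  rw [norm_smul, norm_smul, norm_mul, norm_inv, Real.norm_of_nonneg hp0.le, Real.norm_eq_abs]
  calc mp⁻¹ * ‖p - q‖ + mp⁻¹ * |mq - mp| * ‖cutDir c q‖
      ≤ c⁻¹ * ‖p - q‖ + c⁻¹ * ‖p - q‖ * 1 := by
        gcongr
        exact norm_cutDir_le hc q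
    _ = _ := by ring

lemma abs_norm_gapVec_add_sub_le {p q : Fin 3 → ℝ} {c Q : ℝ} (hc : 0 < c) (hp : c ≤ ‖gapVec p‖)
    (hq : ∀ k, |q k| ≤ Q) :
    |‖gapVec (p + q)‖ - ‖gapVec p‖ - (cutDir c (gapVec p) 0 * (q 2 - q 0)
      + 2 * (cutDir c (gapVec p) 1 * q 1))| ≤ 8 * Q ^ 2 / c := by
  have hp0 := hc.trans_le hp
  have h1 := abs_norm_add_sub_le (p := gapVec p) (q := gapVec q) hp0
  have h2 : inner ℝ (gapVec p) (gapVec q) / ‖gapVec p‖ = cutDir c (gapVec p) 0 * (q 2 - q 0)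
      + 2 * (cutDir c (gapVec p) 1 * q 1) := by
    rw [cutDir, max_eq_left hp, EuclideanSpace.inner_eq_star_dotProduct]
    simp [gapVec, dotProduct, Fin.sum_univ_two]
    ring
  rw [← gapVec_add, h2] at h1
  refine h1.trans ?_
  have h3 := norm_gapVec_le hq
  calc ‖gapVec q‖ ^ 2 / (2 * ‖gapVec p‖) ≤ (4 * Q) ^ 2 / (2 * c) := by gcongr
    _ = _ := by ring

lemma intervalIntegral_apply {F : ℝ → Plane} (hF : Continuous F) (s t : ℝ) (i : Fin 2) :
    (∫ l in s..t, F l) i = ∫ l in s..t, F l i := by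
  have := (EuclideanSpace.proj i : Plane →L[ℝ] ℝ).intervalIntegral_comp_comm
    (hF.intervalIntegrable (μ := volume) s t)
  simpa using this.symm

lemma integral_linearCombination {m : ℕ} (a : Fin m → ℝ) (φ : Fin m → ℝ → ℝ)
    (hφ : ∀ j, Continuous (φ j)) (t : ℝ) :
    ∫ l in (0 : ℝ)..t, ∑ j, a j * φ j l = ∑ j, a j * ∫ l in (0 : ℝ)..t, φ j l := by
  rw [intervalIntegral.integral_finsetSum fun j _ =>
    ((hφ j).const_mul (a j)).intervalIntegrable _ _]
  simp only [intervalIntegral.integral_const_mul]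

/-- The integral of an increment of `eigG` along a path is governed by integrals of the increments
of its arguments, weighted by constants and by the derivative of the norm, up to a quadratic
remainder. -/
lemma norm_integral_eigG_sub_le {p q : ℝ → Fin 3 → ℝ} (hp : Continuous p) (hq : Continuous q)
    {c Q δ t T : ℝ} (hc : 0 < c) (htT : |t| ≤ T)
    (hpc : ∀ l ∈ Set.uIcc 0 t, c ≤ ‖gapVec (p l)‖) (hqQ : ∀ l ∈ Set.uIcc 0 t, ∀ k, |q l k| ≤ Q)
    (h1 : ∀ k, |∫ l in (0 : ℝ)..t, q l k| ≤ δ)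
    (h2 : ∀ i k, |∫ l in (0 : ℝ)..t, cutDir c (gapVec (p l)) i * q l k| ≤ δ) :
    ‖∫ l in (0 : ℝ)..t, (eigG (p l + q l) - eigG (p l))‖ ≤ 24 * δ + 24 * T * Q ^ 2 / c := by
  have hgv := continuous_gapVec
  have hcd : Continuous (cutDir c) := by
    refine Continuous.smul (Continuous.inv₀ (continuous_norm.max continuous_const) fun x => ?_)
      continuous_id
    exact (lt_max_of_lt_right hc).ne'
  have hu : ∀ i, Continuous fun l => cutDir c (gapVec (p l)) i := fun i =>
    (EuclideanSpace.proj i : Plane →L[ℝ] ℝ).continuous.comp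
      (hcd.comp (hgv.comp hp))
  have hqk : ∀ k, Continuous fun l => q l k := fun k => (continuous_apply k).comp hq
  have hpk : ∀ k, Continuous fun l => p l k := fun k => (continuous_apply k).comp hp
  have hF : Continuous fun l => eigG (p l + q l) - eigG (p l) :=
    (continuous_eigG.comp (hp.add hq)).sub (continuous_eigG.comp hp)
  set r : ℝ → ℝ := fun l => ‖gapVec (p l + q l)‖ - ‖gapVec (p l)‖
    - (cutDir c (gapVec (p l)) 0 * (q l 2 - q l 0) + 2 * (cutDir c (gapVec (p l)) 1 * q l 1))
    with hr
  have hrc : Continuous r :=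
    (((hgv.comp (hp.add hq)).norm.sub (hgv.comp hp).norm)).sub
      (((hu 0).mul ((hqk 2).sub (hqk 0))).add (((hu 1).mul (hqk 1)).const_mul 2))
  have hrb : |∫ l in (0 : ℝ)..t, r l| ≤ 8 * Q ^ 2 / c * T := by
    have := intervalIntegral.norm_integral_le_of_norm_le_const (a := (0 : ℝ)) (b := t) (f := r)
      (C := 8 * Q ^ 2 / c) fun l hl =>
        abs_norm_gapVec_add_sub_le hc (hpc l (Set.uIoc_subset_uIcc hl))
          (hqQ l (Set.uIoc_subset_uIcc hl))
    rw [sub_zero] at this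
    refine this.trans ?_
    gcongr
  have hφ : ∀ j, Continuous ((![fun l => q l 0, fun l => q l 2, fun l => q l 1,
      fun l => cutDir c (gapVec (p l)) 0 * q l 2, fun l => cutDir c (gapVec (p l)) 0 * q l 0,
      fun l => cutDir c (gapVec (p l)) 1 * q l 1, r] : Fin 7 → ℝ → ℝ) j) := by
    intro j
    fin_cases j
    exacts [hqk 0, hqk 2, hqk 1, (hu 0).mul (hqk 2), (hu 0).mul (hqk 0), (hu 1).mul (hqk 1), hrc]
  set I : Fin 3 → ℝ := fun k => ∫ l in (0 : ℝ)..t, q l k with hI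
  set J : Fin 2 → Fin 3 → ℝ := fun i k => ∫ l in (0 : ℝ)..t, cutDir c (gapVec (p l)) i * q l k
    with hJ
  have e0 : ∫ l in (0 : ℝ)..t, (eigG (p l + q l) - eigG (p l)) 0
      = 2 * I 0 - 2 * I 2 + 2 * I 1 - 2 * (J 0 2 - J 0 0 + 2 * J 1 1 + ∫ l in (0 : ℝ)..t, r l) := by
    have : ∀ l, (eigG (p l + q l) - eigG (p l)) 0 = 2 * q l 0 - 2 * q l 2 + 2 * q l 1
        - 2 * (cutDir c (gapVec (p l)) 0 * q l 2 - cutDir c (gapVec (p l)) 0 * q l 0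
          + 2 * (cutDir c (gapVec (p l)) 1 * q l 1) + r l) := fun l => by
      rw [PiLp.sub_apply, eigG_zero, eigG_zero, hr]
      simp only [Pi.add_apply]
      ring
    have hsum := integral_linearCombination ![2, -2, 2, -2, 2, -4, -2]
      ![fun l => q l 0, fun l => q l 2, fun l => q l 1,
        fun l => cutDir c (gapVec (p l)) 0 * q l 2, fun l => cutDir c (gapVec (p l)) 0 * q l 0,
        fun l => cutDir c (gapVec (p l)) 1 * q l 1, r] hφ t
    rw [Fin.sum_univ_seven] at hsum
    simp only [this, hI, hJ]
    refine Eq.trans ?_ (hsum.trans ?_)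
    · congr 1
      funext l
      rw [Fin.sum_univ_seven]
      simp
      ring
    · simp
      ring
  have e1 : ∫ l in (0 : ℝ)..t, (eigG (p l + q l) - eigG (p l)) 1
      = I 2 - I 0 + 4 * I 1 - (J 0 2 - J 0 0 + 2 * J 1 1 + ∫ l in (0 : ℝ)..t, r l) := by
    have : ∀ l, (eigG (p l + q l) - eigG (p l)) 1 = q l 2 - q l 0 + 4 * q l 1
        - (cutDir c (gapVec (p l)) 0 * q l 2 - cutDir c (gapVec (p l)) 0 * q l 0
          + 2 * (cutDir c (gapVec (p l)) 1 * q l 1) + r l) := fun l => by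
      rw [PiLp.sub_apply, eigG_one, eigG_one, hr]
      simp only [Pi.add_apply]
      ring
    have hsum := integral_linearCombination ![-1, 1, 4, -1, 1, -2, -1]
      ![fun l => q l 0, fun l => q l 2, fun l => q l 1,
        fun l => cutDir c (gapVec (p l)) 0 * q l 2, fun l => cutDir c (gapVec (p l)) 0 * q l 0,
        fun l => cutDir c (gapVec (p l)) 1 * q l 1, r] hφ t
    rw [Fin.sum_univ_seven] at hsum
    simp only [this, hI, hJ]
    refine Eq.trans ?_ (hsum.trans ?_)
    · congr 1
      funext l
      rw [Fin.sum_univ_seven]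
      simp
      ring
    · simp
      ring
  refine (norm_le_abs_add_abs _).trans ?_
  rw [intervalIntegral_apply hF, intervalIntegral_apply hF, e0, e1]
  obtain ⟨a0, a0'⟩ := abs_le.1 (h1 0)
  obtain ⟨a1, a1'⟩ := abs_le.1 (h1 1)
  obtain ⟨a2, a2'⟩ := abs_le.1 (h1 2)
  obtain ⟨b0, b0'⟩ := abs_le.1 (h2 0 0)
  obtain ⟨b1, b1'⟩ := abs_le.1 (h2 0 2)
  obtain ⟨b2, b2'⟩ := abs_le.1 (h2 1 1)
  obtain ⟨c0, c0'⟩ := abs_le.1 hrb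
  set ρ := ∫ l in (0 : ℝ)..t, r l
  have f0 : |2 * I 0 - 2 * I 2 + 2 * I 1 - 2 * (J 0 2 - J 0 0 + 2 * J 1 1 + ρ)|
      ≤ 14 * δ + 2 * (8 * Q ^ 2 / c * T) := abs_le.2 ⟨by linarith, by linarith⟩
  have f1 : |I 2 - I 0 + 4 * I 1 - (J 0 2 - J 0 0 + 2 * J 1 1 + ρ)|
      ≤ 10 * δ + 8 * Q ^ 2 / c * T := abs_le.2 ⟨by linarith, by linarith⟩
  calc _ ≤ 14 * δ + 2 * (8 * Q ^ 2 / c * T) + (10 * δ + 8 * Q ^ 2 / c * T) := add_le_add f0 f1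
    _ = _ := by ring

/-- The two eigenvalues of the Hessian stay apart uniformly over a regular region. -/
lemma RegularRegion.exists_gap {f : Plane → ℝ} {H : Set Plane} (hH : RegularRegion f H)
    (hf : Continuous (d2 f)) : ∃ c > 0, ∀ x ∈ H, c ≤ ‖gapVec (d2 f x)‖ := by
  have hpos : ∀ x ∈ H, 0 < ‖gapVec (d2 f x)‖ := fun x hx => by
    rw [norm_pos_iff]
    intro h0
    obtain ⟨a, b, hab, ha, hb⟩ := hH.distinct x hx
    have e0 : d2 f x 2 = d2 f x 0 := by
      have := congrArg (fun v : Plane => v 0) h0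
      simp [gapVec] at this
      linarith
    have e1 : d2 f x 1 = 0 := by
      have := congrArg (fun v : Plane => v 1) h0
      simpa [gapVec] using this
    have hscalar : ∀ c, Module.End.HasEigenvalue (Matrix.toLin' (hessian f x)) c →
        c = d2 f x 0 := fun c hc => by
      obtain ⟨v, hv⟩ := hc.exists_hasEigenvector
      have h1 := hv.apply_eq_smul
      have h2 : Matrix.toLin' (hessian f x) v = d2 f x 0 • v := by
        ext i
        rw [Matrix.toLin'_apply]
        fin_cases i <;> simp [hessian, Matrix.mulVec, dotProduct, Fin.sum_univ_two, e0, e1]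
      rw [h2] at h1
      exact (smul_left_injective ℝ hv.2 h1).symm
    exact hab ((hscalar a ha).trans (hscalar b hb).symm)
  have hgv := continuous_gapVec
  rcases H.eq_empty_or_nonempty with rfl | hne
  · exact ⟨1, one_pos, by simp⟩
  · obtain ⟨x, hx, hmin⟩ := hH.isCompact.exists_isMinOn hne
      ((hgv.comp hf).norm.continuousOn)
    exact ⟨_, hpos x hx, fun y hy => hmin hy⟩

/-! ### Deviations of rescaled kernels, at points and along curves -/

/-- The properties of a derivative `θ` of the kernel used below: it is bounded by `C`, `C`-Lipschitz,
and vanishes off the unit ball. -/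
structure IsBump (θ : Plane → ℝ) (C : ℝ) : Prop where
  pos : 0 < C
  bound : ∀ z, |θ z| ≤ C
  lipschitz : ∀ z w, |θ z - θ w| ≤ C * ‖z - w‖
  eq_zero : ∀ z, 1 < ‖z‖ → θ z = 0

/-- The mass that `μ` gives to small balls centred in the ball of radius `R` is at most
proportional to their area. -/
def SmallBallBound (μ : Measure Plane) (R A : ℝ) : Prop :=
  ∀ x, ‖x‖ ≤ R → ∀ h, 0 < h → h ≤ 1 → μ.real (Metric.closedBall x h) ≤ A * h ^ 2

namespace IsBump

variable {θ : Plane → ℝ} {C : ℝ} {μ : Measure Plane} {R A : ℝ}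

lemma continuous (hθ : IsBump θ C) : Continuous θ := by
  have : LipschitzWith ⟨C, hθ.pos.le⟩ θ := LipschitzWith.of_dist_le_mul fun z w => by
    rw [Real.dist_eq, dist_eq_norm]
    exact hθ.lipschitz z w
  exact this.continuous

lemma abs_scaled_sub_le (hθ : IsBump θ C) {h : ℝ} (hh : 0 < h) (x x' y : Plane) :
    |θ (h⁻¹ • (x - y)) - θ (h⁻¹ • (x' - y))| ≤ C * h⁻¹ * ‖x - x'‖ := by
  refine (hθ.lipschitz _ _).trans ?_
  rw [← smul_sub, sub_sub_sub_cancel_right, norm_smul, norm_inv, Real.norm_of_nonneg hh.le,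
    mul_assoc]

lemma abs_scaled_le_indicator (hθ : IsBump θ C) {h : ℝ} (hh : 0 < h) (x y : Plane) :
    |θ (h⁻¹ • (x - y))| ≤ (Metric.closedBall x h).indicator (fun _ => C) y := by
  by_cases hy : y ∈ Metric.closedBall x h
  · rw [Set.indicator_of_mem hy]
    exact hθ.bound _
  · rw [Set.indicator_of_notMem hy, eq_zero_scaled hθ.eq_zero hh, abs_zero]
    rw [Metric.mem_closedBall, dist_comm, dist_eq_norm] at hy
    linarith

lemma integral_abs_scaled_le [IsFiniteMeasure μ] (hθ : IsBump θ C) (hμ : SmallBallBound μ R A)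
    {h : ℝ} (hh : 0 < h) (hh1 : h ≤ 1) {x : Plane} (hx : ‖x‖ ≤ R) :
    ∫ y, |θ (h⁻¹ • (x - y))| ∂μ ≤ C * A * h ^ 2 := by
  have hc := hθ.continuous
  calc ∫ y, |θ (h⁻¹ • (x - y))| ∂μ
      ≤ ∫ y, (Metric.closedBall x h).indicator (fun _ => C) y ∂μ :=
        integral_mono (integrable_of_abs_le (b := C) (by fun_prop) fun y => by
          rw [abs_abs]
          exact hθ.bound _)
          ((integrable_const C).indicator Metric.isClosed_closedBall.measurableSet)
          fun y => hθ.abs_scaled_le_indicator hh x y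
    _ = μ.real (Metric.closedBall x h) * C := by
        rw [integral_indicator_const _ Metric.isClosed_closedBall.measurableSet, smul_eq_mul]
    _ ≤ A * h ^ 2 * C := by
        have := hθ.pos
        gcongr
        exact hμ x hx h hh hh1
    _ = _ := by ring

lemma integral_sq_scaled_le [IsFiniteMeasure μ] (hθ : IsBump θ C) (hμ : SmallBallBound μ R A)
    {h : ℝ} (hh : 0 < h) (hh1 : h ≤ 1) {x : Plane} (hx : ‖x‖ ≤ R) :
    ∫ y, θ (h⁻¹ • (x - y)) ^ 2 ∂μ ≤ C ^ 2 * A * h ^ 2 := by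
  have hc := hθ.continuous
  calc ∫ y, θ (h⁻¹ • (x - y)) ^ 2 ∂μ ≤ ∫ y, C * |θ (h⁻¹ • (x - y))| ∂μ :=
        integral_mono (integrable_of_abs_le (b := C ^ 2) (by fun_prop) fun y => by
          rw [abs_pow]
          exact pow_le_pow_left₀ (abs_nonneg _) (hθ.bound _) 2)
          ((integrable_of_abs_le (b := C) (by fun_prop) fun y => by
            rw [abs_abs]
            exact hθ.bound _).const_mul C) fun y => by
          show θ _ ^ 2 ≤ C * |θ _|
          rw [← sq_abs, pow_two]
          exact mul_le_mul_of_nonneg_right (hθ.bound _) (abs_nonneg _)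
    _ = C * ∫ y, |θ (h⁻¹ • (x - y))| ∂μ := integral_const_mul _ _
    _ ≤ C * (C * A * h ^ 2) :=
        mul_le_mul_of_nonneg_left (hθ.integral_abs_scaled_le hμ hh hh1 hx) hθ.pos.le
    _ = _ := by ring

variable {Ω : Type*} [MeasurableSpace Ω] {P : Measure Ω} [IsProbabilityMeasure P]
  [IsProbabilityMeasure μ] {ξ : ℕ → Ω → Plane}

/-- Uniform deviation of a kernel average over a ball of points. -/
lemma measure_exists_point_le (hθ : IsBump θ C) (hξ : ∀ i, Measurable (ξ i))
    (hind : iIndepFun ξ P) (hlaw : ∀ i, P.map (ξ i) = μ) (hμ : SmallBallBound μ R A)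
    (hR0 : 0 ≤ R) (hA : 0 < A) {h : ℝ} (hh : 0 < h) (hh1 : h ≤ 1) {n : ℕ} (hn : 2 ≤ n)
    (hnh : 4 * Real.log n ≤ n * (A * h ^ 2)) :
    P {ω | ∃ x, ‖x‖ ≤ R ∧ 8 * √(C ^ 2 * A * h ^ 2 * Real.log n / n) + 4 * C * h⁻¹ / n ^ 2
        < |deviation μ (fun y => θ (h⁻¹ • (x - y))) n fun i => ξ i ω|} ≤
      ENNReal.ofReal (2 * (2 * R + 3) ^ 3 / n) := by
  have hC := hθ.pos
  have hc := hθ.continuous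
  have := measure_exists_lt_abs_deviation_le hξ hind hlaw
    (S := {x : Plane // ‖x‖ ≤ R}) (fun x => ![x.1 0, x.1 1, 0]) (R := R)
    (fun x i => by
      fin_cases i
      · exact (abs_apply_le_norm x.1 0).trans x.2
      · exact (abs_apply_le_norm x.1 1).trans x.2
      · simpa using hR0) hR0
    (fun x y => θ (h⁻¹ • (x.1 - y))) (fun x => by fun_prop) (fun x y => hθ.bound _) hC.le
    (fun x => hθ.integral_sq_scaled_le hμ hh hh1 x.2) (by positivity) (D := 2 * C * h⁻¹)
    (fun x x' ρ hρ y => by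
      refine (hθ.abs_scaled_sub_le hh x.1 x'.1 y).trans ?_
      have h0 := hρ 0
      have h1 := hρ 1
      have h2 := norm_le_abs_add_abs (x.1 - x'.1)
      simp only [Matrix.cons_val_zero, Matrix.cons_val_one, PiLp.sub_apply] at h0 h1 h2
      calc C * h⁻¹ * ‖x.1 - x'.1‖ ≤ C * h⁻¹ * (2 * ρ) := by gcongr; linarith
        _ = _ := by ring)
    hn (by nlinarith [mul_le_mul_of_nonneg_left hnh (sq_nonneg C)])
  refine (measure_mono fun ω hω => ?_).trans this
  rw [Set.mem_ofPred_eq] at hω ⊢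
  obtain ⟨x, hx, hlt⟩ := hω
  refine ⟨⟨x, hx⟩, lt_of_le_of_lt (le_of_eq ?_) hlt⟩
  ring

end IsBump

/-- A set of pairs of a starting point and an end time, with the curves `X` that start there: all
the curves run inside the ball of radius `R` and for a time of at most `T`, move away from each of
their points with speed at least `γ`, and depend on the starting point in a Lipschitz way. -/
structure IsCurveFamily (S : Set (Plane × ℝ)) (X : Plane → ℝ → Plane) (R T γ B : ℝ) : Prop where
  continuous : ∀ p ∈ S, Continuous (X p.1)
  norm_start : ∀ p ∈ S, ‖p.1‖ ≤ R
  time : ∀ p ∈ S, |p.2| ≤ T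
  norm_le : ∀ p ∈ S, ∀ l ∈ Set.uIcc 0 p.2, ‖X p.1 l‖ ≤ R
  speed : ∀ p ∈ S, ∀ s ∈ Set.uIcc 0 p.2, ∀ u ∈ Set.uIcc 0 p.2, γ * |u - s| ≤ ‖X p.1 u - X p.1 s‖
  start : ∀ p ∈ S, ∀ p' ∈ S, ∀ l, |l| ≤ T → ‖X p.1 l - X p'.1 l‖ ≤ B * ‖p.1 - p'.1‖

/-- The weighted integral of a kernel along the curve `c` up to the time `t`, as a function of the
centre `y` of the kernel. -/
noncomputable def curveAverage (α θ : Plane → ℝ) (h : ℝ) (c : ℝ → Plane) (t : ℝ) (y : Plane) : ℝ :=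
  ∫ l in (0 : ℝ)..t, α (c l) * θ (h⁻¹ • (c l - y))

namespace IsBump

variable {θ α : Plane → ℝ} {C D : ℝ} {μ : Measure Plane} {R A T γ B : ℝ}

lemma abs_integrand_le (hθ : IsBump θ C) (hα : ∀ x, |α x| ≤ 1) (x z : Plane) :
    |α x * θ z| ≤ C := by
  rw [abs_mul]
  calc |α x| * |θ z| ≤ 1 * C := mul_le_mul (hα x) (hθ.bound z) (abs_nonneg _) zero_le_one
    _ = C := one_mul C

lemma isFiniteMeasure_restrict_uIoc (s t : ℝ) :
    IsFiniteMeasure (volume.restrict (Set.uIoc s t)) :=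
  inferInstanceAs (IsFiniteMeasure (volume.restrict (Set.Ioc _ _)))

lemma integrable_uncurry [IsFiniteMeasure μ] (hθ : IsBump θ C) (hαc : Continuous α)
    (hα : ∀ x, |α x| ≤ 1) {c : ℝ → Plane} (hc : Continuous c) (h t : ℝ) :
    Integrable (Function.uncurry fun l y => α (c l) * θ (h⁻¹ • (c l - y)))
      ((volume.restrict (Set.uIoc 0 t)).prod μ) := by
  have := hθ.continuous
  have := isFiniteMeasure_restrict_uIoc 0 t
  refine Integrable.of_bound (Continuous.aestronglyMeasurable (by fun_prop)) C
    (ae_of_all _ fun p => hθ.abs_integrand_le hα _ _)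

/-- The deviation of a weighted integral along a curve is the weighted integral of the
deviations. -/
lemma deviation_curveAverage [IsFiniteMeasure μ] (hθ : IsBump θ C) (hαc : Continuous α)
    (hα : ∀ x, |α x| ≤ 1) {c : ℝ → Plane} (hc : Continuous c) (h t : ℝ) (n : ℕ)
    (y : ℕ → Plane) :
    deviation μ (curveAverage α θ h c t) n y = ∫ l in (0 : ℝ)..t,
      α (c l) * deviation μ (fun z => θ (h⁻¹ • (c l - z))) n y := by
  have hθc := hθ.continuous
  have hi : ∀ z, IntervalIntegrable (fun l => α (c l) * θ (h⁻¹ • (c l - z))) volume 0 t :=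
    fun z => Continuous.intervalIntegrable (by fun_prop) _ _
  have hsum : IntervalIntegrable (fun l => (n : ℝ)⁻¹ * ∑ i ∈ Finset.range n,
      α (c l) * θ (h⁻¹ • (c l - y i))) volume 0 t :=
    Continuous.intervalIntegrable (by fun_prop) _ _
  have huncurry := hθ.integrable_uncurry (μ := μ) hαc hα hc h t
  have hmean : IntervalIntegrable (fun l => ∫ z, α (c l) * θ (h⁻¹ • (c l - z)) ∂μ) volume 0 t :=
    intervalIntegrable_iff.2 huncurry.integral_prod_left
  simp only [deviation, curveAverage]
  rw [← intervalIntegral_integral_swap huncurry, ← intervalIntegral.integral_finsetSum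
    fun i _ => hi (y i), ← intervalIntegral.integral_const_mul,
    ← intervalIntegral.integral_sub hsum hmean]
  congr 1
  funext l
  rw [integral_const_mul, mul_sub, ← Finset.mul_sum]
  ring

lemma integral_abs_curveAverage_le [IsFiniteMeasure μ] (hθ : IsBump θ C) (hαc : Continuous α)
    (hα : ∀ x, |α x| ≤ 1) (hμ : SmallBallBound μ R A) (hA : 0 < A) {h : ℝ} (hh : 0 < h)
    (hh1 : h ≤ 1) {c : ℝ → Plane} (hc : Continuous c) {t : ℝ} (ht : |t| ≤ T)
    (hcR : ∀ l ∈ Set.uIcc 0 t, ‖c l‖ ≤ R) :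
    ∫ y, |curveAverage α θ h c t y| ∂μ ≤ T * (C * A * h ^ 2) := by
  have hθc := hθ.continuous
  have hC := hθ.pos
  have huncurry := hθ.integrable_uncurry (μ := μ) hαc hα hc h t
  have hnorm := huncurry.norm
  have := isFiniteMeasure_restrict_uIoc 0 t
  calc ∫ y, |curveAverage α θ h c t y| ∂μ
      ≤ ∫ y, (∫ l in Set.uIoc 0 t, |α (c l) * θ (h⁻¹ • (c l - y))|) ∂μ := by
        refine integral_mono_of_nonneg (ae_of_all _ fun y => abs_nonneg _)
          hnorm.integral_prod_right (ae_of_all _ fun y => ?_)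
        show |curveAverage α θ h c t y| ≤ _
        rw [← Real.norm_eq_abs, curveAverage]
        exact intervalIntegral.norm_integral_le_integral_norm_uIoc
    _ = ∫ l in Set.uIoc 0 t, ∫ y, |α (c l) * θ (h⁻¹ • (c l - y))| ∂μ :=
        (integral_integral_swap hnorm).symm
    _ ≤ ∫ l in Set.uIoc 0 t, C * A * h ^ 2 := by
        refine setIntegral_mono_on hnorm.integral_prod_left (integrable_const _)
          measurableSet_uIoc fun l hl => ?_
        refine le_trans ?_ (hθ.integral_abs_scaled_le hμ hh hh1
          (hcR l (Set.uIoc_subset_uIcc hl)))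
        refine integral_mono (integrable_of_abs_le (b := C) (by fun_prop) fun y => by
          rw [abs_abs]
          exact hθ.abs_integrand_le hα _ _)
          (integrable_of_abs_le (b := C) (by fun_prop) fun y => by
            rw [abs_abs]
            exact hθ.bound _) fun y => ?_
        show |_| ≤ |_|
        rw [abs_mul]
        exact mul_le_of_le_one_left (abs_nonneg _) (hα _)
    _ = |t| * (C * A * h ^ 2) := by
        rw [setIntegral_const, smul_eq_mul, measureReal_def, Set.uIoc, Real.volume_Ioc,
          ENNReal.toReal_ofReal (by simp), max_sub_min_eq_abs, sub_zero]
    _ ≤ _ := by gcongr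

/-- A curve that moves away from its points stays in a ball of radius `h` for a time of order `h`
only, which bounds the integral of a rescaled kernel along it. -/
lemma abs_curveAverage_le (hθ : IsBump θ C) (hα : ∀ x, |α x| ≤ 1) {h : ℝ} (hh : 0 < h)
    {c : ℝ → Plane} (hc : Continuous c) (hγ : 0 < γ) {t : ℝ}
    (hspeed : ∀ s ∈ Set.uIcc 0 t, ∀ u ∈ Set.uIcc 0 t, γ * |u - s| ≤ ‖c u - c s‖) (y : Plane) :
    |curveAverage α θ h c t y| ≤ 2 * C / γ * h := by
  have hC := hθ.pos
  set N : Set ℝ := {l | l ∈ Set.uIcc 0 t ∧ c l ∈ Metric.closedBall y h} with hN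
  have hNm : MeasurableSet N := by
    have : N = Set.uIcc 0 t ∩ c ⁻¹' Metric.closedBall y h := rfl
    rw [this]
    exact (isClosed_Icc.inter (Metric.isClosed_closedBall.preimage hc)).measurableSet
  have hdiam : Metric.ediam N ≤ ENNReal.ofReal (2 * h / γ) := by
    refine Metric.ediam_le fun s hs u hu => ?_
    rw [edist_dist, Real.dist_eq]
    refine ENNReal.ofReal_le_ofReal ?_
    rw [le_div_iff₀ hγ, mul_comm]
    refine (hspeed u hu.1 s hs.1).trans ?_
    rw [← dist_eq_norm]
    have h1 := Metric.mem_closedBall.1 hs.2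
    have h2 := Metric.mem_closedBall'.1 hu.2
    linarith [dist_triangle (c s) y (c u)]
  have hvol : volume.real N ≤ 2 * h / γ :=
    ENNReal.toReal_le_of_le_ofReal (by positivity) ((Real.volume_le_diam N).trans hdiam)
  have hNfin : volume N ≠ ∞ := ((Real.volume_le_diam N).trans hdiam).trans_lt
    ENNReal.ofReal_lt_top |>.ne
  have hbound : ∀ l ∈ Set.uIoc 0 t, ‖α (c l) * θ (h⁻¹ • (c l - y))‖
      ≤ N.indicator (fun _ => C) l := fun l hl => by
    by_cases hlN : l ∈ N
    · rw [Set.indicator_of_mem hlN]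
      exact hθ.abs_integrand_le hα _ _
    · have hout : h < ‖c l - y‖ := by
        by_contra! hle
        refine hlN ⟨Set.uIoc_subset_uIcc hl, ?_⟩
        rwa [Metric.mem_closedBall, dist_eq_norm]
      rw [eq_zero_scaled hθ.eq_zero hh hout, mul_zero, norm_zero]
      exact Set.indicator_nonneg (fun _ _ => hC.le) _
  have hNi : Integrable (N.indicator fun _ => C) volume :=
    (integrable_indicator_iff hNm).2 (integrableOn_const hNfin)
  calc |curveAverage α θ h c t y|
      ≤ ∫ l in Set.uIoc 0 t, ‖α (c l) * θ (h⁻¹ • (c l - y))‖ := by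
        rw [← Real.norm_eq_abs, curveAverage]
        exact intervalIntegral.norm_integral_le_integral_norm_uIoc
    _ ≤ ∫ l in Set.uIoc 0 t, N.indicator (fun _ => C) l := by
        refine integral_mono_of_nonneg (ae_of_all _ fun _ => norm_nonneg _) hNi.integrableOn ?_
        exact (ae_restrict_iff' measurableSet_uIoc).2 (ae_of_all _ hbound)
    _ ≤ ∫ l, N.indicator (fun _ => C) l :=
        setIntegral_le_integral hNi (ae_of_all _ fun l =>
          Set.indicator_nonneg (fun _ _ => hC.le) l)
    _ = volume.real N * C := by rw [integral_indicator_const _ hNm, smul_eq_mul]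
    _ ≤ 2 * h / γ * C := by gcongr
    _ = _ := by ring

lemma abs_curveAverage_sub_le (hθ : IsBump θ C) (hαc : Continuous α) (hα : ∀ x, |α x| ≤ 1)
    (hαL : ∀ x y, |α x - α y| ≤ D * ‖x - y‖) (hD : 0 ≤ D) {h : ℝ} (hh : 0 < h) (hh1 : h ≤ 1)
    {c d : ℝ → Plane} (hc : Continuous c) (hd : Continuous d) {s t T ρ : ℝ} (hs : |s| ≤ T)
    (ht : |t| ≤ T)
    (hst : |t - s| ≤ ρ) (hcd : ∀ l, |l| ≤ T → ‖c l - d l‖ ≤ B * ρ) (y : Plane) :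
    |curveAverage α θ h c t y - curveAverage α θ h d s y|
      ≤ (C + T * B * C * (D + 1)) * h⁻¹ * ρ := by
  have hθc := hθ.continuous
  have hC := hθ.pos
  have hρ : 0 ≤ ρ := (abs_nonneg _).trans hst
  have hT : 0 ≤ T := (abs_nonneg _).trans ht
  have hB : 0 ≤ B * ρ := (norm_nonneg _).trans (hcd 0 (by simpa using hT))
  have hhinv : 1 ≤ h⁻¹ := (one_le_inv₀ hh).2 hh1
  have hi : ∀ {c : ℝ → Plane}, Continuous c → ∀ a b, IntervalIntegrable
      (fun l => α (c l) * θ (h⁻¹ • (c l - y))) volume a b := fun hc a b =>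
    Continuous.intervalIntegrable (by fun_prop) _ _
  have hpt : ∀ l, |l| ≤ T → |α (c l) * θ (h⁻¹ • (c l - y)) - α (d l) * θ (h⁻¹ • (d l - y))|
      ≤ B * C * (D + 1) * h⁻¹ * ρ := fun l hl => by
    have e : α (c l) * θ (h⁻¹ • (c l - y)) - α (d l) * θ (h⁻¹ • (d l - y))
        = (α (c l) - α (d l)) * θ (h⁻¹ • (c l - y))
          + α (d l) * (θ (h⁻¹ • (c l - y)) - θ (h⁻¹ • (d l - y))) := by ring
    rw [e]
    refine (abs_add_le _ _).trans ?_
    rw [abs_mul, abs_mul]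
    have h1 := hcd l hl
    have h2 : |α (c l) - α (d l)| ≤ D * (B * ρ) := (hαL _ _).trans (by gcongr)
    have h3 : |θ (h⁻¹ • (c l - y)) - θ (h⁻¹ • (d l - y))| ≤ C * h⁻¹ * (B * ρ) :=
      (hθ.abs_scaled_sub_le hh _ _ y).trans (by gcongr)
    calc _ ≤ D * (B * ρ) * C + 1 * (C * h⁻¹ * (B * ρ)) :=
          add_le_add (mul_le_mul h2 (hθ.bound _) (abs_nonneg _) (by positivity))
            (mul_le_mul (hα _) h3 (abs_nonneg _) zero_le_one)
      _ ≤ D * (B * ρ) * C * h⁻¹ + 1 * (C * h⁻¹ * (B * ρ)) := by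
          have := le_mul_of_one_le_right (show 0 ≤ D * (B * ρ) * C by positivity) hhinv
          linarith
      _ = _ := by ring
  have e1 : curveAverage α θ h c t y - curveAverage α θ h d s y
      = (∫ l in s..t, α (c l) * θ (h⁻¹ • (c l - y)))
        + ∫ l in (0 : ℝ)..s,
          (α (c l) * θ (h⁻¹ • (c l - y)) - α (d l) * θ (h⁻¹ • (d l - y))) := by
    rw [intervalIntegral.integral_sub (hi hc _ _) (hi hd _ _)]
    simp only [curveAverage]
    rw [← intervalIntegral.integral_add_adjacent_intervals (hi hc 0 s) (hi hc s t)]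
    ring
  have h1 : |∫ l in s..t, α (c l) * θ (h⁻¹ • (c l - y))| ≤ C * ρ := by
    have := intervalIntegral.norm_integral_le_of_norm_le_const (a := s) (b := t) (C := C)
      (f := fun l => α (c l) * θ (h⁻¹ • (c l - y))) fun l _ => hθ.abs_integrand_le hα _ _
    refine this.trans ?_
    gcongr
  have h2 : |∫ l in (0 : ℝ)..s,
      (α (c l) * θ (h⁻¹ • (c l - y)) - α (d l) * θ (h⁻¹ • (d l - y)))|
        ≤ B * C * (D + 1) * h⁻¹ * ρ * T := by
    have := intervalIntegral.norm_integral_le_of_norm_le_const (a := 0) (b := s)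
      (C := B * C * (D + 1) * h⁻¹ * ρ)
      (f := fun l => α (c l) * θ (h⁻¹ • (c l - y)) - α (d l) * θ (h⁻¹ • (d l - y)))
      fun l hl => hpt l (by
        have := Set.abs_sub_left_of_mem_uIcc (Set.uIoc_subset_uIcc hl)
        rw [sub_zero, sub_zero] at this
        exact this.trans hs)
    rw [sub_zero] at this
    refine this.trans ?_
    have h0 : 0 ≤ B * ρ * (C * (D + 1) * h⁻¹) := by positivity
    exact mul_le_mul_of_nonneg_left hs (by linarith)
  rw [e1]
  calc _ ≤ C * ρ + B * C * (D + 1) * h⁻¹ * ρ * T := (abs_add_le _ _).trans (add_le_add h1 h2)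
    _ ≤ C * ρ * h⁻¹ + B * C * (D + 1) * h⁻¹ * ρ * T := by
        have := le_mul_of_one_le_right (show 0 ≤ C * ρ by positivity) hhinv
        linarith
    _ = _ := by ring

variable {Ω : Type*} [MeasurableSpace Ω] {P : Measure Ω} [IsProbabilityMeasure P]
  [IsProbabilityMeasure μ] {ξ : ℕ → Ω → Plane}

lemma continuous_curveAverage (hθ : IsBump θ C) (hαc : Continuous α) {c : ℝ → Plane}
    (hc : Continuous c) (h t : ℝ) : Continuous (curveAverage α θ h c t) := by
  have hθc := hθ.continuous
  exact intervalIntegral.continuous_parametric_intervalIntegral_of_continuous' (by fun_prop) _ _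

lemma integral_sq_curveAverage_le (hθ : IsBump θ C) (hαc : Continuous α)
    (hα : ∀ x, |α x| ≤ 1) (hμ : SmallBallBound μ R A) (hA : 0 < A) (hγ : 0 < γ) {h : ℝ}
    (hh : 0 < h) (hh1 : h ≤ 1) {c : ℝ → Plane} (hc : Continuous c) {t : ℝ} (ht : |t| ≤ T)
    (hcR : ∀ l ∈ Set.uIcc 0 t, ‖c l‖ ≤ R)
    (hspeed : ∀ s ∈ Set.uIcc 0 t, ∀ u ∈ Set.uIcc 0 t, γ * |u - s| ≤ ‖c u - c s‖) :
    ∫ y, curveAverage α θ h c t y ^ 2 ∂μ ≤ 2 * T * C ^ 2 * A / γ * h ^ 3 := by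
  have hC := hθ.pos
  have hm := hθ.continuous_curveAverage hαc hc h t
  have hb := hθ.abs_curveAverage_le hα hh hc hγ hspeed
  calc ∫ y, curveAverage α θ h c t y ^ 2 ∂μ
      ≤ ∫ y, 2 * C / γ * h * |curveAverage α θ h c t y| ∂μ :=
        integral_mono (integrable_of_abs_le (b := (2 * C / γ * h) ^ 2) (by fun_prop) fun y => by
          rw [abs_pow]
          exact pow_le_pow_left₀ (abs_nonneg _) (hb y) 2)
          ((integrable_of_abs_le (b := 2 * C / γ * h) (by fun_prop) fun y => by
            rw [abs_abs]
            exact hb y).const_mul _) fun y => by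
          show _ ^ 2 ≤ 2 * C / γ * h * |_|
          rw [← sq_abs, pow_two]
          exact mul_le_mul_of_nonneg_right (hb y) (abs_nonneg _)
    _ = 2 * C / γ * h * ∫ y, |curveAverage α θ h c t y| ∂μ := integral_const_mul _ _
    _ ≤ 2 * C / γ * h * (T * (C * A * h ^ 2)) := by
        gcongr
        exact hθ.integral_abs_curveAverage_le hαc hα hμ hA hh hh1 hc ht hcR
    _ = _ := by ring

/-- Uniform deviation of integrals of a rescaled kernel along a family of curves. The integration
gains a factor `h` in the variance compared to the deviation at points. -/
lemma measure_exists_curve_le (hθ : IsBump θ C) (hαc : Continuous α) (hα : ∀ x, |α x| ≤ 1)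
    (hαL : ∀ x y, |α x - α y| ≤ D * ‖x - y‖) (hD : 0 ≤ D) (hξ : ∀ i, Measurable (ξ i))
    (hind : iIndepFun ξ P) (hlaw : ∀ i, P.map (ξ i) = μ) (hμ : SmallBallBound μ R A)
    (hA : 0 < A) {S : Set (Plane × ℝ)} {X : Plane → ℝ → Plane}
    (hX : IsCurveFamily S X R T γ B) (hγ : 0 < γ) (hT : 0 < T) (hB : 0 ≤ B) (hR : 0 ≤ R)
    {h : ℝ} (hh : 0 < h) (hh1 : h ≤ 1) {n : ℕ} (hn : 2 ≤ n)
    (hnh : 8 * Real.log n ≤ n * (γ * T * A * h)) :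
    P {ω | ∃ p ∈ S, 8 * √(2 * T * C ^ 2 * A / γ * h ^ 3 * Real.log n / n)
        + 2 * ((C + T * (2 * B) * C * (D + 1)) * h⁻¹) / n ^ 2
        < |deviation μ (curveAverage α θ h (X p.1) p.2) n fun i => ξ i ω|} ≤
      ENNReal.ofReal (2 * (2 * (R + T) + 3) ^ 3 / n) := by
  have hC := hθ.pos
  have := measure_exists_lt_abs_deviation_le hξ hind hlaw
    (S := S) (fun p => ![p.1.1 0, p.1.1 1, p.1.2]) (R := R + T)
    (fun p i => by
      have h1 := hX.norm_start p p.2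
      have h2 := hX.time p p.2
      fin_cases i
      · exact (abs_apply_le_norm p.1.1 0).trans (by linarith)
      · exact (abs_apply_le_norm p.1.1 1).trans (by linarith)
      · exact h2.trans (by linarith)) (by positivity)
    (fun p => curveAverage α θ h (X p.1.1) p.1.2)
    (fun p => (hθ.continuous_curveAverage hαc (hX.continuous p p.2) h _).measurable)
    (fun p y => hθ.abs_curveAverage_le hα hh (hX.continuous p p.2) hγ (hX.speed p p.2) y)
    (by positivity)
    (fun p => hθ.integral_sq_curveAverage_le hαc hα hμ hA hγ hh hh1 (hX.continuous p p.2)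
      (hX.time p p.2) (hX.norm_le p p.2) (hX.speed p p.2))
    (by positivity) (D := (C + T * (2 * B) * C * (D + 1)) * h⁻¹)
    (fun p p' ρ hρ y => by
      refine hθ.abs_curveAverage_sub_le hαc hα hαL hD hh hh1 (hX.continuous p p.2)
        (hX.continuous p' p'.2) (hX.time p' p'.2) (hX.time p p.2) (hρ 2) (fun l hl => ?_) y
      refine (hX.start p p.2 p' p'.2 l hl).trans ?_
      have h0 := hρ 0
      have h1 := hρ 1
      have h2 := norm_le_abs_add_abs (p.1.1 - p'.1.1)
      simp only [Matrix.cons_val_zero, Matrix.cons_val_one, PiLp.sub_apply] at h0 h1 h2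
      calc B * ‖p.1.1 - p'.1.1‖ ≤ B * (2 * ρ) := by gcongr; linarith
        _ = _ := by ring)
    hn (by
      have h1 := mul_le_mul_of_nonneg_left hnh
        (show 0 ≤ 2 * C ^ 2 * h ^ 2 / γ ^ 2 by positivity)
      calc 4 * (2 * C / γ * h) ^ 2 * Real.log n
          = 2 * C ^ 2 * h ^ 2 / γ ^ 2 * (8 * Real.log n) := by ring
        _ ≤ _ := h1
        _ = _ := by field_simp)
  refine (measure_mono fun ω hω => ?_).trans this
  rw [Set.mem_ofPred_eq] at hω ⊢
  obtain ⟨p, hp, hlt⟩ := hω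
  exact ⟨⟨p, hp⟩, hlt⟩

end IsBump

/-! ### Second and third derivatives of the kernel density estimator -/

lemma FourDerivs.mono {g : Plane → ℝ} {C C' : ℝ} (hg : FourDerivs g C) (h : C ≤ C') :
    FourDerivs g C' :=
  ⟨hg.differentiable, fun m hm hm' x => (hg.bound m hm hm' x).trans h⟩

/-- A constant multiple of the sum of a function, rescaled by `h` and centred at the points
`y 0, …, y (n - 1)`. -/
noncomputable def kernelSum (c : ℝ) (u : Plane → ℝ) (h : ℝ) (n : ℕ) (y : ℕ → Plane) (x : Plane) :
    ℝ :=
  c * ∑ i ∈ Finset.range n, u (h⁻¹ • (x - y i))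

lemma hasFDerivAt_kernelSum (c : ℝ) {u : Plane → ℝ} (hu : Differentiable ℝ u) (h : ℝ) (n : ℕ)
    (y : ℕ → Plane) (x : Plane) :
    HasFDerivAt (kernelSum c u h n y)
      (c • ∑ i ∈ Finset.range n, h⁻¹ • fderiv ℝ u (h⁻¹ • (x - y i))) x := by
  have h1 : ∀ i ∈ Finset.range n, HasFDerivAt (fun x => u (h⁻¹ • (x - y i)))
      (h⁻¹ • fderiv ℝ u (h⁻¹ • (x - y i))) x := fun i _ => by
    have h2 : HasFDerivAt (fun x : Plane => h⁻¹ • (x - y i))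
        (h⁻¹ • ContinuousLinearMap.id ℝ Plane) x := 
      ((hasFDerivAt_id x).sub_const (y i)).const_smul h⁻¹
    have := (hu _).hasFDerivAt.comp x h2
    convert! this using 1
    ext v
    simp
  have := (HasFDerivAt.fun_sum h1).const_smul c
  exact this

lemma partialDeriv_kernelSum (c : ℝ) {u : Plane → ℝ} (hu : Differentiable ℝ u) (h : ℝ) (n : ℕ)
    (y : ℕ → Plane) (a : Fin 2) :
    partialDeriv a (kernelSum c u h n y) = kernelSum (c * h⁻¹) (partialDeriv a u) h n y := by
  funext x
  rw [partialDeriv, (hasFDerivAt_kernelSum c hu h n y x).fderiv]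
  simp only [kernelSum, partialDeriv, smul_apply, sum_apply, smul_eq_mul,
    ← Finset.mul_sum]
  ring

variable {f K : Plane → ℝ} {C C' : ℝ}

lemma kde_eq_kernelSum (K : Plane → ℝ) (h : ℝ) (n : ℕ) (y : ℕ → Plane) :
    kde K h n y = kernelSum (1 / (n * h ^ 2)) K h n y := rfl

lemma partialDeriv_two_kde (hK : FourDerivs K C) (h : ℝ) (n : ℕ) (y : ℕ → Plane) (a b : Fin 2) :
    partialDeriv a (partialDeriv b (kde K h n y)) =
      kernelSum (1 / (n * h ^ 2) * h⁻¹ * h⁻¹) (partialDeriv a (partialDeriv b K)) h n y := by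
  rw [kde_eq_kernelSum, partialDeriv_kernelSum _ hK.differentiable_zero,
    partialDeriv_kernelSum _ (hK.differentiable_one b)]

lemma partialDeriv_three_kde (hK : FourDerivs K C) (h : ℝ) (n : ℕ) (y : ℕ → Plane)
    (c a b : Fin 2) :
    partialDeriv c (partialDeriv a (partialDeriv b (kde K h n y))) =
      kernelSum (1 / (n * h ^ 2) * h⁻¹ * h⁻¹ * h⁻¹)
        (partialDeriv c (partialDeriv a (partialDeriv b K))) h n y := by
  rw [partialDeriv_two_kde hK, partialDeriv_kernelSum _ (hK.differentiable_two a b)]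

lemma kernelSum_eq_deviation (μ : Measure Plane) (u : Plane → ℝ) (h : ℝ) (n : ℕ)
    (y : ℕ → Plane) (x : Plane) (b : ℝ) :
    kernelSum (b * (n : ℝ)⁻¹) u h n y x = b * (deviation μ (fun z => u (h⁻¹ • (x - z))) n y
      + ∫ z, u (h⁻¹ • (x - z)) ∂μ) := by
  simp only [kernelSum, deviation]
  ring

lemma continuous_d2 (hg : FourDerivs f C) : Continuous (d2 f) := by
  refine continuous_pi fun k => ?_
  simp only [d2_apply]
  exact (hg.differentiable_two _ _).continuous

lemma lipschitzWith_eigField {g : Plane → ℝ} {D : ℝ} (hD : 0 ≤ D)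
    (h : ∀ k x y, |d2 g x k - d2 g y k| ≤ D * ‖x - y‖) :
    LipschitzWith ⟨24 * D, by positivity⟩ (eigField g) :=
  LipschitzWith.of_dist_le_mul fun x y => by
    rw [dist_eq_norm, dist_eq_norm]
    refine (norm_eigG_sub_le fun k => h k x y).trans (le_of_eq ?_)
    rw [← mul_assoc]
    rfl

lemma FourDerivs.lipschitzWith_eigField (hf : FourDerivs f C) :
    LipschitzWith ⟨24 * C, by have := hf.nonneg; positivity⟩ (eigField f) :=
  IntegralCurveEstimation.lipschitzWith_eigField hf.nonneg fun k x y => by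
    rw [d2_apply, d2_apply]
    exact hf.abs_two_sub_le _ _ x y

/-- For every sample the estimated field is globally Lipschitz, with a constant that depends on the
bandwidth. -/
lemma exists_lipschitzWith_eigField_kde (hK : FourDerivs K C) (h : ℝ) (n : ℕ) (y : ℕ → Plane) :
    ∃ L, LipschitzWith L (eigField (kde K h n y)) := by
  have hC := hK.nonneg
  refine ⟨_, lipschitzWith_eigField (D := |1 / (n * h ^ 2) * h⁻¹ * h⁻¹| * (n * (C * |h⁻¹|)))
    (by positivity) fun k x x' => ?_⟩
  rw [d2_apply, d2_apply, partialDeriv_two_kde hK, kernelSum, kernelSum, ← mul_sub, abs_mul,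
    ← Finset.sum_sub_distrib, mul_assoc |_| _ ‖x - x'‖]
  refine mul_le_mul_of_nonneg_left ?_ (abs_nonneg _)
  refine (Finset.abs_sum_le_sum_abs _ _).trans
    ((Finset.sum_le_card_nsmul _ _ (C * |h⁻¹| * ‖x - x'‖) fun i _ => ?_).trans (le_of_eq ?_))
  · refine (hK.abs_two_sub_le _ _ _ _).trans (le_of_eq ?_)
    rw [← smul_sub, sub_sub_sub_cancel_right, norm_smul, Real.norm_eq_abs, mul_assoc]
  · rw [Finset.card_range, nsmul_eq_mul]
    ring

lemma isBump_two (hK : FourDerivs K C) (hC : 0 < C) (hK0 : ∀ z, 1 < ‖z‖ → K z = 0)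
    (a b : Fin 2) : IsBump (partialDeriv a (partialDeriv b K)) C :=
  ⟨hC, hK.abs_two_le a b, hK.abs_two_sub_le a b,
    partialDeriv_eq_zero (partialDeriv_eq_zero hK0 b) a⟩

lemma isBump_three (hK : FourDerivs K C) (hC : 0 < C) (hK0 : ∀ z, 1 < ‖z‖ → K z = 0)
    (c a b : Fin 2) : IsBump (partialDeriv c (partialDeriv a (partialDeriv b K))) C :=
  ⟨hC, hK.abs_three_le c a b, hK.abs_three_sub_le c a b,
    partialDeriv_eq_zero (partialDeriv_eq_zero (partialDeriv_eq_zero hK0 b) a) c⟩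

/-! ### The law of the sample points -/

/-- The probability measure with density `f`. -/
noncomputable def densityMeasure (f : Plane → ℝ) : Measure Plane :=
  volume.withDensity fun x => ENNReal.ofReal (f x)

lemma integral_densityMeasure (hf : Continuous f) (hf0 : ∀ x, 0 ≤ f x) (g : Plane → ℝ) :
    ∫ x, g x ∂densityMeasure f = ∫ x, f x * g x := by
  rw [densityMeasure, integral_withDensity_eq_integral_toReal_smul (by fun_prop)
    (ae_of_all _ fun _ => ENNReal.ofReal_lt_top)]
  congr 1
  funext x
  rw [ENNReal.toReal_ofReal (hf0 x), smul_eq_mul]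

lemma exists_smallBallBound (hf : Continuous f) (R : ℝ) :
    ∃ A > 0, SmallBallBound (densityMeasure f) R A := by
  obtain ⟨F, hF⟩ := (isCompact_closedBall (0 : Plane) (R + 1)).exists_bound_of_continuousOn
    hf.continuousOn
  set v := volume.real (Metric.closedBall (0 : Plane) 1) with hv
  refine ⟨max F 0 * v + 1, by positivity, fun x hx h hh hh1 => ?_⟩
  have hvol : volume (Metric.closedBall x h) = ENNReal.ofReal (h ^ 2 * v) := by
    rw [Measure.addHaar_closedBall' _ _ hh.le, finrank_euclideanSpace_fin,
      ENNReal.ofReal_mul (by positivity), hv, ofReal_measureReal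
        (isCompact_closedBall (0 : Plane) 1).measure_lt_top.ne]
  have hle : densityMeasure f (Metric.closedBall x h)
      ≤ ENNReal.ofReal (max F 0 * (h ^ 2 * v)) := by
    rw [densityMeasure, withDensity_apply _ Metric.isClosed_closedBall.measurableSet,
      ENNReal.ofReal_mul (by positivity), ← hvol, ← setLIntegral_const]
    refine setLIntegral_mono measurable_const fun y hy => ENNReal.ofReal_le_ofReal ?_
    refine le_max_of_le_left ((le_abs_self _).trans (hF y ?_))
    rw [mem_closedBall_zero_iff]
    have h1 := norm_le_norm_sub_add y x
    rw [Metric.mem_closedBall, dist_eq_norm] at hy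
    linarith
  refine (ENNReal.toReal_le_of_le_ofReal (by positivity) hle).trans ?_
  nlinarith [sq_nonneg h]

section Estimator

variable {h : ℝ} {n : ℕ} {y : ℕ → Plane} {R : ℝ}

/-- The error of the second derivatives of the estimator, relative to the stochastic part, is the
bias. -/
lemma abs_d2_kde_sub_le (hfd : IsDensity f) (hf : FourDerivs f C) (hK : FourDerivs K C')
    (hKr : KernelRegular K) (hh : 0 < h) (k : Fin 3) (x : Plane) :
    |d2 (kde K h n y) x k - d2 f x k - (h ^ 4)⁻¹ * deviation (densityMeasure f)
      (fun z => d2 K (h⁻¹ • (x - z)) k) n y| ≤ C * h ^ 2 := by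
  simp only [d2_apply]
  set a := (![0, 0, 1] : Fin 3 → Fin 2) k
  set b := (![0, 1, 1] : Fin 3 → Fin 2) k
  have hc : 1 / ((n : ℝ) * h ^ 2) * h⁻¹ * h⁻¹ = (h ^ 4)⁻¹ * (n : ℝ)⁻¹ := by
    simp only [one_div, mul_inv]
    field_simp
  rw [partialDeriv_two_kde hK, hc, kernelSum_eq_deviation (densityMeasure f),
    integral_densityMeasure hf.differentiable_zero.continuous hfd.nonneg,
    integral_mul_partialDeriv_two hf hK hKr.eq_zero a b hh, mul_add,
    inv_mul_cancel_left₀ (by positivity)]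
  refine le_trans (le_of_eq (congrArg abs ?_)) (abs_smoothing_sub_le hKr (hf.differentiable_two a b)
    (hf.norm_fderiv_two_sub_le a b) hf.nonneg hh x)
  ring

lemma abs_partialDeriv_three_kde_le (hfd : IsDensity f) (hf : FourDerivs f C)
    (hK : FourDerivs K C') (hKr : KernelRegular K) (hh : 0 < h) (c a b : Fin 2) (x : Plane)
    (hdev : |deviation (densityMeasure f) (fun z => partialDeriv c (partialDeriv a
      (partialDeriv b K)) (h⁻¹ • (x - z))) n y| ≤ h ^ 5) :
    |partialDeriv c (partialDeriv a (partialDeriv b (kde K h n y))) x| ≤ 1 + C := by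
  have hc : 1 / ((n : ℝ) * h ^ 2) * h⁻¹ * h⁻¹ * h⁻¹ = (h ^ 5)⁻¹ * (n : ℝ)⁻¹ := by
    simp only [one_div, mul_inv]
    field_simp
  rw [partialDeriv_three_kde hK, hc, kernelSum_eq_deviation (densityMeasure f),
    integral_densityMeasure hf.differentiable_zero.continuous hfd.nonneg,
    integral_mul_partialDeriv_three hf hK hKr.eq_zero c a b hh, mul_add,
    inv_mul_cancel_left₀ (by positivity)]
  refine (abs_add_le _ _).trans (add_le_add ?_ ?_)
  · rw [abs_mul, abs_of_pos (by positivity), inv_mul_le_iff₀ (by positivity), mul_one]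
    exact hdev
  · exact abs_integral_kernel_mul_le hKr.density fun z _ => hf.abs_three_le _ _ _ _

lemma norm_fderiv_le_of_abs_partialDeriv_le {u : Plane → ℝ} {x : Plane} {D : ℝ} (hD : 0 ≤ D)
    (h : ∀ c, |partialDeriv c u x| ≤ D) : ‖fderiv ℝ u x‖ ≤ 2 * D := by
  refine ContinuousLinearMap.opNorm_le_bound _ (by positivity) fun v => ?_
  have hv : v = v 0 • unitVec 0 + v 1 • unitVec 1 := by
    ext i
    fin_cases i <;> simp
  have h1 : fderiv ℝ u x v = v 0 * partialDeriv 0 u x + v 1 * partialDeriv 1 u x := by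
    conv_lhs => rw [hv]
    rw [map_add, map_smul, map_smul]
    rfl
  rw [h1, Real.norm_eq_abs]
  refine (abs_add_le _ _).trans ?_
  rw [abs_mul, abs_mul]
  calc |v 0| * |partialDeriv 0 u x| + |v 1| * |partialDeriv 1 u x|
      ≤ ‖v‖ * D + ‖v‖ * D := by
        gcongr
        exacts [abs_apply_le_norm v 0, h 0, abs_apply_le_norm v 1, h 1]
    _ = _ := by ring

/-- When the deviations of the third derivatives are of the order `1`, the estimated field is
Lipschitz on the ball of radius `R` with a constant that does not depend on the bandwidth. -/
lemma norm_eigField_kde_sub_le (hfd : IsDensity f) (hf : FourDerivs f C)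
    (hK : FourDerivs K C') (hKr : KernelRegular K) (hh : 0 < h)
    (hdev : ∀ (c : Fin 2) (k : Fin 3) x, ‖x‖ ≤ R → |deviation (densityMeasure f)
      (fun z => partialDeriv c (fun w => d2 K w k) (h⁻¹ • (x - z))) n y| ≤ h ^ 5) {p q : Plane}
    (hp : ‖p‖ ≤ R) (hq : ‖q‖ ≤ R) :
    ‖eigField (kde K h n y) p - eigField (kde K h n y) q‖ ≤ 48 * (1 + C) * ‖p - q‖ := by
  have hC := hf.nonneg
  have hk : ∀ k, |d2 (kde K h n y) p k - d2 (kde K h n y) q k| ≤ 2 * (1 + C) * ‖p - q‖ := fun k => by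
    rw [d2_apply, d2_apply]
    refine (convex_closedBall (0 : Plane) R).norm_image_sub_le_of_norm_fderiv_le (𝕜 := ℝ)
      (f := partialDeriv _ (partialDeriv _ (kde K h n y))) (fun x _ => ?_) (fun x hx => ?_) (by simpa using hq) (by simpa using hp)
    · rw [partialDeriv_two_kde hK]
      exact (hasFDerivAt_kernelSum _ (hK.differentiable_two _ _) _ _ _ x).differentiableAt
    · refine norm_fderiv_le_of_abs_partialDeriv_le (by positivity) fun c => ?_
      have := hdev c k x (by simpa using hx)
      simp only [d2_apply] at this
      exact abs_partialDeriv_three_kde_le hfd hf hK hKr hh c _ _ x this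
  refine (norm_eigG_sub_le hk).trans (le_of_eq ?_)
  ring

end Estimator

/-! ### The error along the curves for a fixed sample -/

lemma IsBump.continuous_deviation {μ : Measure Plane} [IsFiniteMeasure μ] {θ : Plane → ℝ} {C : ℝ}
    (hθ : IsBump θ C) (h : ℝ) (n : ℕ) (y : ℕ → Plane) :
    Continuous fun x => deviation μ (fun z => θ (h⁻¹ • (x - z))) n y := by
  have hθc := hθ.continuous
  have : Continuous fun x => ∫ z, θ (h⁻¹ • (x - z)) ∂μ :=
    continuous_of_dominated (bound := fun _ => C)
      (fun x => Continuous.aestronglyMeasurable (by fun_prop))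
      (fun x => ae_of_all _ fun z => hθ.bound _) (integrable_const C)
      (ae_of_all _ fun z => by fun_prop)
  exact Continuous.sub (by fun_prop) this

/-- The weights in the first order expansion of the field along a curve: the constant `1` and the
coordinates of the cut off derivative of the eigenvalue gap. -/
noncomputable def weight (f : Plane → ℝ) (c : ℝ) : Option (Fin 2) → Plane → ℝ
  | none, _ => 1
  | some i, x => cutDir c (gapVec (d2 f x)) i

lemma abs_weight_le (f : Plane → ℝ) {c : ℝ} (hc : 0 < c) (j : Option (Fin 2)) (x : Plane) :
    |weight f c j x| ≤ 1 := by
  cases j with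
  | none => simp [weight]
  | some i => exact (abs_apply_le_norm _ i).trans (norm_cutDir_le hc _)

section Fixed

variable {f K : Plane → ℝ} {C C' c : ℝ}

lemma abs_weight_sub_le (hf : FourDerivs f C) (hc : 0 < c) (j : Option (Fin 2)) (x y : Plane) :
    |weight f c j x - weight f c j y| ≤ 8 * C / c * ‖x - y‖ := by
  have hC := hf.nonneg
  cases j with
  | none =>
    simp only [weight, sub_self, abs_zero]
    positivity
  | some i =>
    have h1 := norm_cutDir_sub_le hc (gapVec (d2 f x)) (gapVec (d2 f y))
    have h2 : ‖gapVec (d2 f x) - gapVec (d2 f y)‖ ≤ 4 * (C * ‖x - y‖) := by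
      rw [← gapVec_sub]
      refine norm_gapVec_le fun k => ?_
      rw [Pi.sub_apply, d2_apply, d2_apply]
      exact hf.abs_two_sub_le _ _ x y
    have h3 : |weight f c (some i) x - weight f c (some i) y|
        ≤ ‖cutDir c (gapVec (d2 f x)) - cutDir c (gapVec (d2 f y))‖ :=
      abs_apply_le_norm (cutDir c (gapVec (d2 f x)) - cutDir c (gapVec (d2 f y))) i
    calc _ ≤ 2 / c * (4 * (C * ‖x - y‖)) := (h3.trans h1).trans (by gcongr)
      _ = _ := by ring

lemma continuous_weight (hf : FourDerivs f C) (hc : 0 < c) (j : Option (Fin 2)) :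
    Continuous (weight f c j) := by
  have hC := hf.nonneg
  have : LipschitzWith ⟨8 * C / c, by positivity⟩ (weight f c j) :=
    LipschitzWith.of_dist_le_mul fun x y => by
      rw [Real.dist_eq, dist_eq_norm]
      exact abs_weight_sub_le hf hc j x y
  exact this.continuous

variable {h : ℝ} {n : ℕ} {y : ℕ → Plane} {R T γ B : ℝ}

lemma continuous_d2_kde (hK : FourDerivs K C') (h : ℝ) (n : ℕ) (y : ℕ → Plane) :
    Continuous (d2 (kde K h n y)) := by
  refine continuous_pi fun k => ?_
  simp only [d2_apply, partialDeriv_two_kde hK]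
  exact continuous_iff_continuousAt.2 fun x =>
    (hasFDerivAt_kernelSum _ (hK.differentiable_two _ _) _ _ _ x).continuousAt

/-- Integrals along a curve of the weighted error of the second derivatives: the deviation of the
curve averages, and the bias. -/
lemma abs_integral_weight_mul_le [IsFiniteMeasure (densityMeasure f)] (hfd : IsDensity f)
    (hf : FourDerivs f C) (hK : FourDerivs K C') (hC' : 0 < C') (hKr : KernelRegular K)
    (hc : 0 < c) (hh : 0 < h)
    {X : ℝ → Plane} (hX : Continuous X) {t : ℝ} (ht : |t| ≤ T) {D₃ : ℝ} (j : Option (Fin 2))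
    (k : Fin 3)
    (hdev : |deviation (densityMeasure f) (curveAverage (weight f c j) (fun w => d2 K w k) h X t)
      n y| ≤ D₃) :
    |∫ l in (0 : ℝ)..t, weight f c j (X l) * (d2 (kde K h n y) (X l) k - d2 f (X l) k)|
      ≤ (h ^ 4)⁻¹ * D₃ + T * (C * h ^ 2) := by
  have hC := hf.nonneg
  have hθ : IsBump (fun w => d2 K w k) C' := by
    simp only [d2_apply]
    exact isBump_two hK hC' hKr.eq_zero _ _
  have hwc := continuous_weight hf hc j
  have hw := abs_weight_le f hc j
  rw [hθ.deviation_curveAverage hwc hw hX] at hdev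
  have hdc := hθ.continuous_deviation (μ := densityMeasure f) h n y
  set dev : Plane → ℝ := fun x =>
    deviation (densityMeasure f) (fun z => d2 K (h⁻¹ • (x - z)) k) n y with hdevdef
  have hkc : Continuous fun x => d2 (kde K h n y) x k :=
    (continuous_apply k).comp (continuous_d2_kde hK h n y)
  have hfc : Continuous fun x => d2 f x k := (continuous_apply k).comp (continuous_d2 hf)
  have i1 : IntervalIntegrable (fun l => (h ^ 4)⁻¹ * (weight f c j (X l) * dev (X l))) volume 0 t :=
    Continuous.intervalIntegrable (by fun_prop) _ _
  have i2 : IntervalIntegrable (fun l => weight f c j (X l) *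
      (d2 (kde K h n y) (X l) k - d2 f (X l) k - (h ^ 4)⁻¹ * dev (X l))) volume 0 t :=
    Continuous.intervalIntegrable (by fun_prop) _ _
  have hsplit : ∫ l in (0 : ℝ)..t, weight f c j (X l) * (d2 (kde K h n y) (X l) k - d2 f (X l) k)
      = (h ^ 4)⁻¹ * (∫ l in (0 : ℝ)..t, weight f c j (X l) * dev (X l))
        + ∫ l in (0 : ℝ)..t, weight f c j (X l) *
          (d2 (kde K h n y) (X l) k - d2 f (X l) k - (h ^ 4)⁻¹ * dev (X l)) := by
    rw [← intervalIntegral.integral_const_mul, ← intervalIntegral.integral_add i1 i2]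
    congr 1
    funext l
    ring
  have hbias := intervalIntegral.norm_integral_le_of_norm_le_const (a := 0) (b := t)
    (C := C * h ^ 2) (f := fun l => weight f c j (X l) *
      (d2 (kde K h n y) (X l) k - d2 f (X l) k - (h ^ 4)⁻¹ * dev (X l))) fun l _ => by
      rw [norm_mul]
      calc _ ≤ 1 * (C * h ^ 2) := mul_le_mul (hw _)
            (abs_d2_kde_sub_le hfd hf hK hKr hh k (X l)) (abs_nonneg _) zero_le_one
        _ = _ := one_mul _
  rw [hsplit]
  refine (abs_add_le _ _).trans (add_le_add ?_ ?_)
  · rw [abs_mul, abs_of_pos (by positivity)]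
    gcongr
  · refine hbias.trans ?_
    rw [sub_zero, mul_comm]
    gcongr

/-- The distance of an estimated integral curve from the true one, for a sample for which the
deviations are under control: `D₁` bounds the deviations of the second derivatives at points,
`D₃` those of their weighted integrals along curves, and the deviations of the third derivatives
are small enough for the estimated field to be Lipschitz. -/
lemma norm_curve_sub_le [IsFiniteMeasure (densityMeasure f)] (hfd : IsDensity f)
    (hf : FourDerivs f C) (hK : FourDerivs K C') (hC' : 0 < C') (hKr : KernelRegular K)
    (hc : 0 < c) (hh : 0 < h) {a b : ℝ} (ha : 0 ≤ a) (hb : 0 ≤ b) (haT : a ≤ T) (hbT : b ≤ T)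
    {x₀ : Plane} {X Y : ℝ → Plane} (hX : IsIntegralCurveFrom (eigField f) x₀ X)
    (hY : IsIntegralCurveFrom (eigField (kde K h n y)) x₀ Y)
    (hXR : ∀ t ∈ Set.Icc (-a) b, ‖X t‖ ≤ R - 1)
    (hgap : ∀ t ∈ Set.Icc (-a) b, c ≤ ‖gapVec (d2 f (X t))‖) {D₁ D₃ : ℝ}
    (hD₃0 : 0 ≤ D₃)
    (hD₁ : ∀ k x, ‖x‖ ≤ R → |deviation (densityMeasure f)
      (fun z => d2 K (h⁻¹ • (x - z)) k) n y| ≤ D₁)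
    (hD₂ : ∀ (e : Fin 2) (k : Fin 3) x, ‖x‖ ≤ R → |deviation (densityMeasure f)
      (fun z => partialDeriv e (fun w => d2 K w k) (h⁻¹ • (x - z))) n y| ≤ h ^ 5)
    (hD₃ : ∀ t ∈ Set.Icc (-a) b, ∀ j k, |deviation (densityMeasure f)
      (curveAverage (weight f c j) (fun w => d2 K w k) h X t) n y| ≤ D₃) {δ : ℝ}
    (hδ : 24 * ((h ^ 4)⁻¹ * D₃ + T * (C * h ^ 2))
      + 24 * T * ((h ^ 4)⁻¹ * D₁ + C * h ^ 2) ^ 2 / c ≤ δ)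
    (hsmall : δ * Real.exp (48 * (1 + C) * T) < 1) :
    ∀ t ∈ Set.Icc (-a) b, ‖Y t - X t‖ ≤ δ * Real.exp (48 * (1 + C) * T) := by
  have hC := hf.nonneg
  have hT : 0 ≤ T := ha.trans haT
  have hVc : Continuous (eigField f) := continuous_eigG.comp (continuous_d2 hf)
  have hWc : Continuous (eigField (kde K h n y)) :=
    continuous_eigG.comp (continuous_d2_kde hK h n y)
  refine norm_sub_le_of_perturbation hVc hWc hX hY (by positivity) (le_trans (by positivity) hδ)
    ha hb haT hbT hXR (fun p q hp hq => norm_eigField_kde_sub_le hfd hf hK hKr hh hD₂ hp hq)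
    (fun t ht => ?_) hsmall
  have hsub : ∀ l ∈ Set.uIcc 0 t, l ∈ Set.Icc (-a) b := fun l hl =>
    Set.uIcc_subset_Icc ⟨by linarith, hb⟩ ht hl
  have htT : |t| ≤ T := abs_le.2 ⟨by linarith [ht.1], by linarith [ht.2]⟩
  have hw := fun j k => abs_integral_weight_mul_le hfd hf hK hC' hKr hc hh hX.continuous htT j k
    (hD₃ t ht j k)
  have hmain := norm_integral_eigG_sub_le (p := fun l => d2 f (X l))
    (q := fun l => d2 (kde K h n y) (X l) - d2 f (X l))
    ((continuous_d2 hf).comp hX.continuous)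
    (((continuous_d2_kde hK h n y).comp hX.continuous).sub
      ((continuous_d2 hf).comp hX.continuous)) (Q := (h ^ 4)⁻¹ * D₁ + C * h ^ 2)
    (δ := (h ^ 4)⁻¹ * D₃ + T * (C * h ^ 2)) hc htT
    (fun l hl => hgap l (hsub l hl))
    (fun l hl k => by
      have h1 := abs_d2_kde_sub_le (n := n) (y := y) hfd hf hK hKr hh k (X l)
      have h2 := hD₁ k (X l) (by linarith [hXR l (hsub l hl)])
      have h3 : |(h ^ 4)⁻¹ * deviation (densityMeasure f)
          (fun z => d2 K (h⁻¹ • (X l - z)) k) n y| ≤ (h ^ 4)⁻¹ * D₁ := by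
        rw [abs_mul, abs_of_pos (by positivity)]
        gcongr
      rw [Pi.sub_apply]
      have h4 := abs_add_le (d2 (kde K h n y) (X l) k - d2 f (X l) k - (h ^ 4)⁻¹ *
        deviation (densityMeasure f) (fun z => d2 K (h⁻¹ • (X l - z)) k) n y)
        ((h ^ 4)⁻¹ * deviation (densityMeasure f) (fun z => d2 K (h⁻¹ • (X l - z)) k) n y)
      rw [sub_add_cancel] at h4
      linarith)
    (fun k => by simpa [weight] using hw none k)
    (fun i k => hw (some i) k)
  simp only [add_sub_cancel] at hmain
  exact hmain.trans hδ

end Fixed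

/-! ### Events of high probability and the bandwidth asymptotics -/

/-- The probability that `E n` fails tends to zero. -/
def WithHighProb {Ω : Type*} [MeasurableSpace Ω] (P : Measure Ω) (E : ℕ → Ω → Prop) : Prop :=
  Tendsto (fun n => P {ω | ¬E n ω}) atTop (𝓝 0)

section HighProb

variable {Ω : Type*} [MeasurableSpace Ω] {P : Measure Ω}

lemma withHighProb_of_le {E : ℕ → Ω → Prop} {c : ℝ}
    (hE : ∀ᶠ n : ℕ in atTop, P {ω | ¬E n ω} ≤ ENNReal.ofReal (c / n)) : WithHighProb P E := by
  have h0 : Tendsto (fun n : ℕ => ENNReal.ofReal (c / n)) atTop (𝓝 0) := by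
    rw [← ENNReal.ofReal_zero]
    exact ENNReal.tendsto_ofReal (tendsto_const_div_atTop_nhds_zero_nat c)
  exact tendsto_of_tendsto_of_tendsto_of_le_of_le' tendsto_const_nhds h0
    (Eventually.of_forall fun _ => zero_le) hE

lemma WithHighProb.forall {ι : Type*} [Fintype ι] {E : ι → ℕ → Ω → Prop}
    (hE : ∀ i, WithHighProb P (E i)) : WithHighProb P fun n ω => ∀ i, E i n ω := by
  have h0 : Tendsto (fun n => ∑ i, P {ω | ¬E i n ω}) atTop (𝓝 0) := by
    have := tendsto_finsetSum (Finset.univ : Finset ι) fun i _ => hE i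
    simpa using this
  refine tendsto_of_tendsto_of_tendsto_of_le_of_le tendsto_const_nhds h0 (fun _ => zero_le)
    fun n => ?_
  refine (measure_mono fun ω hω => ?_).trans (measure_iUnion_fintype_le P fun i => {ω | ¬E i n ω})
  rw [Set.mem_ofPred_eq, not_forall] at hω
  exact Set.mem_iUnion.2 hω

lemma WithHighProb.and {E F : ℕ → Ω → Prop} (hE : WithHighProb P E) (hF : WithHighProb P F) :
    WithHighProb P fun n ω => E n ω ∧ F n ω := by
  have h0 : Tendsto (fun n => P {ω | ¬E n ω} + P {ω | ¬F n ω}) atTop (𝓝 0) := by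
    simpa using Tendsto.add hE hF
  refine tendsto_of_tendsto_of_tendsto_of_le_of_le tendsto_const_nhds h0 (fun _ => zero_le)
    fun n => ?_
  refine (measure_mono fun ω hω => ?_).trans (measure_union_le {ω | ¬E n ω} {ω | ¬F n ω})
  rw [Set.mem_ofPred_eq, not_and_or] at hω
  exact hω

lemma WithHighProb.isBigOInProb {E : ℕ → Ω → Prop} (hE : WithHighProb P E) {Z : ℕ → Ω → ℝ≥0∞}
    {r : ℕ → ℝ} {M : ℝ}
    (h : ∀ᶠ n in atTop, ∀ ω, E n ω → Z n ω ≤ ENNReal.ofReal (M * r n)) : IsBigOInProb P Z r := by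
  intro ε hε
  refine ⟨M, ?_⟩
  have h1 : ∀ᶠ n in atTop, P {ω | ¬E n ω} < ENNReal.ofReal ε :=
    hE.eventually_lt_const (ENNReal.ofReal_pos.2 hε)
  filter_upwards [h, h1] with n hn hn1
  refine (measure_mono fun ω hω => ?_).trans hn1.le
  rw [Set.mem_ofPred_eq] at hω ⊢
  exact fun hEω => absurd (hn ω hEω) (not_le.2 hω)

end HighProb

lemma BandwidthCondition.eventually_le {h : ℕ → ℝ} (hh : BandwidthCondition h) {D : ℝ}
    (hD : 0 ≤ D) : ∀ᶠ n : ℕ in atTop, 2 ≤ n ∧ 1 ≤ Real.log n ∧ h n ≤ 1 ∧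
      D * Real.log n ≤ n * h n ^ 8 := by
  have hlog : Tendsto (fun n : ℕ => Real.log n) atTop atTop :=
    Real.tendsto_log_atTop.comp tendsto_natCast_atTop_atTop
  filter_upwards [eventually_ge_atTop 2, hlog.eventually_ge_atTop 1,
    hh.tendsto_zero.eventually_le_const zero_lt_one, hh.lower.eventually_ge_atTop D]
    with n h2 hL h1 hlow
  refine ⟨h2, hL, h1, ?_⟩
  rw [le_div_iff₀ (by positivity)] at hlow
  refine le_trans ?_ hlow
  gcongr
  exact le_self_pow₀ hL (by norm_num)

section Rates

variable {n h L : ℝ}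

/-- The rate `√(log n / (n h ^ 5))` with a free variable `L` for the logarithm. -/
noncomputable def curveRate (n h L : ℝ) : ℝ := √(L / (n * h ^ 5))

lemma inv_le_curveRate (hn : 1 ≤ n) (hh : 0 < h) (hh1 : h ≤ 1) (hL : 1 ≤ L) :
    1 / n ≤ curveRate n h L := by
  have hn0 : 0 < n := by linarith
  refine Real.le_sqrt_of_sq_le ?_
  rw [div_pow, one_pow, div_le_div_iff₀ (by positivity) (by positivity)]
  have h5 : h ^ 5 ≤ 1 := pow_le_one₀ hh.le hh1
  calc 1 * (n * h ^ 5) ≤ 1 * (n * 1) := by gcongr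
    _ ≤ L * (n * n) := by gcongr
    _ = L * n ^ 2 := by ring

lemma inv_pow_five_div_sq_le (hn : 1 ≤ n) (hh : 0 < h) (hh1 : h ≤ 1) (hL : 1 ≤ L)
    (hlow : L ≤ n * h ^ 8) : (h ^ 5)⁻¹ / n ^ 2 ≤ 1 / n := by
  have hn0 : 0 < n := by linarith
  have h8 : h ^ 8 ≤ h ^ 5 := pow_le_pow_of_le_one hh.le hh1 (by norm_num)
  rw [inv_eq_one_div, div_div, div_le_div_iff₀ (by positivity) hn0]
  have : 1 ≤ n * h ^ 5 := by nlinarith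
  nlinarith

lemma sq_le_curveRate (hn : 1 ≤ n) (hh : 0 < h) (hL : 1 ≤ L) {β : ℝ}
    (hup : n * h ^ 9 ≤ β) : h ^ 2 ≤ √β * curveRate n h L := by
  have hn0 : 0 < n := by linarith
  have hβ : 0 ≤ β := le_trans (by positivity) hup
  rw [curveRate, ← Real.sqrt_mul hβ]
  refine Real.le_sqrt_of_sq_le ?_
  rw [← mul_div_assoc, le_div_iff₀ (by positivity)]
  calc (h ^ 2) ^ 2 * (n * h ^ 5) = n * h ^ 9 * 1 := by ring
    _ ≤ β * L := by gcongr

/-- The deviation along curves, at the scale of second derivatives. -/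
lemma curve_deviation_le (hn : 1 ≤ n) (hh : 0 < h) (hh1 : h ≤ 1) (hL : 1 ≤ L)
    (hlow : L ≤ n * h ^ 8) {a b : ℝ} (ha : 0 ≤ a) (hb : 0 ≤ b) :
    (h ^ 4)⁻¹ * (8 * √(a * h ^ 3 * L / n) + 2 * (b * h⁻¹) / n ^ 2)
      ≤ (8 * √a + 2 * b) * curveRate n h L := by
  have hn0 : 0 < n := by linarith
  have e1 : √(a * h ^ 3 * L / n) = √a * (h ^ 4 * curveRate n h L) := by
    rw [curveRate, ← Real.sqrt_sq (show 0 ≤ h ^ 4 by positivity), ← Real.sqrt_mul (by positivity),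
      ← Real.sqrt_mul ha]
    congr 1
    field_simp
  have e2 : (h ^ 4)⁻¹ * (2 * (b * h⁻¹) / n ^ 2) = 2 * b * ((h ^ 5)⁻¹ / n ^ 2) := by
    field_simp
  have h3 := (inv_pow_five_div_sq_le hn hh hh1 hL hlow).trans (inv_le_curveRate hn hh hh1 hL)
  rw [mul_add, e2, e1]
  have e3 : (h ^ 4)⁻¹ * (8 * (√a * (h ^ 4 * curveRate n h L))) = 8 * √a * curveRate n h L := by
    field_simp
  rw [e3, add_mul]
  gcongr

/-- The squared deviation at points, at the scale of second derivatives. It is of the same order as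
the deviation along curves, so that a quadratic remainder does no harm. -/
lemma point_deviation_sq_le (hn : 1 ≤ n) (hh : 0 < h) (hh1 : h ≤ 1) (hL : 1 ≤ L)
    (hlow : L ≤ n * h ^ 8) {a b : ℝ} (ha : 0 ≤ a) (hb : 0 ≤ b) :
    ((h ^ 4)⁻¹ * (8 * √(a * h ^ 2 * L / n) + 4 * b * h⁻¹ / n ^ 2)) ^ 2
      ≤ (8 * √a + 4 * b) ^ 2 * curveRate n h L := by
  have hn0 : 0 < n := by linarith
  set q := √(L / (n * h ^ 6)) with hq
  have hq0 : 0 ≤ q := Real.sqrt_nonneg _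
  have e1 : √(a * h ^ 2 * L / n) = √a * (h ^ 4 * q) := by
    rw [hq, ← Real.sqrt_sq (show 0 ≤ h ^ 4 by positivity), ← Real.sqrt_mul (by positivity),
      ← Real.sqrt_mul ha]
    congr 1
    field_simp
  have e2 : (h ^ 4)⁻¹ * (4 * b * h⁻¹ / n ^ 2) = 4 * b * ((h ^ 5)⁻¹ / n ^ 2) := by
    field_simp
  have e3 : (h ^ 4)⁻¹ * (8 * (√a * (h ^ 4 * q))) = 8 * √a * q := by
    field_simp
  have hrq : curveRate n h L ≤ q := by
    refine Real.sqrt_le_sqrt ?_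
    have : h ^ 6 ≤ h ^ 5 := pow_le_pow_of_le_one hh.le hh1 (by norm_num)
    gcongr
  have h3 := ((inv_pow_five_div_sq_le hn hh hh1 hL hlow).trans
    (inv_le_curveRate hn hh hh1 hL)).trans hrq
  have hqr : q ^ 2 ≤ curveRate n h L := by
    rw [hq, Real.sq_sqrt (by positivity)]
    refine Real.le_sqrt_of_sq_le ?_
    have h87 : h ^ 8 ≤ h ^ 7 := pow_le_pow_of_le_one hh.le hh1 (by norm_num)
    have hL7 : L ≤ n * h ^ 7 := hlow.trans (by gcongr)
    rw [div_pow, div_le_div_iff₀ (by positivity) (by positivity)]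
    calc L ^ 2 * (n * h ^ 5) = L * (n * h ^ 5) * L := by ring
      _ ≤ L * (n * h ^ 5) * (n * h ^ 7) := by gcongr
      _ = L * (n * h ^ 6) ^ 2 := by ring
  rw [mul_add, e2, e1, e3]
  calc (8 * √a * q + 4 * b * ((h ^ 5)⁻¹ / n ^ 2)) ^ 2 ≤ (8 * √a * q + 4 * b * q) ^ 2 := by gcongr
    _ = (8 * √a + 4 * b) ^ 2 * q ^ 2 := by ring
    _ ≤ _ := by gcongr

/-- The deviation of third derivatives at points is of the order `1`. -/
lemma third_deviation_le (hn : 1 ≤ n) (hh : 0 < h) (hh1 : h ≤ 1) (hL : 1 ≤ L) {a b : ℝ}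
    (ha : 0 ≤ a) (hb : 0 ≤ b) (hlow : (256 * a + 8 * b + 1) * L ≤ n * h ^ 8) :
    8 * √(a * h ^ 2 * L / n) + 4 * b * h⁻¹ / n ^ 2 ≤ h ^ 5 := by
  have hn0 : 0 < n := by linarith
  have hbL : 0 ≤ b * L := by positivity
  have haL : 0 ≤ a * L := by positivity
  have h1 : √(a * h ^ 2 * L / n) ≤ h ^ 5 / 16 := by
    refine Real.sqrt_le_iff.2 ⟨by positivity, ?_⟩
    rw [div_le_iff₀ hn0]
    have : 256 * (a * L) ≤ n * h ^ 8 := by nlinarith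
    nlinarith [mul_le_mul_of_nonneg_left this (sq_nonneg h)]
  have h2 : 4 * b * h⁻¹ / n ^ 2 ≤ h ^ 5 / 2 := by
    rw [← div_eq_mul_inv, div_div, div_le_div_iff₀ (by positivity) two_pos]
    have h86 : h ^ 8 ≤ h ^ 6 := pow_le_pow_of_le_one hh.le hh1 (by norm_num)
    have hb8 : b * 8 ≤ n * h ^ 8 := by nlinarith
    calc 4 * b * 2 = b * 8 * 1 := by ring
      _ ≤ n * h ^ 8 * n := by gcongr
      _ ≤ n * h ^ 6 * n := by gcongr
      _ = h ^ 5 * (h * n ^ 2) := by ring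
  linarith

lemma curveRate_le {ε : ℝ} (hε : 0 < ε) (hn : 1 ≤ n) (hh : 0 < h) (hh1 : h ≤ 1)
    (hlow : 1 / ε ^ 2 * L ≤ n * h ^ 8) : curveRate n h L ≤ ε := by
  have hn0 : 0 < n := by linarith
  refine Real.sqrt_le_iff.2 ⟨hε.le, ?_⟩
  rw [div_le_iff₀ (by positivity)]
  have h85 : h ^ 8 ≤ h ^ 5 := pow_le_pow_of_le_one hh.le hh1 (by norm_num)
  calc L = ε ^ 2 * (1 / ε ^ 2 * L) := by field_simp
    _ ≤ ε ^ 2 * (n * h ^ 5) := mul_le_mul_of_nonneg_left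
      (hlow.trans (mul_le_mul_of_nonneg_left h85 hn0.le)) (sq_nonneg ε)

/-- The three contributions to the error of an integral curve (deviation along curves, bias, and the
quadratic remainder) are all of the order of the rate. -/
lemma total_error_le (hn : 1 ≤ n) (hh : 0 < h) (hh1 : h ≤ 1) (hL : 1 ≤ L) (hlow : L ≤ n * h ^ 8)
    {β a₁ b₁ a₃ b₃ T C c : ℝ} (hup : n * h ^ 9 ≤ β) (ha₁ : 0 ≤ a₁) (hb₁ : 0 ≤ b₁) (ha₃ : 0 ≤ a₃)
    (hb₃ : 0 ≤ b₃) (hT : 0 ≤ T) (hC : 0 ≤ C) (hc : 0 < c) :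
    24 * ((h ^ 4)⁻¹ * (8 * √(a₃ * h ^ 3 * L / n) + 2 * (b₃ * h⁻¹) / n ^ 2) + T * (C * h ^ 2))
      + 24 * T * ((h ^ 4)⁻¹ * (8 * √(a₁ * h ^ 2 * L / n) + 4 * b₁ * h⁻¹ / n ^ 2) + C * h ^ 2) ^ 2 / c
      ≤ (24 * (8 * √a₃ + 2 * b₃ + T * (C * √β))
        + 24 * T * (2 * (8 * √a₁ + 4 * b₁) ^ 2 + 2 * (C ^ 2 * √β)) / c) * curveRate n h L := by
  have e1 := curve_deviation_le hn hh hh1 hL hlow ha₃ hb₃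
  have e2 := point_deviation_sq_le hn hh hh1 hL hlow ha₁ hb₁
  have e3 := sq_le_curveRate hn hh hL hup
  have e4 : h ^ 4 ≤ h ^ 2 := pow_le_pow_of_le_one hh.le hh1 (by norm_num)
  generalize (h ^ 4)⁻¹ * (8 * √(a₃ * h ^ 3 * L / n) + 2 * (b₃ * h⁻¹) / n ^ 2) = w at e1 ⊢
  generalize (h ^ 4)⁻¹ * (8 * √(a₁ * h ^ 2 * L / n) + 4 * b₁ * h⁻¹ / n ^ 2) = u at e2 ⊢
  generalize curveRate n h L = r at *
  generalize 8 * √a₃ + 2 * b₃ = M₃ at *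
  generalize (8 * √a₁ + 4 * b₁) ^ 2 = M₁ at *
  generalize √β = s at *
  have e5 : (u + C * h ^ 2) ^ 2 ≤ (2 * M₁ + 2 * (C ^ 2 * s)) * r := by
    calc (u + C * h ^ 2) ^ 2 ≤ 2 * u ^ 2 + 2 * (C ^ 2 * h ^ 4) := by
          nlinarith [sq_nonneg (u - C * h ^ 2)]
      _ ≤ 2 * (M₁ * r) + 2 * (C ^ 2 * (s * r)) := by
          have := mul_le_mul_of_nonneg_left (e4.trans e3) (sq_nonneg C)
          linarith
      _ = _ := by ring
  calc _ ≤ 24 * (M₃ * r + T * (C * (s * r)))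
        + 24 * T * ((2 * M₁ + 2 * (C ^ 2 * s)) * r) / c := by gcongr
    _ = _ := by ring

end Rates

/-! ### Error bounds of high probability -/

section Assembly

variable {Ω : Type*} [MeasurableSpace Ω] {P : Measure Ω} [IsProbabilityMeasure P]
  {μ : Measure Plane} [IsProbabilityMeasure μ] {ξ : ℕ → Ω → Plane} {θ : Plane → ℝ}
  {C A R : ℝ} {h : ℕ → ℝ}

lemma IsBump.withHighProb_point (hθ : IsBump θ C) (hξ : ∀ i, Measurable (ξ i))
    (hind : iIndepFun ξ P) (hlaw : ∀ i, P.map (ξ i) = μ) (hμ : SmallBallBound μ R A)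
    (hR : 0 ≤ R) (hA : 0 < A) (hh : BandwidthCondition h) :
    WithHighProb P fun n ω => ∀ x, ‖x‖ ≤ R →
      |deviation μ (fun y => θ ((h n)⁻¹ • (x - y))) n fun i => ξ i ω|
        ≤ 8 * √(C ^ 2 * A * h n ^ 2 * Real.log n / n) + 4 * C * (h n)⁻¹ / n ^ 2 := by
  refine withHighProb_of_le (c := 2 * (2 * R + 3) ^ 3) ?_
  filter_upwards [hh.eventually_le (D := 4 / A) (by positivity)] with n ⟨hn, hL, hh1, hlow⟩
  have h0 := hh.pos n
  refine (measure_mono fun ω hω => ?_).trans (hθ.measure_exists_point_le hξ hind hlaw hμ hR hA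
    h0 hh1 hn ?_)
  · rw [Set.mem_ofPred_eq] at hω ⊢
    push Not at hω
    exact hω
  · have h82 : h n ^ 8 ≤ h n ^ 2 := pow_le_pow_of_le_one h0.le hh1 (by norm_num)
    calc 4 * Real.log n = A * (4 / A * Real.log n) := by field_simp
      _ ≤ A * (n * h n ^ 2) := by
        refine mul_le_mul_of_nonneg_left (hlow.trans ?_) hA.le
        gcongr
      _ = _ := by ring

lemma IsBump.withHighProb_curve {α : Plane → ℝ} {D T γ B : ℝ} (hθ : IsBump θ C)
    (hαc : Continuous α) (hα : ∀ x, |α x| ≤ 1)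
    (hαL : ∀ x y, |α x - α y| ≤ D * ‖x - y‖) (hD : 0 ≤ D) (hξ : ∀ i, Measurable (ξ i))
    (hind : iIndepFun ξ P) (hlaw : ∀ i, P.map (ξ i) = μ) (hμ : SmallBallBound μ R A)
    (hA : 0 < A) {S : Set (Plane × ℝ)} {X : Plane → ℝ → Plane}
    (hX : IsCurveFamily S X R T γ B) (hγ : 0 < γ) (hT : 0 < T) (hB : 0 ≤ B) (hR : 0 ≤ R)
    (hh : BandwidthCondition h) :
    WithHighProb P fun n ω => ∀ p ∈ S,
      |deviation μ (curveAverage α θ (h n) (X p.1) p.2) n fun i => ξ i ω|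
        ≤ 8 * √(2 * T * C ^ 2 * A / γ * h n ^ 3 * Real.log n / n)
          + 2 * ((C + T * (2 * B) * C * (D + 1)) * (h n)⁻¹) / n ^ 2 := by
  refine withHighProb_of_le (c := 2 * (2 * (R + T) + 3) ^ 3) ?_
  filter_upwards [hh.eventually_le (D := 8 / (γ * T * A)) (by positivity)]
    with n ⟨hn, hL, hh1, hlow⟩
  have h0 := hh.pos n
  refine (measure_mono fun ω hω => ?_).trans (hθ.measure_exists_curve_le hαc hα hαL hD hξ hind
    hlaw hμ hA hX hγ hT hB hR h0 hh1 hn ?_)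
  · rw [Set.mem_ofPred_eq] at hω ⊢
    push Not at hω
    exact hω
  · have h81 : h n ^ 8 ≤ h n := pow_le_of_le_one h0.le hh1 (by norm_num)
    calc 8 * Real.log n = γ * T * A * (8 / (γ * T * A) * Real.log n) := by field_simp
      _ ≤ γ * T * A * (n * h n) := by
        refine mul_le_mul_of_nonneg_left (hlow.trans ?_) (by positivity)
        gcongr
      _ = _ := by ring

end Assembly

/-- The true integral curves, up to the given times, form a curve family: the lower bound on the
mean velocities is a lower bound on the distances between the points of a curve, and bounds the
time that a curve can spend in the bounded region. -/
lemma isCurveFamily_integralCurve {f : Plane → ℝ} {C R γ : ℝ} (hf : FourDerivs f C)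
    {G H : Set Plane} (hHR : ∀ x ∈ H, ‖x‖ ≤ R) {Tmin Tmax : Plane → ℝ}
    (hTmin : ∀ x₀ ∈ G, 0 ≤ Tmin x₀) (hTmax : ∀ x₀ ∈ G, 0 ≤ Tmax x₀)
    (hsub : ∀ x₀ ∈ G, ∀ t ∈ Set.Icc (-Tmin x₀) (Tmax x₀), integralCurve (eigField f) x₀ t ∈ H)
    (hγ : 0 < γ)
    (hlow : ∀ x₀ ∈ G, ∀ s u : ℝ, -Tmin x₀ ≤ s → s < u → u ≤ Tmax x₀ →
      γ ≤ ‖(u - s)⁻¹ • ∫ l in s..u, eigField f (integralCurve (eigField f) x₀ l)‖) :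
    IsCurveFamily {p | p.1 ∈ G ∧ p.2 ∈ Set.Icc (-Tmin p.1) (Tmax p.1)}
      (integralCurve (eigField f)) (R + 1) (2 * R / γ + 1) γ
      (Real.exp (24 * C * (2 * R / γ + 1))) := by
  have hVL := hf.lipschitzWith_eigField
  have hX := isIntegralCurveFrom_integralCurve hVL
  have h0 : ∀ x₀ ∈ G, (0 : ℝ) ∈ Set.Icc (-Tmin x₀) (Tmax x₀) := fun x₀ hx =>
    ⟨by linarith [hTmin x₀ hx], hTmax x₀ hx⟩
  have hspeed : ∀ x₀ ∈ G, ∀ s ∈ Set.Icc (-Tmin x₀) (Tmax x₀),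
      ∀ u ∈ Set.Icc (-Tmin x₀) (Tmax x₀), γ * |u - s|
        ≤ ‖integralCurve (eigField f) x₀ u - integralCurve (eigField f) x₀ s‖ := by
    intro x₀ hx s hs u hu
    have key : ∀ s u : ℝ, -Tmin x₀ ≤ s → s < u → u ≤ Tmax x₀ → γ * |u - s|
        ≤ ‖integralCurve (eigField f) x₀ u - integralCurve (eigField f) x₀ s‖ :=
      fun s u hs hsu hu => by
      have := hlow x₀ hx s u hs hsu hu
      rw [integral_field_along_curve hVL.continuous (hX x₀), norm_smul, norm_inv,
        Real.norm_eq_abs, ← div_eq_inv_mul, le_div_iff₀ (abs_pos.2 (by linarith))] at this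
      exact this
    rcases lt_trichotomy s u with hsu | rfl | hsu
    · exact key s u hs.1 hsu hu.2
    · simp
    · rw [abs_sub_comm, norm_sub_rev]
      exact key u s hu.1 hsu hs.2
  have hsub' : ∀ x₀ ∈ G, ∀ t ∈ Set.Icc (-Tmin x₀) (Tmax x₀), ∀ l ∈ Set.uIcc 0 t,
      l ∈ Set.Icc (-Tmin x₀) (Tmax x₀) := fun x₀ hx t ht l hl =>
    Set.uIcc_subset_Icc (h0 x₀ hx) ht hl
  refine ⟨fun p _ => (hX p.1).continuous, fun p hp => ?_, fun p hp => ?_, fun p hp l hl => ?_,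
    fun p hp s hs u hu => hspeed p.1 hp.1 s (hsub' _ hp.1 _ hp.2 s hs) u
      (hsub' _ hp.1 _ hp.2 u hu), fun p _ p' _ l hl => ?_⟩
  · have := hHR _ (hsub p.1 hp.1 0 (h0 _ hp.1))
    rw [(hX p.1).1] at this
    linarith
  · have h1 := hspeed p.1 hp.1 0 (h0 _ hp.1) p.2 hp.2
    rw [sub_zero] at h1
    have h2 := hHR _ (hsub p.1 hp.1 0 (h0 _ hp.1))
    have h3 := hHR _ (hsub p.1 hp.1 p.2 hp.2)
    have h4 : |p.2| ≤ 2 * R / γ := by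
      rw [le_div_iff₀ hγ, mul_comm]
      refine h1.trans ((norm_sub_le _ _).trans ?_)
      linarith
    linarith
  · have := hHR _ (hsub p.1 hp.1 l (hsub' _ hp.1 _ hp.2 l hl))
    linarith
  · rw [mul_comm]
    exact (hX p.1).norm_sub_le hVL (hX p'.1) hl

end IntegralCurveEstimation

open IntegralCurveEstimation in
theorem theorem3p3
    {Ω : Type*} [MeasurableSpace Ω] (P : Measure Ω) [IsProbabilityMeasure P]
    (f K : Plane → ℝ) (h : ℕ → ℝ) (ξ : ℕ → Ω → Plane) (H L : Set Plane) (a γ : ℝ)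
    (Tmin Tmax : Plane → ℝ)
    (hf : SmoothDensity f) (hH : RegularRegion f H)
    (hK : KernelRegular K) (hK2 : KernelRoughnessFinite K)
    (hh : BandwidthCondition h) (hξ : IsIIDSample P f ξ)
    (ha : 0 ≤ a)
    (hTmin : ∀ x₀ ∈ startSet (eigField f) L a, 0 ≤ Tmin x₀)
    (hTmax : ∀ x₀ ∈ startSet (eigField f) L a, 0 ≤ Tmax x₀)
    (hTpos : ∀ x₀ ∈ startSet (eigField f) L a, 0 < Tmin x₀ + Tmax x₀)
    (hTmin_cont : ContinuousOn Tmin (startSet (eigField f) L a))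
    (hTmax_cont : ContinuousOn Tmax (startSet (eigField f) L a))
    (hsub : ∀ x₀ ∈ startSet (eigField f) L a, ∀ t ∈ Set.Icc (-Tmin x₀) (Tmax x₀),
      integralCurve (eigField f) x₀ t ∈ H)
    (hγ : 0 < γ)
    (hlow : ∀ x₀ ∈ startSet (eigField f) L a, ∀ s u : ℝ,
      -Tmin x₀ ≤ s → s < u → u ≤ Tmax x₀ →
        γ ≤ ‖(u - s)⁻¹ • ∫ l in s..u, eigField f (integralCurve (eigField f) x₀ l)‖) :
    (∀ x₀, ∃! c, IsIntegralCurveFrom (eigField f) x₀ c) ∧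
    (∀ n ω x₀, ∃! c,
      IsIntegralCurveFrom (eigField (kde K (h n) n fun i => ξ i ω)) x₀ c) ∧
    IsBigOInProb P
      (fun n ω => ⨆ x₀ ∈ startSet (eigField f) L a, ⨆ t ∈ Set.Icc (-Tmin x₀) (Tmax x₀),
        ‖integralCurve (eigField (kde K (h n) n fun i => ξ i ω)) x₀ t
          - integralCurve (eigField f) x₀ t‖ₑ)
      (fun n => √(Real.log n / (n * h n ^ 5))) := by
  obtain ⟨Cf, hf4⟩ := hf.exists_fourDerivs
  obtain ⟨CK', hK4'⟩ := hK.exists_fourDerivs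
  -- `IsBump` asks for a positive constant.
  obtain ⟨CK, hCK, hK4⟩ : ∃ CK, 0 < CK ∧ FourDerivs K CK :=
    ⟨CK' + 1, by linarith [hK4'.nonneg], hK4'.mono (by linarith)⟩
  have hCf := hf4.nonneg
  have hVL := hf4.lipschitzWith_eigField
  have hWL := fun n ω => exists_lipschitzWith_eigField_kde hK4 (h n) n fun i => ξ i ω
  refine ⟨existsUnique_integralCurve hVL, fun n ω => ?_, ?_⟩
  · obtain ⟨_, hW⟩ := hWL n ω
    exact existsUnique_integralCurve hW
  set G := startSet (eigField f) L a
  have hX := isIntegralCurveFrom_integralCurve hVL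
  have hY : ∀ n ω x₀, IsIntegralCurveFrom (eigField (kde K (h n) n fun i => ξ i ω)) x₀
      (integralCurve (eigField (kde K (h n) n fun i => ξ i ω)) x₀) := fun n ω x₀ => by
    obtain ⟨_, hW⟩ := hWL n ω
    exact isIntegralCurveFrom_integralCurve hW x₀
  -- Constants that describe the region and the law of the sample.
  obtain ⟨R, hR, hHR⟩ : ∃ R, 0 ≤ R ∧ ∀ x ∈ H, ‖x‖ ≤ R := by
    obtain ⟨R, hR⟩ := hH.isCompact.isBounded.exists_norm_le
    exact ⟨max R 0, le_max_right _ _, fun x hx => (hR x hx).trans (le_max_left _ _)⟩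
  obtain ⟨c, hc, hgap⟩ := hH.exists_gap (continuous_d2 hf4)
  obtain ⟨A, hA, hsmallball⟩ := exists_smallBallBound hf.contDiff.continuous (R + 1)
  have hlaw : ∀ i, P.map (ξ i) = densityMeasure f := hξ.law
  have : IsProbabilityMeasure (densityMeasure f) := by
    rw [← hlaw 0]
    exact Measure.isProbabilityMeasure_map (hξ.measurable 0).aemeasurable
  set T := 2 * R / γ + 1 with hT
  have hT0 : 0 < T := by positivity
  have hfam := isCurveFamily_integralCurve hf4 hHR hTmin hTmax hsub hγ hlow
  rw [← hT] at hfam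
  set B := Real.exp (24 * Cf * T) with hB
  have hB0 : 0 ≤ B := (Real.exp_pos _).le
  set D := 8 * Cf / c with hD
  have hD0 : 0 ≤ D := by positivity
  have hbump2 : ∀ k : Fin 3, IsBump (fun w => d2 K w k) CK := fun k => by
    simp only [d2_apply]
    exact isBump_two hK4 hCK hK.eq_zero _ _
  have hbump3 : ∀ (e : Fin 2) (k : Fin 3), IsBump (partialDeriv e fun w => d2 K w k) CK :=
    fun e k => by
    simp only [d2_apply]
    exact isBump_three hK4 hCK hK.eq_zero e _ _
  -- With high probability all deviations that matter are under control.
  have hgood := ((WithHighProb.forall fun k => (hbump2 k).withHighProb_point hξ.measurable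
      hξ.indep hlaw hsmallball (by positivity) hA hh).and
    (WithHighProb.forall fun q : Fin 2 × Fin 3 => (hbump3 q.1 q.2).withHighProb_point
      hξ.measurable hξ.indep hlaw hsmallball (by positivity) hA hh)).and
    (WithHighProb.forall fun q : Option (Fin 2) × Fin 3 => (hbump2 q.2).withHighProb_curve
      (continuous_weight hf4 hc q.1) (abs_weight_le f hc q.1) (abs_weight_sub_le hf4 hc q.1) hD0
      hξ.measurable hξ.indep hlaw hsmallball hA hfam hγ hT0 hB0 (by positivity) hh)
  obtain ⟨β, hβ, hβlim⟩ := hh.upper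
  -- Constants of the deviations along curves and at points.
  set a₃ := 2 * T * CK ^ 2 * A / γ with ha₃
  set b₃ := CK + T * (2 * B) * CK * (D + 1) with hb₃
  set a₁ := CK ^ 2 * A with ha₁
  have ha₃0 : 0 ≤ a₃ := by positivity
  have hb₃0 : 0 ≤ b₃ := by positivity
  have ha₁0 : 0 ≤ a₁ := by positivity
  set M := 24 * (8 * √a₃ + 2 * b₃ + T * (Cf * √(β + 1)))
    + 24 * T * (2 * (8 * √a₁ + 4 * CK) ^ 2 + 2 * (Cf ^ 2 * √(β + 1))) / c with hM
  have hM0 : 0 ≤ M := by positivity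
  set Ex := Real.exp (48 * (1 + Cf) * T) with hEx
  have hEx0 : 0 < Ex := Real.exp_pos _
  have hε : 0 < 1 / (M * Ex + 1) := by positivity
  refine hgood.isBigOInProb (M := M * Ex) ?_
  filter_upwards [hh.eventually_le (D := 1) zero_le_one,
    hh.eventually_le (D := 256 * a₁ + 8 * CK + 1) (by positivity),
    hh.eventually_le (D := 1 / (1 / (M * Ex + 1)) ^ 2) (by positivity),
    hβlim.eventually_le_const (show β < β + 1 by linarith)]
    with n ⟨hn, hL1, hh1, hlow1⟩ ⟨_, _, _, hlow2⟩ ⟨_, _, _, hlow3⟩ hup ω ⟨⟨g1, g2⟩, g3⟩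
  have hn1 : (1 : ℝ) ≤ n := by exact_mod_cast (by lia : 1 ≤ n)
  have h0 := hh.pos n
  rw [one_mul] at hlow1
  set r := curveRate n (h n) (Real.log n) with hr
  have hr0 : 0 ≤ r := Real.sqrt_nonneg _
  show _ ≤ ENNReal.ofReal (M * Ex * r)
  -- The error bound is eventually smaller than the distance of the region from the boundary of
  -- the ball on which the estimated field is under control.
  have hMrE : M * r * Ex < 1 := by
    have h1 := curveRate_le hε hn1 h0 hh1 hlow3
    rw [← hr, le_div_iff₀ (by positivity)] at h1
    rcases hr0.eq_or_lt with h2 | h2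
    · rw [← h2]
      simp
    · nlinarith
  have hδ : 24 * (((h n) ^ 4)⁻¹ * (8 * √(a₃ * h n ^ 3 * Real.log n / n)
        + 2 * (b₃ * (h n)⁻¹) / n ^ 2) + T * (Cf * (h n) ^ 2))
      + 24 * T * (((h n) ^ 4)⁻¹ * (8 * √(a₁ * h n ^ 2 * Real.log n / n)
        + 4 * CK * (h n)⁻¹ / n ^ 2) + Cf * (h n) ^ 2) ^ 2 / c ≤ M * r :=
    total_error_le hn1 h0 hh1 hL1 hlow1 hup ha₁0 hCK.le ha₃0 hb₃0 hT0.le hCf hc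
  refine iSup₂_le fun x₀ hx₀ => iSup₂_le fun t ht => ?_
  rw [← ofReal_norm]
  refine ENNReal.ofReal_le_ofReal ?_
  have hx0 : (0 : ℝ) ∈ Set.Icc (-Tmin x₀) (Tmax x₀) :=
    ⟨by linarith [hTmin x₀ hx₀], hTmax x₀ hx₀⟩
  have htime : ∀ s ∈ Set.Icc (-Tmin x₀) (Tmax x₀), |s| ≤ T := fun s hs =>
    hfam.time (x₀, s) ⟨hx₀, hs⟩
  have hTminT : Tmin x₀ ≤ T := by
    have := htime _ ⟨le_rfl, hx0.1.trans hx0.2⟩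
    rwa [abs_neg, abs_of_nonneg (hTmin x₀ hx₀)] at this
  have hTmaxT : Tmax x₀ ≤ T := (le_abs_self _).trans (htime _ ⟨hx0.1.trans hx0.2, le_rfl⟩)
  have key := norm_curve_sub_le (n := n) (y := fun i => ξ i ω) (R := R + 1) hf.density hf4 hK4 hCK
    hK hc h0 (hTmin x₀ hx₀) (hTmax x₀ hx₀) hTminT hTmaxT (hX x₀) (hY n ω x₀)
    (fun s hs => by
      have := hHR _ (hsub x₀ hx₀ s hs)
      linarith)
    (fun s hs => hgap _ (hsub x₀ hx₀ s hs))
    (D₁ := 8 * √(a₁ * h n ^ 2 * Real.log n / n) + 4 * CK * (h n)⁻¹ / n ^ 2)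
    (D₃ := 8 * √(a₃ * h n ^ 3 * Real.log n / n) + 2 * (b₃ * (h n)⁻¹) / n ^ 2)
    (by positivity) (fun k x hx => g1 k x hx)
    (fun e k x hx => (g2 (e, k) x hx).trans
      (third_deviation_le hn1 h0 hh1 hL1 ha₁0 hCK.le hlow2))
    (fun s hs j k => g3 (j, k) (x₀, s) ⟨hx₀, hs⟩) hδ hMrE t ht
  exact key.trans (le_of_eq (by ring))
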